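/- Notation. Let $\mathfrak S_n$ be the set of permutations of $[n]=\{1,\dots,n\}$. The cycle type of a permutation of $[n]$ is $t=(t_1,\dots,t_n)$, where $t_p$ is its number of $p$-cycles (so $\sum_p p\,t_p=n$, and $t$ is said to have size $n$); a uniform $t$-cyclic permutation is a uniformly random element of the set of permutations with cycle type $t$. For $\tau\in\mathfrak S_n$ and $\pi\in\mathfrak S_r$, let $X_\pi(\tau)$ be the number of subsets $\{i_1<\dots<i_r\}$ of $[n]$ such that, for all $j,k\in[r]$, $\pi(j)>\pi(k)\iff\tau(i_j)>\tau(i_k)$. For points $z_1,\dots,z_r$ of the plane with distinct $x$-coordinates and distinct $y$-coordinates, let $\mathrm{perm}(z_1,\dots,z_r)\in\mathfrak S_r$ be the permutation that maps $i$ to $j$ when the $i$-th point from the left is the $j$-th point from the bottom. For $\pi\in\mathfrak S_r$ and $z\in[0,1]^2$ let $$\psi_\pi(z)=\mathbf P\big(\mathrm{perm}(\hat Z_1,\dots,\hat Z_{r-1},z)=\pi\big),$$ where $\hat Z_1,\dots,\hat Z_{r-1}$ are i.i.d. uniform in $[0,1]^2$. For $p_2\in[0,1]$ let $\Sigma^{p_2}=(\Sigma^{p_2}_{\pi,\rho})_{\pi,\rho\in\mathfrak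 S_r}$ be defined by $$(r-1)!^2\,\Sigma^{p_2}_{\pi,\rho}=\mathrm{Cov}\big(\psi_\pi(U,V),\psi_\rho(U,V)\big)+p_2\,\mathrm{Cov}\big(\psi_\pi(U,V),\psi_\rho(V,U)\big),$$ where $U,V$ are i.i.d. uniform on $[0,1]$. Theorem. Let $r\ge1$ be an integer and let $p_2\in[0,1]$. (1) For each $n$ let $t^{(n)}$ be a cycle type of size $n$, such that $t^{(n)}_1=o(\sqrt n)$ and $2t^{(n)}_2=np_2+o(n)$ as $n\to\infty$, and let $\tau_n$ be a uniform $t^{(n)}$-cyclic permutation. Then, as $n\to\infty$, the following convergence in distribution of random vectors holds: $$\left(\frac{X_\pi(\tau_n)-\binom nr\frac1{r!}}{n^{r-1/2}}\right)_{\pi\in\mathfrak S_r}\longrightarrow\mathcal N\big(0,\Sigma^{p_2}\big),$$ where $\mathcal N(0,\Sigma^{p_2})$ is the (possibly degenerate) centered Gaussian distribution on $\mathbb R^{\mathfrak S_r}$ with covariance matrix $\Sigma^{p_2}$; in particular, $\Sigma^{p_2}$ is symmetric positive semidefinite. (2) The matrix $\Sigma^{p_2}$ has rank $(r-1)^2$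 if $p_2<1$, and rank $r(r-1)/2$ if $p_2=1$. (3) If $r\ge2$, then $\Sigma^{p_2}_{\pi,\pi}>0$ for every $\pi\in\mathfrak S_r$. -/

import Mathlib

namespace PatternCLT

/-- Standardization of a sequence of pairwise distinct numbers: the permutation `τ` with
`τ i < τ j ↔ y i < y j` (see `st_lt_st_iff`; ties, if any, are broken by index). -/
def st {n : ℕ} {α : Type*} [LinearOrder α] (y : Fin n → α) : Equiv.Perm (Fin n) :=
  (Tuple.sort y)⁻¹

theorem st_lt_st_iff {n : ℕ} {α : Type*} [LinearOrder α] {y : Fin n → α}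
    (hy : Function.Injective y) (i j : Fin n) : st y i < st y j ↔ y i < y j := by
  have h : StrictMono (y ∘ Tuple.sort y) :=
    (Tuple.monotone_sort y).strictMono_of_injective (hy.comp (Tuple.sort y).injective)
  have := h.lt_iff_lt (a := st y i) (b := st y j)
  simpa [st] using this.symm

/-- The permutation of a family of points of the plane with distinct x-coordinates and distinct
y-coordinates: it maps `i` to `j` when the `i`-th point from the left is the `j`-th point from
the bottom. -/
noncomputable def perm {n : ℕ} (z : Fin n → ℝ × ℝ) : Equiv.Perm (Fin n) :=
  st fun i => (z (Tuple.sort (fun k => (z k).1) i)).2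

/-- The pattern induced by `τ` on an `r`-element set `I` of positions. -/
def pat {n r : ℕ} (τ : Equiv.Perm (Fin n)) (I : Finset (Fin n)) (hI : I.card = r) :
    Equiv.Perm (Fin r) :=
  st fun j => τ (I.orderEmbOfFin hI j)

/-- The number of `r`-element sets of positions on which `τ` induces the pattern `π`. -/
def patternCount {n r : ℕ} (π : Equiv.Perm (Fin r)) (τ : Equiv.Perm (Fin n)) : ℕ :=
  (Finset.univ.filter fun I : Finset (Fin n) => ∃ hI : I.card = r, pat τ I hI = π).card

/-- Permutations form a finite set: every subset is measurable. -/
instance instMeasurableSpacePerm (n : ℕ) : MeasurableSpace (Equiv.Perm (Fin n)) := ⊤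

/-- The permutations of cycle type `t`. A cycle type of size `n` is encoded as the partition of
`n` into the cycle lengths (fixed points included), so that `t_p = t.parts.count p`. -/
def cyclicPerms {n : ℕ} (t : n.Partition) : Set (Equiv.Perm (Fin n)) :=
  {σ | σ.partition.parts = t.parts}

/-- The uniform distribution on `𝔖_n` restricted to the permutations of cycle type `t`. -/
noncomputable def uniformCyclic {n : ℕ} (t : n.Partition) :
    MeasureTheory.Measure (Equiv.Perm (Fin n)) :=
  ProbabilityTheory.uniformOn (cyclicPerms t)

/-- The uniform distribution on `[0,1]`. -/
noncomputable def unif : MeasureTheory.Measure ℝ :=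
  MeasureTheory.volume.restrict (Set.Icc 0 1)

/-- The uniform distribution on `[0,1]²`, that is, the law of `(U, V)`. -/
noncomputable def unifSq : MeasureTheory.Measure (ℝ × ℝ) := unif.prod unif

/-- `ψ_π(z)`: the probability that `r - 1` i.i.d. uniform points of `[0,1]²` together with `z`
form the permutation `π ∈ 𝔖_r` (for `r ≥ 1`; the points are listed as `Z_1, …, Z_{r-1}, z`). -/
noncomputable def psi {r : ℕ} (π : Equiv.Perm (Fin r)) (z : ℝ × ℝ) : ℝ :=
  (MeasureTheory.Measure.pi fun _ : Fin (r - 1) => unifSq).real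
    {Z | perm (fun i : Fin r => if h : (i : ℕ) < r - 1 then Z ⟨i, h⟩ else z) = π}

open ProbabilityTheory in
/-- The limiting covariance matrix `Σ^{p₂}`. -/
noncomputable def sigma (r : ℕ) (p₂ : ℝ) : Matrix (Equiv.Perm (Fin r)) (Equiv.Perm (Fin r)) ℝ :=
  Matrix.of fun π ρ =>
    (cov[fun z => psi π z, fun z => psi ρ z; unifSq] +
      p₂ * cov[fun z => psi π z, fun z => psi ρ z.swap; unifSq]) / ((r - 1).factorial : ℝ) ^ 2

/-- The rescaled vector `((X_π(τ) - C(n,r)/r!) / n^{r-1/2})_{π ∈ 𝔖_r}`. -/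
noncomputable def normalizedCounts (r : ℕ) {n : ℕ} (τ : Equiv.Perm (Fin n)) :
    EuclideanSpace ℝ (Equiv.Perm (Fin r)) :=
  WithLp.toLp 2 fun π =>
    ((patternCount π τ : ℝ) - (n.choose r : ℝ) / (r.factorial : ℝ)) /
      (n : ℝ) ^ ((r : ℝ) - 1 / 2)

end PatternCLT

namespace PatternCLT

/-! Fix `σ` of cycle type `t` and let `U` consist of `n` i.i.d. uniform numbers. Their ranks form a
uniform permutation, so conjugating `σ` by `st U` gives the uniform `t`-cyclic permutation
(`uniformCyclic_eq_map`). Pattern counts thus become counts of patterns among the points `(U i, U (σ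
i))`, one for each arc of `σ`; two points are dependent only when their arcs share a vertex.

By Lévy's continuity theorem it suffices to treat a linear combination of the counts, with
coefficients `H`. Sum over `r`-tuples of arcs. Tuples whose arcs are not disjoint number `O(n^(r-1)
(1 + t₁))`, which is negligible because `t₁ = o(√n)`. On the others use a Hoeffding decomposition:
mean, plus one projection `proj H` per arc, plus a remainder. Two remainders are uncorrelated unless
at least two entries of one tuple are close to the other (`integral_remainder_mul_remainder`), so
their sum has variance `O(n^(2r-2))`, against the scale `n^(2r-1)`. What is left is `n^(-1/2) ∑ g(U
i, U (σ i))`, where `g` integrates to zero in each variable.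

Charging each arc to its larger endpoint makes this a sum of bounded martingale differences, and
McLeish's method gives the Gaussian limit (`norm_charFun_edge_sum_sub_le`). Two arcs are correlated
only if they are equal or are the two arcs of a 2-cycle, so the variance is `(n - t₁) E g(U,V)² + 2
t₂ E g(U,V) g(V,U)`; this is how `p₂` enters.

For the covariance matrix: a point `(x, y)` among `r - 1` uniform ones has rank `i` from the left
with the Bernstein probability `b_i(x)`, and likewise vertically, so `ψ_π = ∑ b_i(x) b_{π i}(y) /
(r-1)!` (`psi_eq`). A centered combination of the `ψ_π` is therefore encoded by a matrix `M` with
zero row and column sums, and by Birkhoff's theorem every such `M` occurs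
(`mem_range_centeredComb`). The quadratic form of `Σ` is a positive multiple of `(1 - p₂) ‖M‖² +
(p₂/2) ‖M + Mᵀ‖²`, where the norm is definite because Bernstein polynomials are independent. For `p₂
< 1` the rank is the dimension `(r-1)²` of the space of such `M`; for `p₂ = 1` the skew matrices are
lost and the symmetric ones remain, of dimension `r(r-1)/2`. On the diagonal, `M` is a centered
permutation matrix, whose corner entry is nonzero when `r ≥ 2`. -/

open MeasureTheory ProbabilityTheory Filter Topology

/-! ### Order-theoretic properties of standardization. -/

section Standardization

variable {n : ℕ} {α β : Type*} [LinearOrder α] [LinearOrder β]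

/-- Two bijections onto `Fin n` that order the indices alike differ by a strictly increasing
bijection of `Fin n`, which is the identity. -/
theorem st_eq_of_lt_iff {y : Fin n → α} (hy : Function.Injective y) {σ : Equiv.Perm (Fin n)}
    (h : ∀ i j, σ i < σ j ↔ y i < y j) : st y = σ := by
  have h1 : StrictMono ((st y) ∘ σ.symm) := fun i j hij => by
    simp only [Function.comp, st_lt_st_iff hy, ← h, Equiv.apply_symm_apply]
    exact hij
  have h2 := (h1.range_inj strictMono_id).1 (by
    rw [((st y).surjective.comp σ.symm.surjective).range_eq, Set.range_id])
  ext i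
  simpa using congrArg Fin.val (congrFun h2 (σ i))

theorem st_comp_perm {y : Fin n → α} (hy : Function.Injective y) (e : Equiv.Perm (Fin n)) :
    st (y ∘ e) = st y * e :=
  st_eq_of_lt_iff (hy.comp e.injective) fun i j => by simp [st_lt_st_iff hy]

theorem st_congr {y : Fin n → α} {z : Fin n → β} (hy : Function.Injective y)
    (h : ∀ i j, y i < y j ↔ z i < z j) : st y = st z := by
  have hz : Function.Injective z := fun i j hij => by
    have h1 := h i j
    have h2 := h j i
    simp only [hij, lt_irrefl, iff_false, not_lt] at h1 h2
    exact hy (le_antisymm h2 h1)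
  exact st_eq_of_lt_iff hy fun i j => by rw [h, st_lt_st_iff hz]

theorem st_strictMono {y : Fin n → α} (hy : StrictMono y) : st y = 1 :=
  st_eq_of_lt_iff hy.injective fun i j => by simp [hy.lt_iff_lt]

/-- In this quotient form, relabelling the points visibly cancels; `tuplePat` and `geomPat` are
built on the same model. -/
theorem perm_eq_mul_inv (z : Fin n → ℝ × ℝ) (hy : Function.Injective fun i => (z i).2) :
    perm z = st (fun i => (z i).2) * (st fun i => (z i).1)⁻¹ := by
  rw [show perm z = st ((fun i => (z i).2) ∘ Tuple.sort fun k => (z k).1) from rfl,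
    st_comp_perm hy]
  simp [st]

theorem val_st_apply {y : Fin n → α} (hy : Function.Injective y) (b : Fin n) :
    (st y b : ℕ) = (Finset.univ.filter fun j => y j < y b).card := by
  have h : (Finset.univ.filter fun j => y j < y b).map (st y).toEmbedding = Finset.Iio (st y b) := by
    ext k
    simp only [Finset.mem_map, Finset.mem_filter, Finset.mem_univ, true_and, Finset.mem_Iio,
      Equiv.coe_toEmbedding]
    constructor
    · rintro ⟨a, ha, rfl⟩
      rwa [st_lt_st_iff hy]
    · intro hk
      refine ⟨(st y).symm k, ?_, by simp⟩
      rw [← st_lt_st_iff hy]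
      simpa using hk
  rw [← Finset.card_map (st y).toEmbedding, h, Fin.card_Iio]

end Standardization

/-! ### Pattern counts as sums over injective tuples. -/

section PatternOfTuple

variable {n r : ℕ}

/-- The pattern induced by `τ` on the positions listed, in any order, by the tuple `f`. -/
def tuplePat (τ : Equiv.Perm (Fin n)) (f : Fin r → Fin n) : Equiv.Perm (Fin r) :=
  st (fun a => τ (f a)) * (st f)⁻¹

theorem tuplePat_comp_perm (τ : Equiv.Perm (Fin n)) {f : Fin r → Fin n}
    (hf : Function.Injective f) (e : Equiv.Perm (Fin r)) :
    tuplePat τ (f ∘ e) = tuplePat τ f := by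
  have h1 : st (fun a => τ ((f ∘ e) a)) = st (fun a => τ (f a)) * e :=
    st_comp_perm (y := fun a => τ (f a)) (τ.injective.comp hf) e
  rw [tuplePat, h1, st_comp_perm hf, tuplePat]
  group

/-- Every `r`-set is listed by `r!` injective tuples, and `tuplePat` does not depend on the order of
the listing. -/
theorem sum_injective_tuplePat (τ : Equiv.Perm (Fin n)) (H : Equiv.Perm (Fin r) → ℝ) :
    ∑ f : Fin r → Fin n with Function.Injective f, H (tuplePat τ f) =
      (r.factorial : ℝ) * ∑ π, H π * (patternCount π τ : ℝ) := by
  classical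
  have hR : ∑ π, H π * (patternCount π τ : ℝ) =
      ∑ I : {I : Finset (Fin n) // I.card = r}, H (pat τ I.1 I.2) := by
    simp only [patternCount]
    rw [← Finset.sum_fiberwise (s := Finset.univ)
      (g := fun I : {I : Finset (Fin n) // I.card = r} => pat τ I.1 I.2)]
    refine Finset.sum_congr rfl fun π _ => ?_
    rw [Finset.sum_congr rfl (g := fun _ => H π) (fun I hI => by
      rw [(Finset.mem_filter.1 hI).2]), Finset.sum_const, nsmul_eq_mul, mul_comm]
    congr 2
    symm
    refine Finset.card_bij (fun I _ => I.1) ?_ ?_ ?_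
    · intro I hI
      simp only [Finset.mem_filter, Finset.mem_univ, true_and] at hI ⊢
      exact ⟨I.2, hI⟩
    · intro I _ J _ h
      exact Subtype.ext h
    · intro I hI
      simp only [Finset.mem_filter, Finset.mem_univ, true_and] at hI
      obtain ⟨h1, h2⟩ := hI
      exact ⟨⟨I, h1⟩, by simpa using h2, rfl⟩
  rw [hR]
  have hL : ∑ f : Fin r → Fin n with Function.Injective f, H (tuplePat τ f) =
      ∑ q : {I : Finset (Fin n) // I.card = r} × Equiv.Perm (Fin r), H (pat τ q.1.1 q.1.2) := by
    symm
    refine Finset.sum_bij (fun q _ => (q.1.1.orderEmbOfFin q.1.2) ∘ q.2) ?_ ?_ ?_ ?_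
    · intro q _
      simpa using (q.1.1.orderEmbOfFin q.1.2).injective
    · rintro ⟨⟨I, hI⟩, e⟩ _ ⟨⟨J, hJ⟩, e'⟩ _ h
      have hIJ : I = J := by
        have h1 : Set.range ((I.orderEmbOfFin hI) ∘ e) = Set.range ((J.orderEmbOfFin hJ) ∘ e') := by
          simpa using congrArg Set.range h
        rw [e.surjective.range_comp, e'.surjective.range_comp, Finset.range_orderEmbOfFin,
          Finset.range_orderEmbOfFin] at h1
        exact_mod_cast h1
      subst hIJ
      have : e = e' := by
        ext a
        have := congrFun h a
        simp only [Function.comp, (I.orderEmbOfFin hI).injective.eq_iff] at this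
        rw [this]
      rw [this]
    · intro f hf
      simp only [Finset.mem_filter, Finset.mem_univ, true_and] at hf
      have hc : (Finset.univ.image f).card = r := by
        rw [Finset.card_image_of_injective _ hf, Finset.card_fin]
      refine ⟨(⟨Finset.univ.image f, hc⟩, st f), Finset.mem_univ _, ?_⟩
      have : f ∘ (st f).symm = (Finset.univ.image f).orderEmbOfFin hc :=
        Finset.orderEmbOfFin_unique hc (by simp) fun i j hij => by
          rw [Function.comp, Function.comp, ← st_lt_st_iff hf]
          simpa using hij
      simp only [← this]
      ext a
      simp
    · rintro ⟨⟨I, hI⟩, e⟩ _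
      have : tuplePat τ ((I.orderEmbOfFin hI) ∘ e) = pat τ I hI := by
        rw [tuplePat_comp_perm τ (I.orderEmbOfFin hI).injective, tuplePat,
          st_strictMono (I.orderEmbOfFin hI).strictMono]
        simp [pat]
      simp only [this]
  rw [hL, Fintype.sum_prod_type, Finset.mul_sum]
  refine Finset.sum_congr rfl fun I _ => ?_
  have := Finset.sum_const (s := (Finset.univ : Finset (Equiv.Perm (Fin r)))) (H (pat τ I.1 I.2))
  rwa [nsmul_eq_mul, Finset.card_univ, Fintype.card_perm, Fintype.card_fin] at this

theorem card_injective_tuples :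
    ((Finset.univ.filter fun f : Fin r → Fin n => Function.Injective f).card : ℝ) =
      r.factorial * n.choose r := by
  classical
  rw [← Fintype.card_subtype, Fintype.card_congr (Equiv.subtypeInjectiveEquivEmbedding _ _),
    Fintype.card_embedding_eq, Fintype.card_fin, Fintype.card_fin,
    Nat.descFactorial_eq_factorial_mul_choose]
  push_cast
  rfl

/-- The pattern formed by the points `(U i, U (σ i))`, where `i` runs through the tuple `f`. -/
noncomputable def geomPat (σ : Equiv.Perm (Fin n)) (f : Fin r → Fin n) (U : Fin n → ℝ) :
    Equiv.Perm (Fin r) :=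
  st (fun a => U (σ (f a))) * (st fun a => U (f a))⁻¹

/-- The conjugate sends the rank of `U i` to the rank of `U (σ i)`, and ranks compare as the numbers
themselves do. -/
theorem tuplePat_conj {U : Fin n → ℝ} (hU : Function.Injective U) (σ : Equiv.Perm (Fin n))
    {f : Fin r → Fin n} (hf : Function.Injective f) :
    tuplePat (st U * σ * (st U)⁻¹) (st U ∘ f) = geomPat σ f U := by
  rw [tuplePat, geomPat]
  congr 1
  · refine st_congr ((Equiv.injective _).comp ((Equiv.injective _).comp hf)) fun i j => ?_
    simp [st_lt_st_iff hU]
  · congr 1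
    refine st_congr ((Equiv.injective _).comp hf) fun i j => ?_
    simp [st_lt_st_iff hU]

theorem sum_mul_patternCount_conj {U : Fin n → ℝ} (hU : Function.Injective U)
    (σ : Equiv.Perm (Fin n)) (H : Equiv.Perm (Fin r) → ℝ) :
    (r.factorial : ℝ) * ∑ π, H π *
        ((patternCount π (st U * σ * (st U)⁻¹) : ℝ) - (n.choose r : ℝ) / (r.factorial : ℝ)) =
      ∑ f : Fin r → Fin n with Function.Injective f,
        (H (geomPat σ f U) - (∑ π, H π) / r.factorial) := by
  have h0 : (r.factorial : ℝ) ≠ 0 := by positivity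
  rw [Finset.sum_sub_distrib, Finset.sum_const, nsmul_eq_mul, card_injective_tuples]
  have h1 : ∑ f : Fin r → Fin n with Function.Injective f, H (geomPat σ f U) =
      ∑ f : Fin r → Fin n with Function.Injective f,
        H (tuplePat (st U * σ * (st U)⁻¹) f) := by
    refine Finset.sum_bij (fun f _ => st U ∘ f) ?_ ?_ ?_ ?_
    · intro f hf
      simpa using hf
    · intro f _ g _ h
      exact (st U).injective.comp_left h
    · intro f hf
      exact ⟨(st U).symm ∘ f, by simpa using hf, by ext; simp⟩
    · intro f hf
      rw [tuplePat_conj hU σ (by simpa using hf)]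
  rw [h1, sum_injective_tuplePat]
  simp only [mul_sub, Finset.sum_sub_distrib, ← Finset.sum_mul]
  field_simp

end PatternOfTuple

/-! ### Cycle types, fixed points and 2-cycles. -/

section CycleType

variable {n : ℕ}

/-- `cycleType` omits fixed points: realize the parts that are at least 2; the remaining parts equal
1 and their number is forced by the size. -/
theorem exists_perm_partition_eq (t : n.Partition) :
    ∃ σ : Equiv.Perm (Fin n), σ.partition.parts = t.parts := by
  classical
  have h : ∃ σ : Equiv.Perm (Fin n), σ.cycleType = t.parts.filter (2 ≤ ·) := by
    rw [Equiv.Perm.exists_with_cycleType_iff]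
    constructor
    · rw [Fintype.card_fin]
      conv_rhs => rw [← t.parts_sum]
      conv_rhs => rw [← Multiset.filter_add_not (2 ≤ ·) t.parts]
      rw [Multiset.sum_add]
      omega
    · intro a ha
      exact (Multiset.mem_filter.1 ha).2
  obtain ⟨σ, hσ⟩ := h
  refine ⟨σ, ?_⟩
  have h1 : t.parts.filter (fun a => ¬ 2 ≤ a) =
      Multiset.replicate (t.parts.filter fun a => ¬ 2 ≤ a).card 1 := by
    rw [Multiset.eq_replicate_card]
    intro b hb
    have h2 := Multiset.mem_filter.1 hb
    have := t.parts_pos h2.1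
    omega
  have h3 := t.parts_sum
  rw [← Multiset.filter_add_not (2 ≤ ·) t.parts, Multiset.sum_add, h1] at h3
  simp only [Multiset.sum_replicate, smul_eq_mul, mul_one] at h3
  have h4 := σ.sum_cycleType
  rw [hσ] at h4
  rw [Equiv.Perm.parts_partition, hσ]
  conv_rhs => rw [← Multiset.filter_add_not (2 ≤ ·) t.parts, h1]
  congr 2
  rw [Fintype.card_fin]
  omega

theorem count_one_partition (σ : Equiv.Perm (Fin n)) :
    σ.partition.parts.count 1 = (Finset.univ.filter fun i => σ i = i).card := by
  have h1 : σ.cycleType.count 1 = 0 := by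
    rw [Multiset.count_eq_zero]
    intro h
    exact absurd (Equiv.Perm.two_le_of_mem_cycleType h) (by norm_num)
  rw [Equiv.Perm.parts_partition, Multiset.count_add, h1, Multiset.count_replicate_self, zero_add,
    ← Finset.card_compl]
  congr 1
  ext i
  simp

theorem two_mul_count_two_partition (σ : Equiv.Perm (Fin n)) :
    2 * σ.partition.parts.count 2 =
      (Finset.univ.filter fun i => σ i ≠ i ∧ σ (σ i) = i).card := by
  classical
  rw [Equiv.Perm.parts_partition, Multiset.count_add, Multiset.count_replicate, if_neg (by norm_num),
    add_zero, Equiv.Perm.cycleType_def, Multiset.count_map]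
  have h : (Finset.univ.filter fun i => σ i ≠ i ∧ σ (σ i) = i) =
      (σ.cycleFactorsFinset.filter fun c => 2 = c.support.card).biUnion fun c => c.support := by
    ext i
    simp only [Finset.mem_filter, Finset.mem_univ, true_and, Finset.mem_biUnion]
    constructor
    · rintro ⟨h1, h2⟩
      refine ⟨σ.cycleOf i, ⟨Equiv.Perm.cycleOf_mem_cycleFactorsFinset_iff.2 (by simpa using h1), ?_⟩,
        by simpa [Equiv.Perm.mem_support_cycleOf_iff] using h1⟩
      have h3 : (σ.cycleOf i).support = {i, σ i} := by
        ext j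
        rw [Equiv.Perm.mem_support_cycleOf_iff' h1]
        simp only [Finset.mem_insert, Finset.mem_singleton]
        constructor
        · rintro ⟨k, rfl⟩
          -- Since `σ²` fixes `i`, the point `σ^k i` depends only on the parity of `k`.
          have h4 : (σ ^ 2) i = i := by simpa [pow_two] using h2
          have h5 : ((σ ^ 2) ^ (k / 2)) i = i := by
            exact Equiv.Perm.zpow_apply_eq_self_of_apply_eq_self h4 _
          have h6 : (σ ^ k) i = (σ ^ (k % 2)) (((σ ^ 2) ^ (k / 2)) i) := by
            rw [← Equiv.Perm.mul_apply, ← zpow_natCast, ← zpow_mul, ← zpow_add]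
            congr 2
            have := Int.emod_add_mul_ediv k 2
            push_cast
            omega
          rw [h6, h5]
          rcases Int.emod_two_eq_zero_or_one k with h | h <;> simp [h]
        · rintro (rfl | rfl)
          · exact Equiv.Perm.SameCycle.refl _ _
          · exact (Equiv.Perm.sameCycle_apply_right).2 (Equiv.Perm.SameCycle.refl _ _)
      rw [h3, Finset.card_pair (Ne.symm h1)]
    · rintro ⟨c, ⟨hc, hc2⟩, hi⟩
      have h1 := Equiv.Perm.mem_cycleFactorsFinset_iff.1 hc
      have h2 : σ i = c i := (h1.2 i hi).symm
      have hi' : c i ∈ c.support := Equiv.Perm.apply_mem_support.2 hi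
      refine ⟨by rw [h2]; simpa using hi, ?_⟩
      rw [h2, ← h1.2 _ hi']
      have h3 : c ^ 2 = 1 := by rw [hc2, ← h1.1.orderOf, pow_orderOf_eq_one]
      simpa [pow_two] using congrArg (fun e : Equiv.Perm (Fin n) => e i) h3
  rw [h, Finset.card_biUnion]
  · rw [Finset.sum_congr rfl (g := fun _ => 2) (fun c hc => (Finset.mem_filter.1 hc).2.symm),
      Finset.sum_const, smul_eq_mul, mul_comm]
    rfl
  · intro c hc d hd hcd
    exact (Equiv.Perm.cycleFactorsFinset_pairwise_disjoint σ (Finset.mem_filter.1 hc).1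
      (Finset.mem_filter.1 hd).1 hcd).disjoint_support

end CycleType

/-! ### I.i.d. uniform points and resampling of coordinates. -/

section UniformPoints

instance : IsProbabilityMeasure unif := ⟨by simp [unif]⟩

instance : NullSingletonClass unif := by unfold unif; infer_instance

instance : IsProbabilityMeasure unifSq := by unfold unifSq; infer_instance

/-- The law of a family of i.i.d. uniform points of `[0,1]` indexed by `ι`. -/
noncomputable def unifPi (ι : Type*) [Fintype ι] : Measure (ι → ℝ) := Measure.pi fun _ => unif

variable {ι κ : Type*} [Fintype ι] [Fintype κ]

instance : IsProbabilityMeasure (unifPi ι) := by unfold unifPi; infer_instance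

theorem measurePreserving_eval_unifPi (i : ι) :
    MeasurePreserving (fun U : ι → ℝ => U i) (unifPi ι) unif :=
  measurePreserving_eval (fun _ : ι => unif) i

theorem iIndepFun_unifPi : iIndepFun (fun (i : ι) (U : ι → ℝ) => U i) (unifPi ι) :=
  iIndepFun_pi (X := fun (_ : ι) (x : ℝ) => x) fun _ => aemeasurable_id

theorem measurePreserving_comp_injective {e : κ → ι} (he : Function.Injective e) :
    MeasurePreserving (fun (U : ι → ℝ) (k : κ) => U (e k)) (unifPi ι) (unifPi κ) := by
  refine ⟨by fun_prop, ?_⟩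
  have h := iIndepFun_unifPi (ι := ι) |>.precomp he
  rw [iIndepFun_iff_map_fun_eq_pi_map (fun k => (measurable_pi_apply _).aemeasurable)] at h
  refine h.trans ?_
  unfold unifPi
  congr 1
  ext1 k
  exact (measurePreserving_eval_unifPi (e k)).map_eq

theorem measurePreserving_pair {i j : ι} (hij : i ≠ j) :
    MeasurePreserving (fun U : ι → ℝ => (U i, U j)) (unifPi ι) unifSq := by
  refine ⟨by fun_prop, ?_⟩
  have h := (iIndepFun_unifPi (ι := ι)).indepFun hij
  rw [indepFun_iff_map_prod_eq_prod_map_map (measurable_pi_apply _).aemeasurable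
    (measurable_pi_apply _).aemeasurable] at h
  rw [h, (measurePreserving_eval_unifPi i).map_eq, (measurePreserving_eval_unifPi j).map_eq, unifSq]

theorem ae_fst_ne_snd : ∀ᵐ z ∂unifSq, z.1 ≠ z.2 := by
  have hm : MeasurableSet {z : ℝ × ℝ | z.1 = z.2} :=
    measurableSet_eq_fun measurable_fst measurable_snd
  rw [ae_iff]
  simp only [ne_eq, not_not]
  rw [unifSq, Measure.measure_prod_null hm]
  refine ae_of_all _ fun x => ?_
  have : Prod.mk x ⁻¹' {z : ℝ × ℝ | z.1 = z.2} = {x} := by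
    ext y
    simp [eq_comm]
  simp [this]

theorem ae_injective_unifPi : ∀ᵐ U ∂unifPi ι, Function.Injective U := by
  have h : ∀ i j : ι, ∀ᵐ U ∂unifPi ι, U i = U j → i = j := fun i j => by
    by_cases hij : i = j
    · exact ae_of_all _ fun _ _ => hij
    · filter_upwards [(measurePreserving_pair hij).quasiMeasurePreserving.ae ae_fst_ne_snd]
        with U hU h using absurd h hU
  filter_upwards [ae_all_iff.2 fun i => ae_all_iff.2 (h i)] with U hU i j using hU i j

theorem ae_ne_unifPi (x : ℝ) : ∀ᵐ U ∂unifPi ι, ∀ i, U i ≠ x := by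
  refine ae_all_iff.2 fun i => ?_
  have : ∀ᵐ y ∂unif, y ≠ x := by simp [ae_iff]
  exact (measurePreserving_eval_unifPi i).quasiMeasurePreserving.ae this

variable [DecidableEq ι]

theorem ae_injective_update_unifPi (b : ι) (x : ℝ) :
    ∀ᵐ U ∂unifPi ι, Function.Injective (Function.update U b x) := by
  filter_upwards [ae_injective_unifPi, ae_ne_unifPi x] with U h1 h2 i j hij
  by_cases hi : i = b <;> by_cases hj : j = b
  · rw [hi, hj]
  · subst hi
    rw [Function.update_self, Function.update_of_ne hj] at hij
    exact absurd hij.symm (h2 j)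
  · subst hj
    rw [Function.update_self, Function.update_of_ne hi] at hij
    exact absurd hij (h2 i)
  · rw [Function.update_of_ne hj, Function.update_of_ne hi] at hij
    exact h1 hij

/-- Replacing the coordinates in `T` by an independent copy keeps the law. Integrating over that
copy alone plays the role of conditioning on the coordinates outside `T`. -/
theorem measurePreserving_piecewise (T : Finset ι) :
    MeasurePreserving (fun p : (ι → ℝ) × (ι → ℝ) => T.piecewise p.2 p.1)
      ((unifPi ι).prod (unifPi ι)) (unifPi ι) := by
  have hm : Measurable fun p : (ι → ℝ) × (ι → ℝ) => T.piecewise p.2 p.1 := by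
    refine measurable_pi_lambda _ fun i => ?_
    by_cases hi : i ∈ T <;> simp only [Finset.piecewise, hi, if_true, if_false] <;> fun_prop
  refine ⟨hm, ?_⟩
  conv_rhs => rw [unifPi]
  refine (Measure.pi_eq fun s hs => ?_).symm
  rw [Measure.map_apply hm (MeasurableSet.univ_pi hs)]
  have : (fun p : (ι → ℝ) × (ι → ℝ) => T.piecewise p.2 p.1) ⁻¹' Set.univ.pi s =
      (Set.univ.pi fun i => if i ∈ T then Set.univ else s i) ×ˢ
        (Set.univ.pi fun i => if i ∈ T then s i else Set.univ) := by
    ext p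
    simp only [Set.mem_preimage, Set.mem_pi, Set.mem_univ, true_imp_iff, Set.mem_prod,
      ← forall_and]
    refine forall_congr' fun i => ?_
    by_cases hi : i ∈ T <;> simp [hi]
  rw [this, Measure.prod_prod, unifPi, Measure.pi_pi, Measure.pi_pi, ← Finset.prod_mul_distrib]
  refine Finset.prod_congr rfl fun i _ => ?_
  by_cases hi : i ∈ T <;> simp [hi]

/-- If `φ` does not depend on the coordinates in `T` and `R` integrates to zero over these
coordinates, then `φ * R` integrates to zero. -/
theorem integral_mul_eq_zero_of_piecewise {𝕜 : Type*} [RCLike 𝕜] (T : Finset ι)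
    {φ R : (ι → ℝ) → 𝕜} (hφ : ∀ U V, φ (T.piecewise V U) = φ U)
    (hint : Integrable (fun U => φ U * R U) (unifPi ι))
    (hR : ∀ᵐ U ∂unifPi ι, ∫ V, R (T.piecewise V U) ∂unifPi ι = 0) :
    ∫ U, φ U * R U ∂unifPi ι = 0 := by
  have hp := measurePreserving_piecewise T
  have h1 : ∫ U, φ U * R U ∂unifPi ι =
      ∫ p : (ι → ℝ) × (ι → ℝ), φ (T.piecewise p.2 p.1) * R (T.piecewise p.2 p.1)
        ∂(unifPi ι).prod (unifPi ι) := by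
    conv_lhs => rw [← hp.map_eq]
    exact integral_map hp.measurable.aemeasurable (by rw [hp.map_eq]; exact hint.1)
  have h2 : Integrable (fun p : (ι → ℝ) × (ι → ℝ) =>
      φ (T.piecewise p.2 p.1) * R (T.piecewise p.2 p.1)) ((unifPi ι).prod (unifPi ι)) :=
    hp.integrable_comp_of_integrable hint
  rw [h1, integral_prod _ h2]
  refine integral_eq_zero_of_ae ?_
  filter_upwards [hR] with U hU
  simp only [hφ]
  rw [integral_const_mul, hU, mul_zero]
  rfl

end UniformPoints

/-! ### The uniform cyclic permutation as a random conjugate. -/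

section Exchangeability

variable {n : ℕ}

theorem measurable_st : Measurable (st : (Fin n → ℝ) → Equiv.Perm (Fin n)) := by
  refine measurable_to_countable' fun α => ?_
  have : st ⁻¹' {α} = {y : Fin n → ℝ | (∀ i j, i ≤ j → y (α⁻¹ i) ≤ y (α⁻¹ j)) ∧
      ∀ i j, i < j → y (α⁻¹ i) = y (α⁻¹ j) → α⁻¹ i < α⁻¹ j} := by
    ext y
    simp only [Set.mem_preimage, Set.mem_singleton_iff, Set.mem_ofPred_eq, st, inv_eq_iff_eq_inv]
    rw [eq_comm, Tuple.eq_sort_iff]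
    rfl
  rw [this]
  refine measurableSet_setOfPred.2 (Measurable.and ?_ ?_)
  · refine Measurable.forall fun i => Measurable.forall fun j => Measurable.imp measurable_const ?_
    exact measurableSet_setOfPred.1
      (measurableSet_le (measurable_pi_apply (α⁻¹ i)) (measurable_pi_apply (α⁻¹ j)))
  · refine Measurable.forall fun i => Measurable.forall fun j => Measurable.imp measurable_const
      (Measurable.imp ?_ measurable_const)
    exact measurableSet_setOfPred.1
      (measurableSet_eq_fun (measurable_pi_apply (α⁻¹ i)) (measurable_pi_apply (α⁻¹ j)))

/-- Permuting the coordinates preserves the law and multiplies `st U` on the right, so the `n!`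
fibres have equal mass. -/
theorem measureReal_st_eq (α : Equiv.Perm (Fin n)) :
    (unifPi (Fin n)).real {U | st U = α} = 1 / n.factorial := by
  have hmeas : ∀ α : Equiv.Perm (Fin n), MeasurableSet {U : Fin n → ℝ | st U = α} := fun α =>
    measurable_st (MeasurableSpace.measurableSet_top (s := {α}))
  have h1 : ∀ α : Equiv.Perm (Fin n), (unifPi (Fin n)).real {U | st U = α} =
      (unifPi (Fin n)).real {U | st U = 1} := fun α => by
    rw [← (measurePreserving_comp_injective α.injective).measureReal_preimage
      (hmeas α).nullMeasurableSet]
    refine measureReal_congr ?_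
    filter_upwards [ae_injective_unifPi] with U hU
    have := st_comp_perm hU α
    simp only [eq_iff_iff]
    show st (U ∘ α) = α ↔ st U = 1
    rw [this, mul_eq_right]
  have h2 : ∑ α : Equiv.Perm (Fin n), (unifPi (Fin n)).real {U | st U = α} = 1 := by
    rw [← measureReal_biUnion_finset]
    · convert probReal_univ (μ := unifPi (Fin n))
      ext U
      simp
    · intro a _ b _ hab
      exact Set.disjoint_left.2 fun U h1 h2 => hab (h1.symm.trans h2)
    · exact fun a _ => hmeas a
  simp only [h1, Finset.sum_const, Finset.card_univ, Fintype.card_perm, Fintype.card_fin,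
    nsmul_eq_mul] at h2
  rw [h1]
  have : (n.factorial : ℝ) ≠ 0 := by positivity
  field_simp
  linarith

/-- The law on the right is invariant under conjugation and carried by the conjugacy class of `σ`,
which is the set of permutations of cycle type `t`. -/
theorem uniformCyclic_eq_map {t : n.Partition} {σ : Equiv.Perm (Fin n)}
    (hσ : σ.partition.parts = t.parts) :
    uniformCyclic t = (unifPi (Fin n)).map fun U => st U * σ * (st U)⁻¹ := by
  classical
  have hm : Measurable fun U : Fin n → ℝ => st U * σ * (st U)⁻¹ :=
    (measurable_from_top (f := fun ρ : Equiv.Perm (Fin n) => ρ * σ * ρ⁻¹)).comp measurable_st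
  set ν := (unifPi (Fin n)).map fun U => st U * σ * (st U)⁻¹ with hν
  have hν1 : IsProbabilityMeasure ν := Measure.isProbabilityMeasure_map hm.aemeasurable
  have hsing : MeasurableSingletonClass (Equiv.Perm (Fin n)) := ⟨fun _ => trivial⟩
  have hmem : ∀ τ : Equiv.Perm (Fin n), τ ∈ cyclicPerms t ↔ IsConj σ τ := fun τ => by
    rw [Equiv.Perm.partition_eq_of_isConj, Nat.Partition.ext_iff, hσ, cyclicPerms, Set.mem_ofPred_eq,
      eq_comm]
  have hval : ∀ τ, ν.real {τ} =
      (Finset.univ.filter fun ρ : Equiv.Perm (Fin n) => ρ * σ * ρ⁻¹ = τ).card / n.factorial := by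
    intro τ
    rw [hν, map_measureReal_apply hm trivial]
    have : (fun U : Fin n → ℝ => st U * σ * (st U)⁻¹) ⁻¹' {τ} =
        ⋃ ρ ∈ (Finset.univ.filter fun ρ : Equiv.Perm (Fin n) => ρ * σ * ρ⁻¹ = τ),
          {U | st U = ρ} := by
      ext U
      simp
    rw [this, measureReal_biUnion_finset]
    · simp only [measureReal_st_eq, Finset.sum_const, nsmul_eq_mul]
      ring
    · intro a _ b _ hab
      exact Set.disjoint_left.2 fun U h1 h2 => hab (h1.symm.trans h2)
    · exact fun a _ => measurable_st (MeasurableSpace.measurableSet_top (s := {a}))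
  have hconj : ∀ τ g, ν.real {g * τ * g⁻¹} = ν.real {τ} := fun τ g => by
    rw [hval, hval]
    congr 2
    refine Finset.card_bij (fun ρ _ => g⁻¹ * ρ) ?_ ?_ ?_
    · intro ρ hρ
      simp only [Finset.mem_filter, Finset.mem_univ, true_and] at hρ ⊢
      have : g⁻¹ * ρ * σ * (g⁻¹ * ρ)⁻¹ = g⁻¹ * (ρ * σ * ρ⁻¹) * g := by group
      rw [this, hρ]
      group
    · intro a _ b _ h
      exact mul_left_cancel h
    · intro ρ hρ
      simp only [Finset.mem_filter, Finset.mem_univ, true_and] at hρ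
      refine ⟨g * ρ, ?_, by group⟩
      simp only [Finset.mem_filter, Finset.mem_univ, true_and]
      rw [← hρ]
      group
  have heq : ∀ τ ∈ cyclicPerms t, ν.real {τ} = ν.real {σ} := fun τ hτ => by
    obtain ⟨g, hg⟩ := isConj_iff.1 ((hmem τ).1 hτ)
    rw [← hg, hconj]
  have hzero : ∀ τ ∉ cyclicPerms t, ν.real {τ} = 0 := fun τ hτ => by
    rw [hval, Finset.card_eq_zero.2, Nat.cast_zero, zero_div]
    refine Finset.filter_eq_empty_iff.2 fun ρ _ h => hτ ?_
    exact (hmem τ).2 (isConj_iff.2 ⟨ρ, h⟩)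
  have hfin : (cyclicPerms t).Finite := Set.toFinite _
  have hσt : σ ∈ cyclicPerms t := hσ
  have hS : (hfin.toFinset.card : ℝ) * ν.real {σ} = 1 := by
    have h1 : ν.real (Finset.univ : Finset (Equiv.Perm (Fin n))) = 1 := by simp
    rw [← sum_measureReal_singleton, ← Finset.sum_subset (Finset.subset_univ hfin.toFinset)
      (fun τ _ h => hzero τ (by simpa using h)),
      Finset.sum_congr rfl (fun τ h => heq τ (by simpa using h)), Finset.sum_const,
      nsmul_eq_mul] at h1
    exact h1
  have hprob : IsProbabilityMeasure (uniformCyclic t) :=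
    isProbabilityMeasure_uniformOn hfin ⟨σ, hσt⟩
  refine Measure.ext_of_singleton fun τ => ?_
  rw [← ENNReal.toReal_eq_toReal_iff' (measure_ne_top _ _) (measure_ne_top _ _)]
  show _ = ν.real {τ}
  rw [uniformCyclic, uniformOn, cond_apply MeasurableSpace.measurableSet_top,
    Measure.count_apply_finite _ hfin, ENNReal.toReal_mul]
  by_cases hτ : τ ∈ cyclicPerms t
  · rw [heq τ hτ, Set.inter_eq_self_of_subset_right (by simpa using hτ), Measure.count_singleton]
    have : (hfin.toFinset.card : ℝ) ≠ 0 := left_ne_zero_of_mul_eq_one hS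
    simp only [ENNReal.toReal_inv, ENNReal.toReal_natCast, ENNReal.toReal_one, mul_one]
    field_simp
    linarith
  · rw [hzero τ hτ, Set.inter_singleton_eq_empty.2 hτ]
    simp

end Exchangeability

/-! ### Bernstein polynomials as rank probabilities. -/

section Bernstein

/-- The projection of `x` to `[0,1]`, which is also the distribution function of `unif`. -/
noncomputable def clamp (x : ℝ) : ℝ := max 0 (min 1 x)

theorem clamp_of_mem {x : ℝ} (hx : x ∈ Set.Icc (0 : ℝ) 1) : clamp x = x := by
  simp [clamp, hx.1, hx.2]

theorem continuous_clamp : Continuous clamp := by unfold clamp; fun_prop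

theorem unif_real_Iio (x : ℝ) : unif.real (Set.Iio x) = clamp x := by
  have h : unif (Set.Iio x) = ENNReal.ofReal (min 1 x) := by
    have h1 : unif (Set.Iio x) = unif (Set.Iic x) := measure_congr Iio_ae_eq_Iic
    have h2 : Set.Iic x ∩ Set.Icc 0 1 = Set.Icc 0 (min 1 x) := by
      ext y
      simp only [Set.mem_inter_iff, Set.mem_Iic, Set.mem_Icc, le_min_iff]
      tauto
    rw [h1, unif, Measure.restrict_apply measurableSet_Iic, h2, Real.volume_Icc, sub_zero]
  rw [Measure.real, h, ENNReal.toReal_ofReal', clamp, max_comm]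

theorem unif_real_Ici (x : ℝ) : unif.real (Set.Ici x) = 1 - clamp x := by
  rw [← Set.compl_Iio, probReal_compl_eq_one_sub measurableSet_Iio, unif_real_Iio]

/-- The Bernstein polynomial of degree `r - 1` and index `k`, evaluated at `clamp x`. -/
noncomputable def bern (r : ℕ) (k : Fin r) (x : ℝ) : ℝ :=
  ((r - 1).choose k : ℝ) * clamp x ^ (k : ℕ) * (1 - clamp x) ^ (r - 1 - (k : ℕ))

variable {r : ℕ}

theorem continuous_bern (k : Fin r) : Continuous (bern r k) := by
  have := continuous_clamp
  unfold bern
  fun_prop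

theorem sum_bern [NeZero r] (x : ℝ) : ∑ k, bern r k x = 1 := by
  have h := add_pow (clamp x) (1 - clamp x) (r - 1)
  rw [add_sub_cancel, one_pow, Nat.sub_add_cancel (NeZero.one_le (n := r)),
    ← Fin.sum_univ_eq_sum_range
      (fun k => clamp x ^ k * (1 - clamp x) ^ (r - 1 - k) * ((r - 1).choose k : ℝ))] at h
  rw [h]
  refine Finset.sum_congr rfl fun k _ => ?_
  rw [bern]
  ring

/-- A binomial law: split according to the set `S` of the indices other than `b` whose coordinate
falls below `x`. -/
theorem measureReal_card_lt_eq (b k : Fin r) (x : ℝ) :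
    (unifPi (Fin r)).real {U | (Finset.univ.filter fun j => j ≠ b ∧ U j < x).card = k} =
      bern r k x := by
  classical
  have h1 : {U : Fin r → ℝ | (Finset.univ.filter fun j => j ≠ b ∧ U j < x).card = k} =
      ⋃ S ∈ (Finset.univ.erase b).powersetCard k,
        Set.univ.pi fun j => if j = b then Set.univ else if j ∈ S then Set.Iio x else Set.Ici x := by
    ext U
    simp only [Set.mem_ofPred_eq, Set.mem_iUnion, Finset.mem_powersetCard, exists_prop, Set.mem_pi,
      Set.mem_univ, true_imp_iff]
    constructor
    · intro h
      refine ⟨_, ⟨fun j hj => ?_, h⟩, fun j => ?_⟩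
      · simpa using (Finset.mem_filter.1 hj).2.1
      · by_cases hj : j = b
        · simp [hj]
        · by_cases hx : U j < x <;> simp [hj, hx]
          exact not_lt.1 hx
    · rintro ⟨S, ⟨hS, hc⟩, hU⟩
      rw [← hc]
      congr 1
      ext j
      have := hU j
      by_cases hj : j = b
      · subst hj
        have : j ∉ S := fun h => by simpa using hS h
        simp [this]
      · by_cases hx : j ∈ S <;> simp [hj, hx] at this ⊢ <;> exact this
  rw [h1, measureReal_biUnion_finset]
  · have h2 : ∀ S ∈ (Finset.univ.erase b).powersetCard k, (unifPi (Fin r)).real (Set.univ.pi fun j =>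
        if j = b then Set.univ else if j ∈ S then Set.Iio x else Set.Ici x) =
        clamp x ^ (k : ℕ) * (1 - clamp x) ^ (r - 1 - (k : ℕ)) := fun S hS => by
      rw [Finset.mem_powersetCard] at hS
      rw [Measure.real, unifPi, Measure.pi_pi, ENNReal.toReal_prod]
      rw [← Finset.mul_prod_erase _ _ (Finset.mem_univ b)]
      have h3 : ∀ j ∈ Finset.univ.erase b, (unif (if j = b then Set.univ else if j ∈ S then
          Set.Iio x else Set.Ici x)).toReal = if j ∈ S then clamp x else 1 - clamp x := fun j hj => by
        rw [if_neg (Finset.ne_of_mem_erase hj)]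
        split_ifs
        · exact unif_real_Iio x
        · exact unif_real_Ici x
      rw [Finset.prod_congr rfl h3, Finset.prod_ite, Finset.prod_const, Finset.prod_const,
        Finset.filter_mem_eq_inter, Finset.inter_eq_right.2 hS.1, hS.2, Finset.filter_notMem_eq_sdiff,
        Finset.card_sdiff_of_subset hS.1, hS.2, Finset.card_erase_of_mem (Finset.mem_univ b)]
      simp
    rw [Finset.sum_congr rfl h2, Finset.sum_const, Finset.card_powersetCard,
      Finset.card_erase_of_mem (Finset.mem_univ b), nsmul_eq_mul, bern, mul_assoc]
    simp
  · intro S hS S' hS' hSS'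
    rw [Finset.mem_coe, Finset.mem_powersetCard] at hS hS'
    refine Set.disjoint_left.2 fun U h1 h2 => hSS' ?_
    ext j
    have h1 := h1 j (Set.mem_univ _)
    have h2 := h2 j (Set.mem_univ _)
    by_cases hj : j = b
    · subst hj
      have h1 : j ∉ S := fun h => by simpa using hS.1 h
      have h2 : j ∉ S' := fun h => by simpa using hS'.1 h
      simp [h1, h2]
    · by_cases ha : j ∈ S <;> by_cases hb : j ∈ S' <;> simp [hj, ha, hb] at h1 h2 ⊢ <;> linarith
  · intro S _
    refine MeasurableSet.univ_pi fun j => ?_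
    split_ifs
    exacts [MeasurableSet.univ, measurableSet_Iio, measurableSet_Ici]

theorem bern_nonneg (k : Fin r) (x : ℝ) : 0 ≤ bern r k x := by
  rw [← measureReal_card_lt_eq k k x]
  positivity

theorem bern_le_one (k : Fin r) (x : ℝ) : bern r k x ≤ 1 := by
  rw [← measureReal_card_lt_eq k k x]
  exact measureReal_le_one

theorem card_perm_apply_eq (b k : Fin r) :
    (Finset.univ.filter fun α : Equiv.Perm (Fin r) => α b = k).card = (r - 1).factorial := by
  have h1 : ∀ k', (Finset.univ.filter fun α : Equiv.Perm (Fin r) => α b = k').card =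
      (Finset.univ.filter fun α : Equiv.Perm (Fin r) => α b = k).card := fun k' => by
    refine Finset.card_bij (fun α _ => Equiv.swap k k' * α) ?_ ?_ ?_
    · intro α hα
      simp only [Finset.mem_filter, Finset.mem_univ, true_and] at hα ⊢
      simp [hα]
    · intro α _ β _ h
      exact mul_left_cancel h
    · intro α hα
      simp only [Finset.mem_filter, Finset.mem_univ, true_and] at hα
      exact ⟨Equiv.swap k k' * α, by simp [hα], by rw [← mul_assoc, Equiv.swap_mul_self, one_mul]⟩
  have h2 := Finset.card_eq_sum_card_fiberwise (s := (Finset.univ : Finset (Equiv.Perm (Fin r))))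
    (t := Finset.univ) (f := fun α => α b) (fun _ _ => Finset.mem_coe.2 (Finset.mem_univ _))
  simp only [h1, Finset.sum_const, Finset.card_univ, Fintype.card_perm, Fintype.card_fin,
    smul_eq_mul] at h2
  have hr : 0 < r := b.pos
  rw [← Nat.mul_factorial_pred hr.ne'] at h2
  exact (Nat.eq_of_mul_eq_mul_left hr h2).symm

theorem measurable_update_left (b : Fin r) (x : ℝ) :
    Measurable fun U : Fin r → ℝ => Function.update U b x :=
  measurable_pi_lambda _ fun j => by
    by_cases hj : j = b
    · subst hj; simp
    · simp only [Function.update_of_ne hj]; fun_prop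

theorem measurableSet_st_update (b : Fin r) (x : ℝ) (α : Equiv.Perm (Fin r)) :
    MeasurableSet {U : Fin r → ℝ | st (Function.update U b x) = α} :=
  (measurable_st.comp (measurable_update_left b x)) (MeasurableSpace.measurableSet_top (s := {α}))

/-- The rank of `x` among the `r` values is binomial; given this rank, the other coordinates are
exchangeable, so the `(r-1)!` permutations with the prescribed value at `b` are equally likely. -/
theorem measureReal_st_update (b : Fin r) (x : ℝ) (α : Equiv.Perm (Fin r)) :
    (unifPi (Fin r)).real {U | st (Function.update U b x) = α} =
      bern r (α b) x / (r - 1).factorial := by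
  have hinv : ∀ β : Equiv.Perm (Fin r), β b = α b →
      (unifPi (Fin r)).real {U | st (Function.update U b x) = β} =
        (unifPi (Fin r)).real {U | st (Function.update U b x) = α} := fun β hβ => by
    -- The relabelling fixes `b`, so it leaves the inserted value `x` in place.
    have he : (α⁻¹ * β) b = b := by simp [hβ]
    rw [← (measurePreserving_comp_injective (α⁻¹ * β).injective).measureReal_preimage
      (measurableSet_st_update b x β).nullMeasurableSet]
    refine measureReal_congr ?_
    filter_upwards [ae_injective_update_unifPi b x] with U hU
    have h1 : Function.update (fun k => U ((α⁻¹ * β) k)) b x =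
        Function.update U b x ∘ (α⁻¹ * β) := by
      ext j
      by_cases hj : j = b
      · subst hj
        simp only [Function.comp, he, Function.update_self]
      · have : (α⁻¹ * β) j ≠ b := fun h => hj ((α⁻¹ * β).injective (h.trans he.symm))
        simp only [Function.comp, Function.update_of_ne hj, Function.update_of_ne this]
    simp only [eq_iff_iff]
    show st (Function.update (fun k => U ((α⁻¹ * β) k)) b x) = β ↔ _
    rw [h1, st_comp_perm hU, ← mul_assoc, mul_eq_right, mul_inv_eq_one]
    rfl
  have hsum : (unifPi (Fin r)).real
      {U | (Finset.univ.filter fun j => j ≠ b ∧ U j < x).card = α b} =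
      ∑ β : Equiv.Perm (Fin r) with β b = α b,
        (unifPi (Fin r)).real {U | st (Function.update U b x) = β} := by
    rw [← measureReal_biUnion_finset]
    · refine measureReal_congr ?_
      filter_upwards [ae_injective_update_unifPi b x] with U hU
      simp only [eq_iff_iff]
      show (Finset.univ.filter fun j => j ≠ b ∧ U j < x).card = α b ↔ U ∈ ⋃ β ∈ _, _
      simp only [Set.mem_iUnion, Finset.mem_filter, Finset.mem_univ, true_and, exists_prop,
        Set.mem_ofPred_eq, exists_eq_right']
      rw [Fin.ext_iff, val_st_apply hU]
      have : (Finset.univ.filter fun j => j ≠ b ∧ U j < x) = Finset.univ.filter fun j =>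
          Function.update U b x j < Function.update U b x b := by
        ext j
        by_cases hj : j = b
        · subst hj; simp
        · simp [hj]
      rw [this]
    · intro a _ c _ hac
      exact Set.disjoint_left.2 fun U h1 h2 => hac (h1.symm.trans h2)
    · exact fun β _ => measurableSet_st_update b x β
  rw [measureReal_card_lt_eq, Finset.sum_congr rfl fun β hβ => hinv β (Finset.mem_filter.1 hβ).2,
    Finset.sum_const, card_perm_apply_eq, nsmul_eq_mul] at hsum
  rw [hsum]
  field_simp

/-- Averaging `measureReal_st_update` at the identity over the inserted value gives back the
probability `1/r!` of the identity. -/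
theorem integral_bern (k : Fin r) : ∫ x, bern r k x ∂unif = 1 / r := by
  have hp := measurePreserving_piecewise (ι := Fin r) {k}
  have h1 := measureReal_st_eq (n := r) 1
  have hmeas : MeasurableSet {U : Fin r → ℝ | st U = 1} :=
    measurable_st (MeasurableSpace.measurableSet_top (s := {1}))
  rw [← hp.measureReal_preimage hmeas.nullMeasurableSet,
    Measure.real, Measure.prod_apply_symm (hp.measurable hmeas),
    ← integral_toReal (measurable_measure_prodMk_right (hp.measurable hmeas)).aemeasurable
      (ae_of_all _ fun _ => measure_lt_top _ _)] at h1
  have h2 : ∀ V : Fin r → ℝ, (unifPi (Fin r)).real ((fun U => (U, V)) ⁻¹'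
      ((fun p : (Fin r → ℝ) × (Fin r → ℝ) => ({k} : Finset (Fin r)).piecewise p.2 p.1) ⁻¹'
        {U | st U = 1})) = bern r k (V k) / (r - 1).factorial := fun V => by
    refine Eq.trans ?_ (measureReal_st_update k (V k) 1)
    congr 1
    ext U
    simp only [Set.mem_preimage, Finset.piecewise_singleton, Set.mem_ofPred_eq]
  simp only [← measureReal_def, h2] at h1
  rw [integral_div] at h1
  have h3 : ∫ V, bern r k (V k) ∂unifPi (Fin r) = ∫ x, bern r k x ∂unif := by
    conv_rhs => rw [← (measurePreserving_eval_unifPi k).map_eq]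
    exact (integral_map (measurable_pi_apply k).aemeasurable (continuous_bern k).aestronglyMeasurable).symm
  have hr : 0 < r := k.pos
  rw [h3, ← Nat.mul_factorial_pred hr.ne'] at h1
  have : (r : ℝ) ≠ 0 := by positivity
  have : ((r - 1).factorial : ℝ) ≠ 0 := by positivity
  push_cast at h1
  field_simp at h1 ⊢
  linarith

end Bernstein

/-! ### The functions `ψ_π` in terms of Bernstein polynomials. -/

section Psi

variable {r : ℕ}

/-- If the abscissas have standardization `α`, the ordinates must have `π * α`. Grouping by `i = α
b` leaves `(r-1)!` equal terms for each `i`. -/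
theorem measureReal_pattern_update (b : Fin r) (π : Equiv.Perm (Fin r)) (x y : ℝ) :
    ((unifPi (Fin r)).prod (unifPi (Fin r))).real
      {p | st (Function.update p.2 b y) * (st (Function.update p.1 b x))⁻¹ = π} =
      (∑ i, bern r i x * bern r (π i) y) / (r - 1).factorial := by
  have h1 : {p : (Fin r → ℝ) × (Fin r → ℝ) |
      st (Function.update p.2 b y) * (st (Function.update p.1 b x))⁻¹ = π} =
      ⋃ α ∈ (Finset.univ : Finset (Equiv.Perm (Fin r))),
        {U | st (Function.update U b x) = α} ×ˢ {U | st (Function.update U b y) = π * α} := by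
    ext p
    simp only [Set.mem_ofPred_eq, Finset.mem_univ, Set.iUnion_true, Set.mem_iUnion, Set.mem_prod,
      exists_eq_left', mul_inv_eq_iff_eq_mul]
  rw [h1, measureReal_biUnion_finset]
  · simp only [measureReal_prod_prod, measureReal_st_update, Equiv.Perm.mul_apply]
    rw [← Finset.sum_fiberwise (s := Finset.univ) (g := fun α : Equiv.Perm (Fin r) => α b),
      Finset.sum_div]
    refine Finset.sum_congr rfl fun i _ => ?_
    rw [Finset.sum_congr rfl (g := fun _ => bern r i x / (r - 1).factorial *
      (bern r (π i) y / (r - 1).factorial)) fun α hα => by rw [(Finset.mem_filter.1 hα).2],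
      Finset.sum_const, card_perm_apply_eq, nsmul_eq_mul]
    field_simp
  · intro a _ c _ hac
    exact Set.disjoint_left.2 fun U h1 h2 => hac (h1.1.symm.trans h2.1)
  · exact fun α _ => (measurableSet_st_update b x α).prod (measurableSet_st_update b y _)

theorem integral_pattern_update (H : Equiv.Perm (Fin r) → ℝ) (b : Fin r) (x y : ℝ) :
    ∫ p, H (st (Function.update p.2 b y) * (st (Function.update p.1 b x))⁻¹)
        ∂(unifPi (Fin r)).prod (unifPi (Fin r)) =
      ∑ π, H π * ((∑ i, bern r i x * bern r (π i) y) / (r - 1).factorial) := by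
  have hm : Measurable fun p : (Fin r → ℝ) × (Fin r → ℝ) =>
      st (Function.update p.2 b y) * (st (Function.update p.1 b x))⁻¹ := by
    have h1 : Measurable fun q : Equiv.Perm (Fin r) × Equiv.Perm (Fin r) => q.2 * q.1⁻¹ :=
      measurable_of_countable _
    exact h1.comp ((measurable_st.comp ((measurable_update_left b x).comp measurable_fst)).prodMk
      (measurable_st.comp ((measurable_update_left b y).comp measurable_snd)))
  rw [← integral_map (φ := fun p : (Fin r → ℝ) × (Fin r → ℝ) =>
      st (Function.update p.2 b y) * (st (Function.update p.1 b x))⁻¹) (f := H) hm.aemeasurable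
      (measurable_of_countable H).aestronglyMeasurable]
  have : IsProbabilityMeasure (((unifPi (Fin r)).prod (unifPi (Fin r))).map fun p =>
      st (Function.update p.2 b y) * (st (Function.update p.1 b x))⁻¹) :=
    Measure.isProbabilityMeasure_map hm.aemeasurable
  rw [integral_fintype .of_finite]
  refine Finset.sum_congr rfl fun π _ => ?_
  rw [map_measureReal_apply hm MeasurableSpace.measurableSet_top, smul_eq_mul, mul_comm,
    ← measureReal_pattern_update b π x y]
  rfl

theorem measurable_perm : Measurable (perm : (Fin r → ℝ × ℝ) → Equiv.Perm (Fin r)) := by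
  refine measurable_to_countable' fun π => ?_
  have : perm ⁻¹' {π} = ⋃ s : Equiv.Perm (Fin r), {z : Fin r → ℝ × ℝ | st (fun i => (z i).1) = s⁻¹} ∩
      {z | st (fun i => (z (s i)).2) = π} := by
    ext z
    simp only [Set.mem_preimage, Set.mem_singleton_iff, Set.mem_iUnion, Set.mem_inter_iff,
      Set.mem_ofPred_eq, st, inv_inj, exists_eq_left']
    rfl
  rw [this]
  refine MeasurableSet.iUnion fun s => MeasurableSet.inter ?_ ?_
  · exact (measurable_st.comp (by fun_prop : Measurable fun (z : Fin r → ℝ × ℝ) i => (z i).1))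
      (MeasurableSpace.measurableSet_top (s := {s⁻¹}))
  · exact (measurable_st.comp (by fun_prop : Measurable fun (z : Fin r → ℝ × ℝ) i => (z (s i)).2))
      (MeasurableSpace.measurableSet_top (s := {π}))

/-- The `r - 1` random points are read off two independent vectors of length `r`, whose last
coordinates are overwritten by those of `z`. -/
theorem psi_eq [NeZero r] (π : Equiv.Perm (Fin r)) (z : ℝ × ℝ) :
    psi π z = (∑ i, bern r i z.1 * bern r (π i) z.2) / (r - 1).factorial := by
  obtain ⟨m, rfl⟩ : ∃ m, r = m + 1 := ⟨r - 1, (Nat.sub_add_cancel NeZero.one_le).symm⟩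
  rw [← measureReal_pattern_update (Fin.last m) π z.1 z.2, psi]
  have h1 := (measurePreserving_comp_injective (Fin.castSucc_injective m)).prod
    (measurePreserving_comp_injective (Fin.castSucc_injective m))
  have h2 := (measurePreserving_arrowProdEquivProdArrow ℝ ℝ (Fin m) (fun _ => unif)
    (fun _ => unif)).symm
  have h3 : MeasurePreserving (fun (p : (Fin (m + 1) → ℝ) × (Fin (m + 1) → ℝ)) (i : Fin m) =>
      (p.1 i.castSucc, p.2 i.castSucc)) ((unifPi (Fin (m + 1))).prod (unifPi (Fin (m + 1))))
      (Measure.pi fun _ : Fin m => unifSq) := h2.comp h1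
  have hmeas : Measurable fun (Z : Fin m → ℝ × ℝ) (i : Fin (m + 1)) =>
      if h : (i : ℕ) < m then Z ⟨i, h⟩ else z := by
    refine measurable_pi_lambda _ fun i => ?_
    by_cases h : (i : ℕ) < m <;> simp only [h, dif_pos, dif_neg, not_false_iff] <;> fun_prop
  have h4 : MeasurableSet {Z : Fin m → ℝ × ℝ |
      perm (fun i : Fin (m + 1) => if h : (i : ℕ) < m then Z ⟨i, h⟩ else z) = π} :=
    (measurable_perm.comp hmeas) (MeasurableSpace.measurableSet_top (s := {π}))
  show (Measure.pi fun _ : Fin m => unifSq).real {Z | perm (fun i : Fin (m + 1) =>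
    if h : (i : ℕ) < m then Z ⟨i, h⟩ else z) = π} = _
  rw [← h3.measureReal_preimage h4.nullMeasurableSet]
  refine measureReal_congr ?_
  have h5 : ∀ᵐ p ∂(unifPi (Fin (m + 1))).prod (unifPi (Fin (m + 1))),
      Function.Injective (Function.update p.2 (Fin.last m) z.2) :=
    measurePreserving_snd.quasiMeasurePreserving.ae (ae_injective_update_unifPi (Fin.last m) z.2)
  filter_upwards [h5] with p hp
  simp only [eq_iff_iff]
  show perm (fun i : Fin (m + 1) => if h : (i : ℕ) < m then
    (p.1 (⟨i, h⟩ : Fin m).castSucc, p.2 (⟨i, h⟩ : Fin m).castSucc) else z) = π ↔ _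
  have h6 : (fun i : Fin (m + 1) => if h : (i : ℕ) < m then
      (p.1 (⟨i, h⟩ : Fin m).castSucc, p.2 (⟨i, h⟩ : Fin m).castSucc) else z) = fun i =>
      (Function.update p.1 (Fin.last m) z.1 i, Function.update p.2 (Fin.last m) z.2 i) := by
    funext i
    by_cases h : (i : ℕ) < m
    · have : i ≠ Fin.last m := fun h' => by simp [h'] at h
      rw [dif_pos h, Function.update_of_ne this, Function.update_of_ne this]
      rfl
    · have : i = Fin.last m := Fin.ext (by have := i.2; simp; omega)
      subst this
      simp
  rw [h6, perm_eq_mul_inv _ hp]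
  rfl

end Psi

/-! ### Bilinear Bernstein forms and their `L²` geometry. -/

section BernsteinForms

variable {r : ℕ}

/-- The function `∑ M i j b_i(x) b_j(y)` on the plane. -/
noncomputable def bernForm (M : Matrix (Fin r) (Fin r) ℝ) (z : ℝ × ℝ) : ℝ :=
  ∑ i, ∑ j, M i j * (bern r i z.1 * bern r j z.2)

theorem continuous_bernForm (M : Matrix (Fin r) (Fin r) ℝ) : Continuous (bernForm M) := by
  unfold bernForm
  refine continuous_finsetSum _ fun i _ => continuous_finsetSum _ fun j _ => ?_
  have h1 := (continuous_bern i).comp continuous_fst (X := ℝ × ℝ)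
  have h2 := (continuous_bern j).comp continuous_snd (X := ℝ × ℝ)
  exact continuous_const.mul (h1.mul h2)

theorem abs_bernForm_le (M : Matrix (Fin r) (Fin r) ℝ) (z : ℝ × ℝ) :
    |bernForm M z| ≤ ∑ i, ∑ j, |M i j| := by
  refine (Finset.abs_sum_le_sum_abs _ _).trans (Finset.sum_le_sum fun i _ => ?_)
  refine (Finset.abs_sum_le_sum_abs _ _).trans (Finset.sum_le_sum fun j _ => ?_)
  rw [abs_mul, abs_of_nonneg (mul_nonneg (bern_nonneg i _) (bern_nonneg j _))]
  exact mul_le_of_le_one_right (abs_nonneg _)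
    (mul_le_one₀ (bern_le_one i _) (bern_nonneg j _) (bern_le_one j _))

theorem bernForm_add (M N : Matrix (Fin r) (Fin r) ℝ) (z : ℝ × ℝ) :
    bernForm (M + N) z = bernForm M z + bernForm N z := by
  simp only [bernForm, Matrix.add_apply, add_mul, Finset.sum_add_distrib]

theorem bernForm_smul (a : ℝ) (M : Matrix (Fin r) (Fin r) ℝ) (z : ℝ × ℝ) :
    bernForm (a • M) z = a * bernForm M z := by
  simp only [bernForm, Matrix.smul_apply, smul_eq_mul, mul_assoc, Finset.mul_sum]

theorem bernForm_swap (M : Matrix (Fin r) (Fin r) ℝ) (z : ℝ × ℝ) :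
    bernForm M z.swap = bernForm M.transpose z := by
  unfold bernForm
  rw [Finset.sum_comm]
  refine Finset.sum_congr rfl fun i _ => Finset.sum_congr rfl fun j _ => ?_
  simp only [Prod.fst_swap, Prod.snd_swap, Matrix.transpose_apply]
  ring

theorem integrable_bern (k : Fin r) : Integrable (bern r k) unif :=
  Integrable.of_bound (continuous_bern k).aestronglyMeasurable 1 (ae_of_all _ fun x => by
    rw [Real.norm_eq_abs, abs_of_nonneg (bern_nonneg k x)]; exact bern_le_one k x)

theorem integral_bernForm_snd {M : Matrix (Fin r) (Fin r) ℝ} (hM : ∀ i, ∑ j, M i j = 0) (x : ℝ) :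
    ∫ y, bernForm M (x, y) ∂unif = 0 := by
  unfold bernForm
  have hi : ∀ i j, Integrable (fun y => M i j * (bern r i x * bern r j y)) unif := fun i j =>
    ((integrable_bern j).const_mul _).const_mul _
  rw [integral_finsetSum _ fun i _ => integrable_finsetSum _ fun j _ => hi i j]
  refine Finset.sum_eq_zero fun i _ => ?_
  rw [integral_finsetSum _ fun j _ => hi i j]
  simp only [integral_const_mul, integral_bern]
  rw [← Finset.sum_mul, hM, zero_mul]

theorem integral_bernForm_fst {M : Matrix (Fin r) (Fin r) ℝ} (hM : ∀ j, ∑ i, M i j = 0) (y : ℝ) :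
    ∫ x, bernForm M (x, y) ∂unif = 0 := by
  have h : ∀ x, bernForm M (x, y) = bernForm M.transpose (y, x) := fun x => bernForm_swap M (y, x)
  simp only [h]
  exact integral_bernForm_snd (M := M.transpose) hM y

theorem integrable_bernForm (M : Matrix (Fin r) (Fin r) ℝ) : Integrable (bernForm M) unifSq :=
  Integrable.of_bound (continuous_bernForm M).aestronglyMeasurable _
    (ae_of_all _ fun z => by rw [Real.norm_eq_abs]; exact abs_bernForm_le M z)

theorem integrable_bernForm_mul (M N : Matrix (Fin r) (Fin r) ℝ) :
    Integrable (fun z => bernForm M z * bernForm N z) unifSq :=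
  (integrable_bernForm N).bdd_mul (continuous_bernForm M).aestronglyMeasurable
    (ae_of_all _ fun z => by rw [Real.norm_eq_abs]; exact abs_bernForm_le M z)

theorem integral_bernForm {M : Matrix (Fin r) (Fin r) ℝ} (hM : ∀ i, ∑ j, M i j = 0) :
    ∫ z, bernForm M z ∂unifSq = 0 := by
  have h : Integrable (bernForm M) (unif.prod unif) := integrable_bernForm M
  rw [unifSq, integral_prod _ h]
  simp [integral_bernForm_snd hM]

theorem integral_unifSq_swap (f : ℝ × ℝ → ℝ) : ∫ z, f z.swap ∂unifSq = ∫ z, f z ∂unifSq :=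
  integral_prod_swap (μ := unif) (ν := unif) f

/-- Substituting `x = t / (1 + t)` and clearing `(1 + t)^(r-1)` turns the Bernstein basis into
binomial multiples of the monomials in `t`; the resulting polynomial vanishes for all `t > 0`. -/
theorem eq_zero_of_sum_mul_bern_eq_zero {a : Fin r → ℝ}
    (h : ∀ x ∈ Set.Icc (0 : ℝ) 1, ∑ k, a k * bern r k x = 0) : a = 0 := by
  classical
  set p : Polynomial ℝ := ∑ k : Fin r, Polynomial.monomial (k : ℕ) (a k * ((r - 1).choose k : ℝ))
    with hp
  have hroot : ∀ t ∈ Set.Ioi (0 : ℝ), p.IsRoot t := fun t ht => by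
    have ht0 : 0 < t := ht
    have ht1 : 0 < 1 + t := by linarith
    have hx : t / (1 + t) ∈ Set.Icc (0 : ℝ) 1 :=
      ⟨by positivity, by rw [div_le_one ht1]; linarith⟩
    have h1 := h _ hx
    have h2 : ∀ k : Fin r, a k * bern r k (t / (1 + t)) =
        (a k * ((r - 1).choose k : ℝ) * t ^ (k : ℕ)) / (1 + t) ^ (r - 1) := fun k => by
      have hk : (k : ℕ) + (r - 1 - k) = r - 1 := by have := k.2; omega
      rw [bern, clamp_of_mem hx, show 1 - t / (1 + t) = 1 / (1 + t) by field_simp; ring]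
      have hpow : (1 + t) ^ (r - 1) = (1 + t) ^ (k : ℕ) * (1 + t) ^ (r - 1 - (k : ℕ)) := by
        rw [← pow_add, hk]
      rw [hpow, div_pow, div_pow, one_pow]
      field_simp
    simp only [h2, ← Finset.sum_div] at h1
    rw [div_eq_zero_iff, or_iff_left (by positivity)] at h1
    rw [Polynomial.IsRoot.def, hp, Polynomial.eval_finsetSum]
    simpa using h1
  have hp0 : p = 0 := Polynomial.eq_zero_of_infinite_isRoot p
    ((Set.Ioi_infinite (0 : ℝ)).mono hroot)
  ext k
  have h1 : p.coeff k = a k * ((r - 1).choose k : ℝ) := by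
    rw [hp, Polynomial.finsetSum_coeff, Finset.sum_eq_single k]
    · simp
    · intro j _ hj
      rw [Polynomial.coeff_monomial, if_neg]
      exact fun h => hj (Fin.ext h)
    · simp
  rw [hp0, Polynomial.coeff_zero] at h1
  have h2 : ((r - 1).choose k : ℝ) ≠ 0 := by
    have : 0 < (r - 1).choose k := Nat.choose_pos (by have := k.2; omega)
    positivity
  simpa [h2] using h1.symm

/-- Continuity upgrades the vanishing to the whole square; independence of the Bernstein polynomials
is then used in each variable. -/
theorem eq_zero_of_bernForm_ae_eq_zero {M : Matrix (Fin r) (Fin r) ℝ}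
    (h : bernForm M =ᵐ[unifSq] 0) : M = 0 := by
  have h1 : unifSq = volume.restrict (Set.Icc (0 : ℝ) 1 ×ˢ Set.Icc (0 : ℝ) 1) := by
    rw [unifSq, unif, Measure.prod_restrict, Measure.volume_eq_prod]
  rw [h1] at h
  have h2 := Measure.eqOn_of_ae_eq h (continuous_bernForm M).continuousOn continuousOn_const (by
    rw [interior_prod_eq, interior_Icc, closure_prod_eq, closure_Ioo zero_ne_one])
  have h3 : ∀ y ∈ Set.Icc (0 : ℝ) 1, (fun i => ∑ j, M i j * bern r j y) = 0 := fun y hy => by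
    refine eq_zero_of_sum_mul_bern_eq_zero fun x hx => ?_
    have := h2 (Set.mk_mem_prod hx hy)
    simp only [bernForm, Pi.zero_apply] at this
    rw [← this]
    refine Finset.sum_congr rfl fun i _ => ?_
    rw [Finset.sum_mul]
    exact Finset.sum_congr rfl fun j _ => by ring
  ext i j
  have := eq_zero_of_sum_mul_bern_eq_zero (a := fun j => M i j)
    fun y hy => congrFun (h3 y hy) i
  exact congrFun this j

/-- The `L²` inner product of the functions `bernForm M`. -/
noncomputable def gram (r : ℕ) : LinearMap.BilinForm ℝ (Matrix (Fin r) (Fin r) ℝ) :=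
  LinearMap.mk₂ ℝ (fun M N => ∫ z, bernForm M z * bernForm N z ∂unifSq)
    (fun M M' N => by
      simp only [bernForm_add, add_mul]
      exact integral_add (integrable_bernForm_mul M N) (integrable_bernForm_mul M' N))
    (fun a M N => by
      simp only [bernForm_smul, mul_assoc]
      exact integral_const_mul _ _)
    (fun M N N' => by
      simp only [bernForm_add, mul_add]
      exact integral_add (integrable_bernForm_mul M N) (integrable_bernForm_mul M N'))
    (fun a M N => by
      simp only [bernForm_smul, mul_left_comm _ a]
      exact integral_const_mul _ _)

theorem gram_apply (M N : Matrix (Fin r) (Fin r) ℝ) :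
    gram r M N = ∫ z, bernForm M z * bernForm N z ∂unifSq := rfl

theorem gram_comm (M N : Matrix (Fin r) (Fin r) ℝ) : gram r M N = gram r N M := by
  simp only [gram_apply, mul_comm]

theorem gram_transpose (M N : Matrix (Fin r) (Fin r) ℝ) :
    gram r M.transpose N = gram r M N.transpose := by
  simp only [gram_apply]
  rw [← integral_unifSq_swap]
  simp only [bernForm_swap, Matrix.transpose_transpose]

theorem gram_self_nonneg (M : Matrix (Fin r) (Fin r) ℝ) : 0 ≤ gram r M M :=
  integral_nonneg fun _ => mul_self_nonneg _

theorem eq_zero_of_gram_self_eq_zero {M : Matrix (Fin r) (Fin r) ℝ} (h : gram r M M = 0) :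
    M = 0 := by
  rw [gram_apply, integral_eq_zero_iff_of_nonneg (fun _ => mul_self_nonneg _)
    (integrable_bernForm_mul M M)] at h
  refine eq_zero_of_bernForm_ae_eq_zero ?_
  filter_upwards [h] with z hz
  simpa using hz

/-- The quadratic form `Var f(U,V) + p Cov(f(U,V), f(V,U))` for `f = bernForm M`. -/
noncomputable def twistedVar (p : ℝ) (M : Matrix (Fin r) (Fin r) ℝ) : ℝ :=
  gram r M M + p * gram r M M.transpose

/-- Transposition is an isometry of `gram`, so the square of `M + Mᵀ` is `2 (‖M‖² + ⟨M, Mᵀ⟩)`. For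
`p` in `[0,1]` both terms are nonnegative, from which the kernel can be read. -/
theorem twistedVar_eq (p : ℝ) (M : Matrix (Fin r) (Fin r) ℝ) :
    twistedVar p M =
      (1 - p) * gram r M M + p / 2 * gram r (M + M.transpose) (M + M.transpose) := by
  simp only [twistedVar, map_add, LinearMap.add_apply, gram_transpose, Matrix.transpose_transpose]
  ring

theorem twistedVar_nonneg {p : ℝ} (hp : p ∈ Set.Icc (0 : ℝ) 1) (M : Matrix (Fin r) (Fin r) ℝ) :
    0 ≤ twistedVar p M := by
  rw [twistedVar_eq]
  have h1 := gram_self_nonneg M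
  have h2 := gram_self_nonneg (M + M.transpose)
  have := hp.1
  have := hp.2
  exact add_nonneg (mul_nonneg (by linarith) h1) (mul_nonneg (by linarith) h2)

theorem twistedVar_eq_zero_iff_of_lt {p : ℝ} (hp : p ∈ Set.Ico (0 : ℝ) 1)
    (M : Matrix (Fin r) (Fin r) ℝ) : twistedVar p M = 0 ↔ M = 0 := by
  refine ⟨fun h => ?_, fun h => by simp [h, twistedVar]⟩
  rw [twistedVar_eq] at h
  have h1 := gram_self_nonneg M
  have h2 := gram_self_nonneg (M + M.transpose)
  have h3 : 0 < 1 - p := by linarith [hp.2]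
  have h4 : 0 ≤ p / 2 * gram r (M + M.transpose) (M + M.transpose) :=
    mul_nonneg (by linarith [hp.1]) h2
  have h5 : (1 - p) * gram r M M = 0 := le_antisymm (by linarith) (mul_nonneg h3.le h1)
  exact eq_zero_of_gram_self_eq_zero ((mul_eq_zero.1 h5).resolve_left h3.ne')

theorem twistedVar_one_eq_zero_iff (M : Matrix (Fin r) (Fin r) ℝ) :
    twistedVar 1 M = 0 ↔ M + M.transpose = 0 := by
  have h := twistedVar_eq 1 M
  rw [sub_self, zero_mul, zero_add] at h
  rw [h]
  refine ⟨fun h => eq_zero_of_gram_self_eq_zero (by linarith), fun h => by simp [h]⟩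

end BernsteinForms

/-! ### The covariance matrix as a quadratic form on zero-sum matrices. -/

section CovarianceMatrix

variable {r : ℕ}

/-- The permutation matrix of `π`, centered so that its rows and columns sum to zero. -/
noncomputable def centeredPerm (π : Equiv.Perm (Fin r)) : Matrix (Fin r) (Fin r) ℝ :=
  fun i j => (if π i = j then 1 else 0) - 1 / r

theorem centeredPerm_row_sum (π : Equiv.Perm (Fin r)) (i : Fin r) :
    ∑ j, centeredPerm π i j = 0 := by
  have : (r : ℝ) ≠ 0 := by have := i.pos; positivity
  simp [centeredPerm, this]

theorem centeredPerm_col_sum (π : Equiv.Perm (Fin r)) (j : Fin r) :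
    ∑ i, centeredPerm π i j = 0 := by
  have : (r : ℝ) ≠ 0 := by have := j.pos; positivity
  have h : ∀ i, (π i = j) = (i = π.symm j) := fun i => by
    rw [Equiv.eq_symm_apply]
  simp [centeredPerm, this, h]

/-- The linear combination of the matrices `centeredPerm π` with given coefficients. -/
noncomputable def centeredComb (r : ℕ) :
    (Equiv.Perm (Fin r) → ℝ) →ₗ[ℝ] Matrix (Fin r) (Fin r) ℝ :=
  Fintype.linearCombination ℝ centeredPerm

theorem centeredComb_apply (c : Equiv.Perm (Fin r) → ℝ) :
    centeredComb r c = ∑ π, c π • centeredPerm π := rfl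

theorem centeredComb_row_sum (c : Equiv.Perm (Fin r) → ℝ) (i : Fin r) :
    ∑ j, centeredComb r c i j = 0 := by
  simp only [centeredComb_apply, Matrix.sum_apply, Matrix.smul_apply, smul_eq_mul]
  rw [Finset.sum_comm]
  simp only [← Finset.mul_sum, centeredPerm_row_sum, mul_zero, Finset.sum_const_zero]

theorem centeredComb_col_sum (c : Equiv.Perm (Fin r) → ℝ) (j : Fin r) :
    ∑ i, centeredComb r c i j = 0 := by
  simp only [centeredComb_apply, Matrix.sum_apply, Matrix.smul_apply, smul_eq_mul]
  rw [Finset.sum_comm]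
  simp only [← Finset.mul_sum, centeredPerm_col_sum, mul_zero, Finset.sum_const_zero]

/-- The Bernstein polynomials sum to one, so subtracting a constant amounts to subtracting a
constant matrix. -/
theorem psi_sub_eq [NeZero r] (π : Equiv.Perm (Fin r)) (z : ℝ × ℝ) :
    psi π z - 1 / r.factorial = bernForm (centeredPerm π) z / (r - 1).factorial := by
  have h1 : bernForm (centeredPerm π) z = ∑ i, bern r i z.1 * bern r (π i) z.2 - 1 / r := by
    simp only [bernForm, centeredPerm, sub_mul, Finset.sum_sub_distrib, ite_mul, one_mul, zero_mul,
      Finset.sum_ite_eq, Finset.mem_univ, if_true, ← Finset.mul_sum, sum_bern, mul_one]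
  have h2 : (r : ℝ) ≠ 0 := NeZero.ne _
  rw [psi_eq, h1, ← Nat.mul_factorial_pred (NeZero.ne r)]
  push_cast
  field_simp

theorem integral_psi [NeZero r] (π : Equiv.Perm (Fin r)) :
    ∫ z, psi π z ∂unifSq = 1 / r.factorial := by
  have h1 : ∀ z, psi π z = bernForm (centeredPerm π) z / (r - 1).factorial + 1 / r.factorial :=
    fun z => by rw [← psi_sub_eq]; ring
  simp only [h1]
  rw [integral_add ((integrable_bernForm _).div_const _) (integrable_const _), integral_div,
    integral_bernForm (centeredPerm_row_sum π)]
  simp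

/-- Of the four factorials, two come from the definition of `sigma` and two from the functions `psi`
inside the covariance. -/
theorem sigma_apply [NeZero r] (p : ℝ) (π ρ : Equiv.Perm (Fin r)) :
    sigma r p π ρ = (gram r (centeredPerm π) (centeredPerm ρ) +
      p * gram r (centeredPerm π) (centeredPerm ρ).transpose) / ((r - 1).factorial : ℝ) ^ 4 := by
  have h1 : ∫ z, psi ρ z.swap ∂unifSq = 1 / r.factorial := by
    rw [integral_unifSq_swap, integral_psi]
  simp only [sigma, Matrix.of_apply, covariance, h1, integral_psi, psi_sub_eq, bernForm_swap]
  simp only [gram_apply, div_mul_div_comm, integral_div]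
  field_simp

theorem dotProduct_sigma_mulVec [NeZero r] (p : ℝ) (c : Equiv.Perm (Fin r) → ℝ) :
    dotProduct c (Matrix.mulVec (sigma r p) c) =
      twistedVar p (centeredComb r c) / ((r - 1).factorial : ℝ) ^ 4 := by
  simp only [twistedVar, centeredComb_apply, Matrix.transpose_sum, Matrix.transpose_smul, map_sum,
    map_smul, LinearMap.sum_apply, LinearMap.smul_apply, smul_eq_mul, dotProduct, Matrix.mulVec,
    sigma_apply, Finset.mul_sum, ← Finset.sum_add_distrib, Finset.sum_div]
  rw [Finset.sum_comm]
  refine Finset.sum_congr rfl fun i _ => Finset.sum_congr rfl fun j _ => ?_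
  ring

theorem posSemidef_sigma [NeZero r] {p : ℝ} (hp : p ∈ Set.Icc (0 : ℝ) 1) :
    (sigma r p).PosSemidef := by
  refine Matrix.PosSemidef.of_dotProduct_mulVec_nonneg ?_ fun c => ?_
  · ext π ρ
    simp only [Matrix.conjTranspose_apply, star_trivial, sigma_apply]
    rw [gram_comm (centeredPerm ρ) (centeredPerm π), ← gram_transpose, gram_comm (Matrix.transpose _)]
  · rw [star_trivial, dotProduct_sigma_mulVec]
    exact div_nonneg (twistedVar_nonneg hp _) (by positivity)

theorem sigma_mulVec_eq_zero_iff [NeZero r] {p : ℝ} (hp : p ∈ Set.Icc (0 : ℝ) 1)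
    (c : Equiv.Perm (Fin r) → ℝ) :
    Matrix.mulVec (sigma r p) c = 0 ↔ twistedVar p (centeredComb r c) = 0 := by
  rw [← (posSemidef_sigma hp).dotProduct_mulVec_zero_iff, star_trivial, dotProduct_sigma_mulVec,
    div_eq_zero_iff, or_iff_left (by positivity)]

/-- If the entry vanished, `centeredPerm π` would be zero or skew-symmetric, hence zero on its
diagonal; but its corner entry is `-1/r` or `1 - 1/r`. -/
theorem sigma_diag_pos {p : ℝ} (hp : p ∈ Set.Icc (0 : ℝ) 1) (hr : 2 ≤ r)
    (π : Equiv.Perm (Fin r)) : 0 < sigma r p π π := by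
  have : NeZero r := ⟨by omega⟩
  have h1 : sigma r p π π = twistedVar p (centeredPerm π) / ((r - 1).factorial : ℝ) ^ 4 := by
    rw [sigma_apply, twistedVar]
  rw [h1]
  refine div_pos (lt_of_le_of_ne (twistedVar_nonneg hp _) fun h => ?_) (by positivity)
  have h2 : centeredPerm π 0 0 = 0 := by
    rcases hp.2.lt_or_eq with h3 | h3
    · rw [(twistedVar_eq_zero_iff_of_lt ⟨hp.1, h3⟩ _).1 h.symm, Matrix.zero_apply]
    · rw [h3] at h
      have := congrFun (congrFun ((twistedVar_one_eq_zero_iff _).1 h.symm) 0) 0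
      simp only [Matrix.add_apply, Matrix.transpose_apply, Matrix.zero_apply] at this
      linarith
  have h3 : (2 : ℝ) ≤ r := by exact_mod_cast hr
  have h4 : (1 : ℝ) / r < 1 := by rw [div_lt_one (by linarith)]; linarith
  have h5 : (0 : ℝ) < 1 / r := by positivity
  simp only [centeredPerm] at h2
  split_ifs at h2 <;> linarith

end CovarianceMatrix

/-! ### The rank, by Birkhoff's theorem and dimension counting. -/

section Rank

variable {r : ℕ}

/-- The kernel of a positive semidefinite matrix is the null set of its quadratic form, so
rank-nullity applies to any `L` with that kernel. -/
theorem rank_sigma_eq [NeZero r] {p : ℝ} (hp : p ∈ Set.Icc (0 : ℝ) 1) {E : Type*} [AddCommGroup E]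
    [Module ℝ E] (L : (Equiv.Perm (Fin r) → ℝ) →ₗ[ℝ] E)
    (hL : ∀ c, twistedVar p (centeredComb r c) = 0 ↔ L c = 0) :
    (sigma r p).rank = Module.finrank ℝ (LinearMap.range L) := by
  have h1 : LinearMap.ker (sigma r p).mulVecLin = LinearMap.ker L := by
    ext c
    rw [LinearMap.mem_ker, LinearMap.mem_ker, Matrix.mulVecLin_apply, sigma_mulVec_eq_zero_iff hp,
      hL]
  have h2 := (sigma r p).mulVecLin.finrank_range_add_finrank_ker
  have h3 := L.finrank_range_add_finrank_ker
  rw [h1] at h2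
  rw [Matrix.rank]
  omega

/-- The flat matrix `1/r` plus a small multiple of `M` is doubly stochastic, hence by Birkhoff a
convex combination of permutation matrices; subtract the flat matrix and rescale. -/
theorem mem_range_centeredComb [NeZero r] {M : Matrix (Fin r) (Fin r) ℝ}
    (hrow : ∀ i, ∑ j, M i j = 0) (hcol : ∀ j, ∑ i, M i j = 0) :
    M ∈ LinearMap.range (centeredComb r) := by
  have hr : (0 : ℝ) < r := by exact_mod_cast NeZero.pos r
  -- `K` bounds all entries, so scaling by `1/(rK)` keeps the perturbation within `1/r`; the `+ 1`
  -- makes `K` positive even if `M = 0`.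
  set K : ℝ := ∑ i, ∑ j, |M i j| + 1 with hK
  have hK0 : 0 < K := by positivity
  have hMK : ∀ i j, |M i j| ≤ K := fun i j => by
    have h1 : |M i j| ≤ ∑ j, |M i j| :=
      Finset.single_le_sum (f := fun j => |M i j|) (fun _ _ => abs_nonneg _) (Finset.mem_univ j)
    have h2 : ∑ j, |M i j| ≤ ∑ i, ∑ j, |M i j| :=
      Finset.single_le_sum (f := fun i => ∑ j, |M i j|)
        (fun _ _ => Finset.sum_nonneg fun _ _ => abs_nonneg _) (Finset.mem_univ i)
    linarith
  set N : Matrix (Fin r) (Fin r) ℝ := fun i j => 1 / r + (r * K)⁻¹ * M i j with hN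
  have hmem : N ∈ doublyStochastic ℝ (Fin r) := by
    rw [mem_doublyStochastic_iff_sum]
    refine ⟨fun i j => ?_, fun i => ?_, fun j => ?_⟩
    · have h1 := (abs_le.1 (hMK i j)).1
      have h2 : (1 : ℝ) / r = (r * K)⁻¹ * K := by field_simp
      simp only [hN]
      rw [h2, ← mul_add]
      exact mul_nonneg (by positivity) (by linarith)
    · simp only [hN, Finset.sum_add_distrib, ← Finset.mul_sum, hrow]
      simp [hr.ne']
    · simp only [hN, Finset.sum_add_distrib, ← Finset.mul_sum, hcol]
      simp [hr.ne']
  obtain ⟨w, -, hw1, hw⟩ := exists_eq_sum_perm_of_mem_doublyStochastic hmem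
  refine ⟨fun π => r * K * w π, ?_⟩
  ext i j
  have h1 := congrFun (congrFun hw i) j
  simp only [Matrix.sum_apply, Matrix.smul_apply, smul_eq_mul, hN, Equiv.Perm.permMatrix,
    PEquiv.toMatrix_apply, Equiv.toPEquiv_apply, Option.mem_def, Option.some.injEq] at h1
  simp only [centeredComb_apply, Matrix.sum_apply, Matrix.smul_apply, smul_eq_mul, centeredPerm,
    mul_sub, Finset.sum_sub_distrib, mul_assoc, ← Finset.mul_sum, ← Finset.sum_mul, hw1, h1]
  field_simp
  ring

/-- The entries of the extension of `N` by one row and one column to a matrix whose rows and columns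
sum to zero. -/
def zeroSumEntry {m : ℕ} (N : Matrix (Fin m) (Fin m) ℝ) (i j : Fin (m + 1)) : ℝ :=
  Fin.lastCases (Fin.lastCases (∑ k, ∑ l, N k l) (fun l => -∑ k, N k l) j)
    (fun k => Fin.lastCases (-∑ l, N k l) (fun l => N k l) j) i

/-- The extension of a matrix by one row and one column to a matrix whose rows and columns sum to
zero, as a linear map. -/
def zeroSumExt (m : ℕ) :
    Matrix (Fin m) (Fin m) ℝ →ₗ[ℝ] Matrix (Fin (m + 1)) (Fin (m + 1)) ℝ where
  toFun N := Matrix.of (zeroSumEntry N)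
  map_add' N N' := by
    ext i j
    cases i using Fin.lastCases <;> cases j using Fin.lastCases <;>
      simp [zeroSumEntry, Finset.sum_add_distrib, add_comm]
  map_smul' a N := by
    ext i j
    cases i using Fin.lastCases <;> cases j using Fin.lastCases <;>
      simp [zeroSumEntry, Finset.mul_sum]

theorem zeroSumExt_apply {m : ℕ} (N : Matrix (Fin m) (Fin m) ℝ) (i j : Fin (m + 1)) :
    zeroSumExt m N i j = zeroSumEntry N i j := rfl

variable {m : ℕ}

theorem zeroSumExt_row_sum (N : Matrix (Fin m) (Fin m) ℝ) (i : Fin (m + 1)) :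
    ∑ j, zeroSumExt m N i j = 0 := by
  rw [Fin.sum_univ_castSucc]
  cases i using Fin.lastCases
  · simp only [zeroSumExt_apply, zeroSumEntry, Fin.lastCases_last,
      Fin.lastCases_castSucc, Finset.sum_neg_distrib]
    rw [Finset.sum_comm]
    ring
  · simp [zeroSumExt_apply, zeroSumEntry]

theorem zeroSumExt_transpose (N : Matrix (Fin m) (Fin m) ℝ) :
    (zeroSumExt m N).transpose = zeroSumExt m N.transpose := by
  ext i j
  cases i using Fin.lastCases <;> cases j using Fin.lastCases <;>
    simp [zeroSumExt_apply, zeroSumEntry]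
  rw [Finset.sum_comm]

theorem zeroSumExt_col_sum (N : Matrix (Fin m) (Fin m) ℝ) (j : Fin (m + 1)) :
    ∑ i, zeroSumExt m N i j = 0 := by
  have := zeroSumExt_row_sum N.transpose j
  rwa [← zeroSumExt_transpose] at this

theorem zeroSumExt_injective : Function.Injective (zeroSumExt m) := fun N N' h => by
  ext k l
  have := congrFun (congrFun h k.castSucc) l.castSucc
  simpa [zeroSumExt_apply, zeroSumEntry] using this

/-- The zero sums recover the last row and column from the upper left block, so the zero-sum
matrices are exactly parametrized by that block. -/
theorem eq_zeroSumExt {M : Matrix (Fin (m + 1)) (Fin (m + 1)) ℝ}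
    (hrow : ∀ i, ∑ j, M i j = 0) (hcol : ∀ j, ∑ i, M i j = 0) :
    zeroSumExt m (M.submatrix Fin.castSucc Fin.castSucc) = M := by
  have h1 : ∀ i, M i (Fin.last m) = -∑ l : Fin m, M i l.castSucc := fun i => by
    have := hrow i
    rw [Fin.sum_univ_castSucc] at this
    linarith
  have h2 : ∀ j, M (Fin.last m) j = -∑ k : Fin m, M k.castSucc j := fun j => by
    have := hcol j
    rw [Fin.sum_univ_castSucc] at this
    linarith
  ext i j
  cases i using Fin.lastCases <;> cases j using Fin.lastCases
  · simp only [zeroSumExt_apply, zeroSumEntry, Matrix.submatrix_apply, Fin.lastCases_last]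
    rw [h1]
    simp only [h2, Finset.sum_neg_distrib, neg_neg]
    rw [Finset.sum_comm]
  · simp only [zeroSumExt_apply, zeroSumEntry, Matrix.submatrix_apply,
      Fin.lastCases_last, Fin.lastCases_castSucc, h2]
  · simp only [zeroSumExt_apply, zeroSumEntry, Matrix.submatrix_apply,
      Fin.lastCases_last, Fin.lastCases_castSucc, h1]
  · simp [zeroSumExt_apply, zeroSumEntry, Matrix.submatrix_apply]

theorem rank_sigma_of_lt [NeZero r] {p : ℝ} (hp : p ∈ Set.Ico (0 : ℝ) 1) :
    (sigma r p).rank = (r - 1) ^ 2 := by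
  obtain ⟨m, rfl⟩ : ∃ m, r = m + 1 := ⟨r - 1, (Nat.sub_add_cancel NeZero.one_le).symm⟩
  rw [rank_sigma_eq ⟨hp.1, hp.2.le⟩ (centeredComb (m + 1))
    fun c => twistedVar_eq_zero_iff_of_lt hp _]
  have h : LinearMap.range (centeredComb (m + 1)) = LinearMap.range (zeroSumExt m) := by
    refine le_antisymm ?_ ?_
    · rintro _ ⟨c, rfl⟩
      exact ⟨_, eq_zeroSumExt (centeredComb_row_sum c) (centeredComb_col_sum c)⟩
    · rintro _ ⟨N, rfl⟩
      exact mem_range_centeredComb (zeroSumExt_row_sum N) (zeroSumExt_col_sum N)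
  rw [h, LinearMap.finrank_range_of_inj zeroSumExt_injective, Module.finrank_matrix]
  simp [pow_two]

/-- The symmetric matrix with entries given by a function of unordered pairs. -/
def symMatrix (m : ℕ) : (Sym2 (Fin m) → ℝ) →ₗ[ℝ] Matrix (Fin m) (Fin m) ℝ where
  toFun f := fun k l => f s(k, l)
  map_add' _ _ := rfl
  map_smul' _ _ := rfl

/-- The kernel of the form consists of the skew matrices. Symmetrizing identifies the quotient with
the symmetric zero-sum matrices, that is, with functions on unordered pairs from `r - 1` indices. -/
theorem rank_sigma_one [NeZero r] : (sigma r 1).rank = r * (r - 1) / 2 := by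
  obtain ⟨m, rfl⟩ : ∃ m, r = m + 1 := ⟨r - 1, (Nat.sub_add_cancel NeZero.one_le).symm⟩
  set L : (Equiv.Perm (Fin (m + 1)) → ℝ) →ₗ[ℝ] Matrix (Fin (m + 1)) (Fin (m + 1)) ℝ :=
    centeredComb (m + 1) +
      (Matrix.transposeLinearEquiv _ _ ℝ ℝ).toLinearMap ∘ₗ centeredComb (m + 1) with hL
  have hLc : ∀ c, L c = centeredComb (m + 1) c + (centeredComb (m + 1) c).transpose := fun _ => rfl
  rw [rank_sigma_eq ⟨zero_le_one, le_rfl⟩ L fun c => by rw [twistedVar_one_eq_zero_iff, hLc]]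
  have h : LinearMap.range L = LinearMap.range (zeroSumExt m ∘ₗ symMatrix m) := by
    refine le_antisymm ?_ ?_
    · rintro _ ⟨c, rfl⟩
      have hsym : (L c).transpose = L c := by
        rw [hLc, Matrix.transpose_add, Matrix.transpose_transpose]
        exact add_comm _ _
      refine ⟨fun s => s.lift ⟨fun k l => L c k.castSucc l.castSucc, fun k l => ?_⟩, ?_⟩
      · exact congrFun (congrFun hsym l.castSucc) k.castSucc
      · refine (eq_zeroSumExt (M := L c) (fun i => ?_) (fun j => ?_) :)
        · simp only [hLc, Matrix.add_apply, Matrix.transpose_apply, Finset.sum_add_distrib,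
            centeredComb_row_sum, centeredComb_col_sum, add_zero]
        · simp only [hLc, Matrix.add_apply, Matrix.transpose_apply, Finset.sum_add_distrib,
            centeredComb_row_sum, centeredComb_col_sum, add_zero]
    · rintro _ ⟨f, rfl⟩
      obtain ⟨c, hc⟩ := mem_range_centeredComb (zeroSumExt_row_sum (symMatrix m f))
        (zeroSumExt_col_sum (symMatrix m f))
      -- A symmetric matrix is the symmetrization of its half.
      refine ⟨(1 / 2 : ℝ) • c, ?_⟩
      have hsym : (symMatrix m f).transpose = symMatrix m f := by
        ext k l
        exact congrArg f Sym2.eq_swap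
      rw [map_smul, hLc, hc, zeroSumExt_transpose, hsym, LinearMap.comp_apply, ← two_smul ℝ,
        smul_smul]
      norm_num
  rw [h, LinearMap.finrank_range_of_inj, Module.finrank_fintype_fun_eq_card, Sym2.card,
    Fintype.card_fin, Nat.choose_two_right]
  rw [LinearMap.coe_comp]
  refine zeroSumExt_injective.comp fun f g hfg => ?_
  ext s
  induction s with
  | _ k l => exact congrFun (congrFun hfg k) l

end Rank

/-! ### Complex estimates for McLeish's method. -/

section ComplexEstimates

/-- This expresses `log (1 + ix) = ix + x²/2 + O(|x|³)`: in the second-order Taylor polynomial of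
the exponential the terms in `x²` cancel. -/
theorem norm_one_add_mul_I_sub_exp_le {x : ℝ} (hx : |x| ≤ 1 / 2) :
    ‖(1 + x * Complex.I) - Complex.exp (x * Complex.I + x ^ 2 / 2)‖ ≤ 2 * |x| ^ 3 := by
  set w : ℂ := x * Complex.I + x ^ 2 / 2 with hw
  have ha := abs_nonneg x
  have hw1 : ‖w‖ ≤ 5 / 4 * |x| := by
    calc ‖w‖ ≤ ‖(x * Complex.I : ℂ)‖ + ‖(x ^ 2 / 2 : ℂ)‖ := norm_add_le _ _
      _ = |x| + |x| ^ 2 / 2 := by simp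
      _ ≤ 5 / 4 * |x| := by nlinarith
  have h1 := Complex.exp_bound (x := w) (by linarith) (n := 3) (by norm_num)
  have h2 : (1 + x * Complex.I) - Complex.exp w =
      -(Complex.exp w - ∑ m ∈ Finset.range 3, w ^ m / (m.factorial : ℂ)) -
        (x ^ 3 / 2 * Complex.I + x ^ 4 / 8) := by
    simp only [Finset.sum_range_succ, Finset.sum_range_zero, Nat.factorial, hw]
    push_cast
    ring_nf
    simp only [Complex.I_sq]
    ring
  have h3 : ‖(x ^ 3 / 2 * Complex.I + x ^ 4 / 8 : ℂ)‖ ≤ |x| ^ 3 / 2 + |x| ^ 4 / 8 := by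
    refine (norm_add_le _ _).trans (le_of_eq ?_)
    simp
  have h4 : ‖w‖ ^ 3 ≤ (5 / 4 * |x|) ^ 3 := pow_le_pow_left₀ (norm_nonneg _) hw1 3
  rw [h2]
  refine (norm_sub_le _ _).trans ?_
  rw [norm_neg]
  have h5 : |x| ^ 4 ≤ |x| ^ 3 * (1 / 2) := by
    rw [pow_succ]
    exact mul_le_mul_of_nonneg_left hx (by positivity)
  have h6 : (0 : ℝ) ≤ |x| ^ 3 := by positivity
  norm_num at h1
  nlinarith

/-- Telescoping, one factor at a time; `1 ≤ M i` allows every partial product to be bounded by the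
full one. -/
theorem norm_prod_sub_prod_le_mul_sum {ι : Type*} (s : Finset ι) (a b : ι → ℂ) (M : ι → ℝ)
    (hM : ∀ i, 1 ≤ M i) (ha : ∀ i, ‖a i‖ ≤ M i) (hb : ∀ i, ‖b i‖ ≤ M i) :
    ‖∏ i ∈ s, a i - ∏ i ∈ s, b i‖ ≤ (∏ i ∈ s, M i) * ∑ i ∈ s, ‖a i - b i‖ := by
  classical
  induction s using Finset.induction_on with
  | empty => simp
  | insert i s hi ih =>
    rw [Finset.prod_insert hi, Finset.prod_insert hi, Finset.prod_insert hi, Finset.sum_insert hi]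
    have h1 : a i * ∏ j ∈ s, a j - b i * ∏ j ∈ s, b j =
        a i * (∏ j ∈ s, a j - ∏ j ∈ s, b j) + (a i - b i) * ∏ j ∈ s, b j := by ring
    have h2 : ‖∏ j ∈ s, b j‖ ≤ ∏ j ∈ s, M j := by
      rw [norm_prod]
      exact Finset.prod_le_prod (fun _ _ => norm_nonneg _) fun j _ => hb j
    have hP : 0 ≤ ∏ j ∈ s, M j := Finset.prod_nonneg fun j _ => zero_le_one.trans (hM j)
    rw [h1]
    calc ‖a i * (∏ j ∈ s, a j - ∏ j ∈ s, b j) + (a i - b i) * ∏ j ∈ s, b j‖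
        ≤ ‖a i‖ * ‖∏ j ∈ s, a j - ∏ j ∈ s, b j‖ + ‖a i - b i‖ * ‖∏ j ∈ s, b j‖ := by
          rw [← norm_mul, ← norm_mul]
          exact norm_add_le _ _
      _ ≤ M i * ((∏ j ∈ s, M j) * ∑ j ∈ s, ‖a j - b j‖) +
          (M i * ∏ j ∈ s, M j) * ‖a i - b i‖ := by
          refine add_le_add (mul_le_mul (ha i) ih (norm_nonneg _) (zero_le_one.trans (hM i))) ?_
          rw [mul_comm]
          refine mul_le_mul_of_nonneg_right (h2.trans ?_) (norm_nonneg _)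
          exact le_mul_of_one_le_left hP (hM i)
      _ = _ := by ring

theorem abs_exp_sub_one_le_mul_exp (u : ℝ) : |Real.exp u - 1| ≤ |u| * Real.exp |u| := by
  rcases le_total 0 u with h | h
  · rw [abs_of_nonneg h, abs_of_nonneg (by linarith [Real.add_one_le_exp u])]
    have h1 := Real.add_one_le_exp (-u)
    have h2 : Real.exp (-u) * Real.exp u = 1 := by rw [← Real.exp_add]; simp
    nlinarith [Real.exp_pos u]
  · rw [abs_of_nonpos h, abs_of_nonpos (by linarith [Real.exp_le_one_iff.2 h])]
    have h1 := Real.add_one_le_exp u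
    have h2 := Real.one_le_exp (neg_nonneg.2 h)
    nlinarith

/-- McLeish's comparison of `exp (i ∑ x_j)` with the product of the factors `1 + i x_j`. -/
theorem norm_exp_sum_sub_prod_le {ι : Type*} (s : Finset ι) (x : ι → ℝ) {v K : ℝ} (hv : 0 ≤ v)
    (hvK : v ≤ K) (hx : ∀ i, |x i| ≤ 1 / 2) (hQ : ∑ i ∈ s, x i ^ 2 ≤ K) :
    ‖Complex.exp ((∑ i ∈ s, x i : ℝ) * Complex.I) -
        (Real.exp (-(v / 2)) : ℝ) * ∏ i ∈ s, (1 + x i * Complex.I)‖ ≤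
      Real.exp K * (|∑ i ∈ s, x i ^ 2 - v| + ∑ i ∈ s, 2 * |x i| ^ 3) := by
  set Q := ∑ i ∈ s, x i ^ 2 with hQdef
  set S := ∑ i ∈ s, x i with hS
  have hQ0 : 0 ≤ Q := Finset.sum_nonneg fun i _ => sq_nonneg _
  have hprod : ∏ i ∈ s, Complex.exp (x i * Complex.I + x i ^ 2 / 2) =
      Complex.exp (S * Complex.I) * (Real.exp (Q / 2) : ℝ) := by
    rw [← Complex.exp_sum, Finset.sum_add_distrib, ← Finset.sum_mul, ← Finset.sum_div,
      Complex.exp_add, hS, hQdef]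
    push_cast
    rfl
  have hM : ∏ i ∈ s, Real.exp (x i ^ 2 / 2) = Real.exp (Q / 2) := by
    rw [← Real.exp_sum, ← Finset.sum_div]
  have h1 := norm_prod_sub_prod_le_mul_sum s (fun i => 1 + x i * Complex.I)
    (fun i => Complex.exp (x i * Complex.I + x i ^ 2 / 2)) (fun i => Real.exp (x i ^ 2 / 2))
    (fun i => Real.one_le_exp (by positivity))
    (fun i => by
      have h2 : ‖(1 + x i * Complex.I : ℂ)‖ ^ 2 = 1 + x i ^ 2 := by
        rw [← Complex.normSq_eq_norm_sq]
        simp [Complex.normSq_apply, pow_two]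
      have h3 : Real.exp (x i ^ 2 / 2) ^ 2 = Real.exp (x i ^ 2) := by
        rw [← Real.exp_nat_mul]
        congr 1
        push_cast
        ring
      refine le_of_sq_le_sq ?_ (Real.exp_pos _).le
      rw [h2, h3]
      linarith [Real.add_one_le_exp (x i ^ 2)])
    (fun i => by
      rw [Complex.norm_exp]
      refine le_of_eq ?_
      congr 1
      have : (x i * Complex.I + x i ^ 2 / 2 : ℂ) = ((x i ^ 2 / 2 : ℝ) : ℂ) + x i * Complex.I := by
        push_cast; ring
      rw [this, Complex.add_re, Complex.ofReal_re, Complex.re_ofReal_mul, Complex.I_re, mul_zero,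
        add_zero])
  rw [hprod, hM] at h1
  have h2 : ∑ i ∈ s, ‖(1 + x i * Complex.I : ℂ) - Complex.exp (x i * Complex.I + x i ^ 2 / 2)‖ ≤
      ∑ i ∈ s, 2 * |x i| ^ 3 :=
    Finset.sum_le_sum fun i _ => norm_one_add_mul_I_sub_exp_le (hx i)
  -- The first term is the error of replacing the quadratic variation `Q` by `v`; the second
  -- compares the product with the exponentials.
  have h3 : Complex.exp (S * Complex.I) -
        (Real.exp (-(v / 2)) : ℝ) * ∏ i ∈ s, (1 + x i * Complex.I) =
      -(Complex.exp (S * Complex.I) * ((Real.exp ((Q - v) / 2) - 1 : ℝ) : ℂ)) -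
        (Real.exp (-(v / 2)) : ℝ) * (∏ i ∈ s, (1 + x i * Complex.I) -
          Complex.exp (S * Complex.I) * (Real.exp (Q / 2) : ℝ)) := by
    have : Real.exp ((Q - v) / 2) = Real.exp (-(v / 2)) * Real.exp (Q / 2) := by
      rw [← Real.exp_add]; congr 1; ring
    rw [this]
    push_cast
    ring
  have h4 : |Real.exp ((Q - v) / 2) - 1| ≤ Real.exp K * |Q - v| := by
    have hu : |(Q - v) / 2| = |Q - v| / 2 := by rw [abs_div, abs_two]
    have hu2 : |(Q - v) / 2| ≤ K := by
      rw [hu]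
      have : |Q - v| ≤ K := abs_sub_le_iff.2 ⟨by linarith, by linarith⟩
      linarith [abs_nonneg (Q - v)]
    refine (abs_exp_sub_one_le_mul_exp _).trans ?_
    rw [mul_comm]
    refine mul_le_mul (Real.exp_le_exp.2 hu2) ?_ (abs_nonneg _) (Real.exp_pos _).le
    rw [hu]
    linarith [abs_nonneg (Q - v)]
  have h5 : Real.exp (-(v / 2)) ≤ 1 := Real.exp_le_one_iff.2 (by linarith)
  have h6 : Real.exp (Q / 2) ≤ Real.exp K := Real.exp_le_exp.2 (by linarith)
  have h7 : 0 ≤ ∑ i ∈ s, 2 * |x i| ^ 3 := Finset.sum_nonneg fun _ _ => by positivity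
  rw [h3]
  refine (norm_sub_le _ _).trans ?_
  rw [norm_neg, norm_mul, norm_mul, Complex.norm_exp_ofReal_mul_I, one_mul, Complex.norm_real,
    Complex.norm_real, Real.norm_eq_abs, Real.norm_eq_abs, abs_of_pos (Real.exp_pos _), mul_add]
  refine add_le_add h4 ?_
  calc Real.exp (-(v / 2)) * _ ≤ 1 * (Real.exp (Q / 2) * ∑ i ∈ s, 2 * |x i| ^ 3) :=
        mul_le_mul h5 (h1.trans (mul_le_mul_of_nonneg_left h2 (Real.exp_pos _).le))
          (norm_nonneg _) zero_le_one
    _ ≤ Real.exp K * ∑ i ∈ s, 2 * |x i| ^ 3 := by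
        rw [one_mul]
        exact mul_le_mul_of_nonneg_right h6 h7

end ComplexEstimates

/-! ### Sums over arcs as martingales, and their variance. -/

section EdgeSums

theorem integral_eval_unifPi {ι : Type*} [Fintype ι] {f : ℝ → ℝ} (hf : Measurable f) (j : ι) :
    ∫ V, f (V j) ∂unifPi ι = ∫ x, f x ∂unif := by
  conv_rhs => rw [← (measurePreserving_eval_unifPi j).map_eq]
  exact (integral_map (measurable_pi_apply j).aemeasurable hf.aestronglyMeasurable).symm

theorem integral_pair_unifPi {ι : Type*} [Fintype ι] {f : ℝ × ℝ → ℝ} (hf : Measurable f) {i j : ι}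
    (hij : i ≠ j) : ∫ V, f (V i, V j) ∂unifPi ι = ∫ z, f z ∂unifSq := by
  rw [← (measurePreserving_pair hij).map_eq]
  exact (integral_map (measurePreserving_pair hij).measurable.aemeasurable
    hf.aestronglyMeasurable).symm

/-- A bounded measurable function of two variables that integrates to zero over each of them. -/
structure IsDegenerate (g : ℝ × ℝ → ℝ) (C : ℝ) : Prop where
  measurable : Measurable g
  bound : ∀ z, |g z| ≤ C
  integral_snd : ∀ x, ∫ y, g (x, y) ∂unif = 0
  integral_fst : ∀ y, ∫ x, g (x, y) ∂unif = 0

variable {n : ℕ} (σ : Equiv.Perm (Fin n)) (g : ℝ × ℝ → ℝ)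

/-- The contribution of the arc from `i` to `σ i`; loops do not contribute. -/
noncomputable def edge (i : Fin n) (U : Fin n → ℝ) : ℝ :=
  if σ i = i then 0 else g (U i, U (σ i))

/-- The contribution of the arcs between `j` and smaller vertices. -/
noncomputable def increment (j : Fin n) (U : Fin n → ℝ) : ℝ :=
  (if σ j < j then g (U j, U (σ j)) else 0) + (if σ⁻¹ j < j then g (U (σ⁻¹ j), U j) else 0)

/-- The vertices at distance at most one from `j` in the graph of `σ`. -/
def nbhd (j : Fin n) : Finset (Fin n) := {j, σ j, σ⁻¹ j}

/-- Every arc that is not a loop is charged once, to its larger endpoint. -/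
theorem sum_increment (U : Fin n → ℝ) : ∑ j, increment σ g j U = ∑ i, edge σ g i U := by
  have h : ∑ j, (if σ⁻¹ j < j then g (U (σ⁻¹ j), U j) else 0) =
      ∑ i, if i < σ i then g (U i, U (σ i)) else 0 := by
    rw [← Equiv.sum_comp σ]
    simp
  simp only [increment, Finset.sum_add_distrib]
  rw [h, ← Finset.sum_add_distrib]
  refine Finset.sum_congr rfl fun i _ => ?_
  rw [edge]
  rcases lt_trichotomy (σ i) i with h | h | h
  · simp [h, h.ne, h.not_gt]
  · simp [h]
  · simp [h, h.ne', h.not_gt]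

variable {σ g} {C : ℝ}

/-- Adaptedness: the `j`-th increment is a function of the coordinates up to `j`. -/
theorem increment_congr {j : Fin n} {U V : Fin n → ℝ} (h : ∀ i ≤ j, U i = V i) :
    increment σ g j U = increment σ g j V := by
  unfold increment
  congr 1
  · split_ifs with h1
    · rw [h j le_rfl, h _ h1.le]
    · rfl
  · split_ifs with h1
    · rw [h j le_rfl, h _ h1.le]
    · rfl

theorem increment_congr_nbhd {j : Fin n} {U V : Fin n → ℝ} (h : ∀ i ∈ nbhd σ j, U i = V i) :
    increment σ g j U = increment σ g j V := by
  unfold increment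
  rw [h j (by simp [nbhd]), h (σ j) (by simp [nbhd]), h (σ⁻¹ j) (by simp [nbhd])]

namespace IsDegenerate

variable (hg : IsDegenerate g C)
include hg

theorem bound_nonneg : 0 ≤ C := (abs_nonneg _).trans (hg.bound 0)

theorem measurable_comp_pair (i j : Fin n) : Measurable fun U : Fin n → ℝ => g (U i, U j) :=
  hg.measurable.comp (by fun_prop)

theorem measurable_edge (i : Fin n) : Measurable (edge σ g i) := by
  unfold edge
  split_ifs
  · exact measurable_const
  · exact hg.measurable_comp_pair _ _

theorem measurable_increment (j : Fin n) : Measurable (increment σ g j) := by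
  unfold increment
  refine Measurable.add ?_ ?_ <;> split_ifs
  exacts [hg.measurable_comp_pair _ _, measurable_const, hg.measurable_comp_pair _ _,
    measurable_const]

theorem abs_edge_le (i : Fin n) (U : Fin n → ℝ) : |edge σ g i U| ≤ C := by
  unfold edge
  split_ifs
  · simpa using hg.bound_nonneg
  · exact hg.bound _

theorem abs_increment_le (j : Fin n) (U : Fin n → ℝ) : |increment σ g j U| ≤ 2 * C := by
  unfold increment
  refine (abs_add_le _ _).trans ?_
  have h : ∀ (p : Prop) [Decidable p] (z : ℝ × ℝ), |if p then g z else 0| ≤ C := fun p _ z => by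
    split_ifs
    · exact hg.bound z
    · simpa using hg.bound_nonneg
  have := h (σ j < j) (U j, U (σ j))
  have := h (σ⁻¹ j < j) (U (σ⁻¹ j), U j)
  linarith

theorem integral_snd_unifPi (x : ℝ) (j : Fin n) : ∫ V, g (x, V j) ∂unifPi (Fin n) = 0 := by
  rw [← hg.integral_snd x]
  exact integral_eval_unifPi (f := fun y => g (x, y)) (hg.measurable.comp (by fun_prop)) j

theorem integral_fst_unifPi (y : ℝ) (j : Fin n) : ∫ V, g (V j, y) ∂unifPi (Fin n) = 0 := by
  rw [← hg.integral_fst y]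
  exact integral_eval_unifPi (f := fun x => g (x, y)) (hg.measurable.comp (by fun_prop)) j

theorem integrable_snd_unifPi (x : ℝ) (j : Fin n) :
    Integrable (fun V : Fin n → ℝ => g (x, V j)) (unifPi (Fin n)) :=
  Integrable.of_bound (hg.measurable.comp (by fun_prop)).aestronglyMeasurable C
    (ae_of_all _ fun _ => hg.bound _)

theorem integrable_fst_unifPi (y : ℝ) (j : Fin n) :
    Integrable (fun V : Fin n → ℝ => g (V j, y)) (unifPi (Fin n)) :=
  Integrable.of_bound (hg.measurable.comp (by fun_prop)).aestronglyMeasurable C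
    (ae_of_all _ fun _ => hg.bound _)

/-- The martingale difference property: the new coordinate `j` is one of the two arguments of each
kernel, the other argument having a smaller index. -/
theorem integral_increment_piecewise (j : Fin n) (U : Fin n → ℝ) :
    ∫ V, increment σ g j (({j} : Finset (Fin n)).piecewise V U) ∂unifPi (Fin n) = 0 := by
  have h : ∀ V, increment σ g j (({j} : Finset (Fin n)).piecewise V U) =
      (if σ j < j then g (V j, U (σ j)) else 0) +
        (if σ⁻¹ j < j then g (U (σ⁻¹ j), V j) else 0) := fun V => by
    rw [Finset.piecewise_singleton, increment, Function.update_self]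
    congr 1
    · split_ifs with h1
      · rw [Function.update_of_ne h1.ne]
      · rfl
    · split_ifs with h1
      · rw [Function.update_of_ne h1.ne]
      · rfl
  simp only [h]
  rw [integral_add]
  · have h1 : ∫ V, (if σ j < j then g (V j, U (σ j)) else 0) ∂unifPi (Fin n) = 0 := by
      split_ifs
      · exact hg.integral_fst_unifPi _ _
      · simp
    have h2 : ∫ V, (if σ⁻¹ j < j then g (U (σ⁻¹ j), V j) else 0) ∂unifPi (Fin n) = 0 := by
      split_ifs
      · exact hg.integral_snd_unifPi _ _
      · simp
    rw [h1, h2, add_zero]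
  · split_ifs
    · exact hg.integrable_fst_unifPi _ _
    · exact integrable_zero _ _ _
  · split_ifs
    · exact hg.integrable_snd_unifPi _ _
    · exact integrable_zero _ _ _

/-- McLeish's identity. Remove the factors from the last one down: the earlier ones do not involve
the newest coordinate, over which the increment averages to zero. -/
theorem integral_prod_one_add (θ : ℝ) :
    ∫ U, ∏ j, (1 + (θ * increment σ g j U : ℝ) * Complex.I) ∂unifPi (Fin n) = 1 := by
  have hmeas : ∀ s : Finset (Fin n), Measurable fun U : Fin n → ℝ =>
      ∏ j ∈ s, (1 + (θ * increment σ g j U : ℝ) * Complex.I) := fun s =>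
    Finset.measurable_prod _ fun j _ => measurable_const.add
      ((Complex.measurable_ofReal.comp ((hg.measurable_increment j).const_mul θ)).mul_const _)
  have hbound : ∀ (j : Fin n) U, ‖(1 + (θ * increment σ g j U : ℝ) * Complex.I : ℂ)‖ ≤
      1 + |θ| * (2 * C) := fun j U => by
    refine (norm_add_le _ _).trans ?_
    rw [norm_one, norm_mul, Complex.norm_I, mul_one, Complex.norm_real, Real.norm_eq_abs, abs_mul]
    gcongr
    exact hg.abs_increment_le j U
  have hint : ∀ s : Finset (Fin n), Integrable (fun U : Fin n → ℝ =>
      ∏ j ∈ s, (1 + (θ * increment σ g j U : ℝ) * Complex.I)) (unifPi (Fin n)) := fun s =>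
    Integrable.of_bound (hmeas s).aestronglyMeasurable (∏ j ∈ s, (1 + |θ| * (2 * C)))
      (ae_of_all _ fun U => by
        rw [norm_prod]
        exact Finset.prod_le_prod (fun _ _ => norm_nonneg _) fun j _ => hbound j U)
  have key : ∀ k : ℕ, ∫ U, ∏ j : Fin n with j.val < k,
      (1 + (θ * increment σ g j U : ℝ) * Complex.I) ∂unifPi (Fin n) = 1 := by
    intro k
    induction k with
    | zero => simp
    | succ k ih =>
      by_cases hk : k < n
      · have hins : (Finset.univ.filter fun j : Fin n => j.val < k + 1) =
            insert ⟨k, hk⟩ (Finset.univ.filter fun j : Fin n => j.val < k) := by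
          ext j
          simp only [Finset.mem_filter, Finset.mem_univ, true_and, Finset.mem_insert, Fin.ext_iff]
          omega
        have hnot : (⟨k, hk⟩ : Fin n) ∉ Finset.univ.filter fun j : Fin n => j.val < k := by simp
        have hmul : ∀ U : Fin n → ℝ, ∏ j : Fin n with j.val < k + 1,
            (1 + (θ * increment σ g j U : ℝ) * Complex.I) =
            ∏ j : Fin n with j.val < k, (1 + (θ * increment σ g j U : ℝ) * Complex.I) +
            (∏ j : Fin n with j.val < k, (1 + (θ * increment σ g j U : ℝ) * Complex.I)) *
              ((θ * increment σ g ⟨k, hk⟩ U : ℝ) * Complex.I) := fun U => by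
          rw [hins, Finset.prod_insert hnot]
          ring
        have hzint : Integrable (fun U : Fin n → ℝ =>
            (∏ j : Fin n with j.val < k, (1 + (θ * increment σ g j U : ℝ) * Complex.I)) *
              ((θ * increment σ g ⟨k, hk⟩ U : ℝ) * Complex.I)) (unifPi (Fin n)) := by
          have := (hint (Finset.univ.filter fun j : Fin n => j.val < k + 1)).sub
            (hint (Finset.univ.filter fun j : Fin n => j.val < k))
          refine this.congr (ae_of_all _ fun U => ?_)
          simp only [Pi.sub_apply, hmul]
          ring
        simp only [hmul]
        rw [integral_add (hint _) hzint, ih]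
        have hz := integral_mul_eq_zero_of_piecewise (𝕜 := ℂ) {(⟨k, hk⟩ : Fin n)}
          (φ := fun U : Fin n → ℝ =>
            ∏ j : Fin n with j.val < k, (1 + (θ * increment σ g j U : ℝ) * Complex.I))
          (R := fun U => (θ * increment σ g ⟨k, hk⟩ U : ℝ) * Complex.I) (fun U V => by
            refine Finset.prod_congr rfl fun j hj => ?_
            rw [increment_congr (V := U)]
            intro i hi
            rw [Finset.piecewise_eq_of_notMem]
            simp only [Finset.mem_filter, Finset.mem_univ, true_and] at hj
            simp only [Finset.mem_singleton, Fin.ext_iff]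
            have : i.val ≤ j.val := hi
            omega) hzint (ae_of_all _ fun U => by
            rw [integral_mul_const, integral_complex_ofReal, integral_const_mul,
              hg.integral_increment_piecewise]
            simp)
        rw [hz, add_zero]
      · refine Eq.trans ?_ ih
        congr 1
        ext U
        refine Finset.prod_congr (Finset.filter_congr fun j _ => ?_) fun _ _ => rfl
        have := j.2
        constructor <;> intro <;> omega
  have := key n
  rwa [Finset.filter_true_of_mem fun j _ => j.2] at this

theorem integrable_increment_mul (j k : Fin n) :
    Integrable (fun U => increment σ g j U * increment σ g k U) (unifPi (Fin n)) :=
  Integrable.of_bound ((hg.measurable_increment j).mul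
    (hg.measurable_increment k)).aestronglyMeasurable ((2 * C) * (2 * C)) (ae_of_all _ fun U => by
      rw [norm_mul]
      exact mul_le_mul (hg.abs_increment_le j U) (hg.abs_increment_le k U) (norm_nonneg _)
        (by linarith [hg.bound_nonneg]))

theorem integral_increment_mul_increment {j k : Fin n} (hjk : j ≠ k) :
    ∫ U, increment σ g j U * increment σ g k U ∂unifPi (Fin n) = 0 := by
  wlog h : j < k generalizing j k
  · simp only [mul_comm (increment σ g j _)]
    exact this hjk.symm (lt_of_le_of_ne (not_lt.1 h) hjk.symm)
  refine integral_mul_eq_zero_of_piecewise {k} (fun U V => ?_) (hg.integrable_increment_mul j k)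
    (ae_of_all _ fun U => hg.integral_increment_piecewise k U)
  refine increment_congr fun i hi => ?_
  rw [Finset.piecewise_eq_of_notMem]
  simpa using (hi.trans_lt h).ne

theorem integrable_edge_mul (i j : Fin n) :
    Integrable (fun U => edge σ g i U * edge σ g j U) (unifPi (Fin n)) :=
  Integrable.of_bound ((hg.measurable_edge i).mul
    (hg.measurable_edge j)).aestronglyMeasurable (C * C) (ae_of_all _ fun U => by
      rw [norm_mul]
      exact mul_le_mul (hg.abs_edge_le i U) (hg.abs_edge_le j U) (norm_nonneg _) hg.bound_nonneg)

/-- An endpoint of the second arc that is not on the first can be integrated out alone, which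
annihilates the second factor by degeneracy. -/
theorem integral_edge_mul_edge_of_exists {i j : Fin n}
    (h : ∃ v, (v = j ∨ v = σ j) ∧ v ≠ i ∧ v ≠ σ i) :
    ∫ U, edge σ g i U * edge σ g j U ∂unifPi (Fin n) = 0 := by
  obtain ⟨v, hv, hvi, hvi'⟩ := h
  refine integral_mul_eq_zero_of_piecewise {v} (fun U V => ?_) (hg.integrable_edge_mul i j)
    (ae_of_all _ fun U => ?_)
  · unfold edge
    rw [Finset.piecewise_eq_of_notMem _ _ _ (by simpa using hvi.symm),
      Finset.piecewise_eq_of_notMem _ _ _ (by simpa using hvi'.symm)]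
  · unfold edge
    split_ifs with hj
    · simp
    · simp only [Finset.piecewise_singleton]
      rcases hv with rfl | rfl
      · simp only [Function.update_self, Function.update_of_ne hj]
        exact hg.integral_fst_unifPi _ _
      · simp only [Function.update_self, Function.update_of_ne (Ne.symm hj)]
        exact hg.integral_snd_unifPi _ _

/-- By the previous lemma the arcs must have the same endpoints, so they coincide or form a 2-cycle.
-/
theorem integral_edge_mul_edge (i j : Fin n) :
    ∫ U, edge σ g i U * edge σ g j U ∂unifPi (Fin n) =
      (if j = i ∧ σ i ≠ i then ∫ z, g z * g z ∂unifSq else 0) +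
        (if j = σ i ∧ (σ i ≠ i ∧ σ (σ i) = i) then ∫ z, g z * g z.swap ∂unifSq else 0) := by
  by_cases hi : σ i = i
  · simp [edge, hi]
  by_cases h1 : j = i
  · subst h1
    rw [if_pos ⟨rfl, hi⟩, if_neg (fun h => hi h.1.symm), add_zero]
    simp only [edge, if_neg hi]
    exact integral_pair_unifPi (hg.measurable.mul hg.measurable) (Ne.symm hi)
  · rw [if_neg fun h => h1 h.1, zero_add]
    by_cases h2 : j = σ i ∧ (σ i ≠ i ∧ σ (σ i) = i)
    · rw [if_pos h2]
      obtain ⟨rfl, -, h3⟩ := h2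
      simp only [edge, if_neg hi, h3, if_neg (Ne.symm hi)]
      exact integral_pair_unifPi (f := fun z => g z * g z.swap)
        (hg.measurable.mul (hg.measurable.comp measurable_swap)) (Ne.symm hi)
    · rw [if_neg h2]
      by_cases hj : σ j = j
      · simp [edge, hj]
      refine hg.integral_edge_mul_edge_of_exists ?_
      by_contra hcon
      push Not at hcon
      have h3 := hcon j (Or.inl rfl)
      have h4 := hcon (σ j) (Or.inr rfl)
      have h5 := h3 h1
      subst h5
      refine h2 ⟨rfl, hi, ?_⟩
      by_contra h6
      exact hj (h4 h6)

/-- The expected quadratic variation of the edge sum. -/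
theorem sum_integral_increment_sq :
    ∑ j, ∫ U, increment σ g j U ^ 2 ∂unifPi (Fin n) =
      (n - σ.partition.parts.count 1) * (∫ z, g z * g z ∂unifSq) +
        2 * σ.partition.parts.count 2 * ∫ z, g z * g z.swap ∂unifSq := by
  have h1 : ∀ j, ∫ U, increment σ g j U ^ 2 ∂unifPi (Fin n) =
      ∑ k, ∫ U, increment σ g j U * increment σ g k U ∂unifPi (Fin n) := fun j => by
    rw [Finset.sum_eq_single j]
    · simp only [pow_two]
    · exact fun k _ hk => hg.integral_increment_mul_increment hk.symm
    · simp
  -- The increments are orthogonal, so both sides are the second moment of the same total, which is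
  -- expanded once over vertices and once over arcs.
  have h2 : ∑ j, ∫ U, increment σ g j U ^ 2 ∂unifPi (Fin n) =
      ∑ i, ∑ j, ∫ U, edge σ g i U * edge σ g j U ∂unifPi (Fin n) := by
    simp only [h1]
    have h3 : ∀ f : Fin n → (Fin n → ℝ) → ℝ,
        (∀ i j, Integrable (fun U => f i U * f j U) (unifPi (Fin n))) →
        ∑ i, ∑ j, ∫ U, f i U * f j U ∂unifPi (Fin n) =
          ∫ U, (∑ i, f i U) * (∑ i, f i U) ∂unifPi (Fin n) := fun f hf => by
      simp only [Finset.sum_mul_sum]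
      rw [integral_finsetSum _ fun i _ => integrable_finsetSum _ fun j _ => hf i j]
      exact Finset.sum_congr rfl fun i _ => (integral_finsetSum _ fun j _ => hf i j).symm
    rw [h3 _ fun i j => hg.integrable_increment_mul i j, h3 _ fun i j => hg.integrable_edge_mul i j]
    simp only [sum_increment]
  have h4 : ((Finset.univ.filter fun i => σ i ≠ i).card : ℝ) =
      n - σ.partition.parts.count 1 := by
    have := Finset.card_filter_add_card_filter_not (s := (Finset.univ : Finset (Fin n)))
      (fun i => σ i = i)
    rw [Finset.card_univ, Fintype.card_fin, ← count_one_partition] at this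
    have h6 : ((σ.partition.parts.count 1 : ℕ) : ℝ) +
        (Finset.univ.filter fun i => ¬σ i = i).card = n := by exact_mod_cast this
    linarith
  have h5 : ((Finset.univ.filter fun i => σ i ≠ i ∧ σ (σ i) = i).card : ℝ) =
      2 * σ.partition.parts.count 2 := by
    rw [← two_mul_count_two_partition]
    push_cast
    rfl
  rw [h2, ← h4, ← h5]
  simp only [hg.integral_edge_mul_edge, Finset.sum_add_distrib, ite_and, Finset.sum_ite_eq',
    Finset.mem_univ, if_true]
  simp only [← ite_and]
  rw [← Finset.sum_filter, ← Finset.sum_filter, Finset.sum_const, Finset.sum_const, nsmul_eq_mul,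
    nsmul_eq_mul]

end IsDegenerate

end EdgeSums

/-! ### A second moment bound under local dependence. -/

section SecondMoment

theorem integral_sq_sum_le {Ω ι : Type*} [MeasurableSpace Ω] {μ : Measure Ω}
    [IsProbabilityMeasure μ] (s : Finset ι) (f : ι → Ω → ℝ) {B : ℝ}
    (hf : ∀ i ∈ s, Measurable (f i)) (hB : ∀ i ∈ s, ∀ ω, |f i ω| ≤ B) (near : ι → ι → Prop)
    [DecidableRel near]
    (h0 : ∀ i ∈ s, ∀ j ∈ s, ¬ near i j → ∫ ω, f i ω * f j ω ∂μ = 0) :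
    ∫ ω, (∑ i ∈ s, f i ω) ^ 2 ∂μ ≤ B ^ 2 * ∑ i ∈ s, ((s.filter fun j => near i j).card : ℝ) := by
  have hbd : ∀ i ∈ s, ∀ j ∈ s, ∀ ω, |f i ω * f j ω| ≤ B ^ 2 := fun i hi j hj ω => by
    rw [abs_mul, pow_two]
    exact mul_le_mul (hB i hi ω) (hB j hj ω) (abs_nonneg _) ((abs_nonneg _).trans (hB i hi ω))
  have hint : ∀ i ∈ s, ∀ j ∈ s, Integrable (fun ω => f i ω * f j ω) μ := fun i hi j hj =>
    Integrable.of_bound ((hf i hi).mul (hf j hj)).aestronglyMeasurable (B ^ 2)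
      (ae_of_all _ (hbd i hi j hj))
  simp only [pow_two (∑ i ∈ s, f i _), Finset.sum_mul_sum]
  rw [integral_finsetSum _ fun i hi => integrable_finsetSum _ fun j hj => hint i hi j hj,
    Finset.mul_sum]
  refine Finset.sum_le_sum fun i hi => ?_
  rw [integral_finsetSum _ fun j hj => hint i hi j hj, mul_comm, ← nsmul_eq_mul,
    ← Finset.sum_const, Finset.sum_filter]
  refine Finset.sum_le_sum fun j hj => ?_
  split_ifs with h
  · calc ∫ ω, f i ω * f j ω ∂μ ≤ ∫ _, B ^ 2 ∂μ :=
          integral_mono (hint i hi j hj) (integrable_const _)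
            fun ω => (le_abs_self _).trans (hbd i hi j hj ω)
      _ = B ^ 2 := by simp
  · exact (h0 i hi j hj h).le

end SecondMoment

/-! ### The quantitative central limit theorem for arc sums. -/

section CentralLimit

variable {n : ℕ} {σ : Equiv.Perm (Fin n)} {g : ℝ × ℝ → ℝ} {C : ℝ}

theorem mem_nbhd_symm {i j : Fin n} (h : i ∈ nbhd σ j) : j ∈ nbhd σ i := by
  simp only [nbhd, Finset.mem_insert, Finset.mem_singleton] at h ⊢
  rcases h with rfl | rfl | rfl <;> simp

theorem card_nbhd_le (j : Fin n) : (nbhd σ j).card ≤ 3 := Finset.card_le_three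

theorem card_nbhd_inter_le (j : Fin n) :
    (Finset.univ.filter fun k => ¬Disjoint (nbhd σ j) (nbhd σ k)).card ≤ 9 := by
  have h : (Finset.univ.filter fun k => ¬Disjoint (nbhd σ j) (nbhd σ k)) ⊆
      (nbhd σ j).biUnion (nbhd σ) := fun k hk => by
    obtain ⟨a, ha, hak⟩ := Finset.not_disjoint_iff.1 (Finset.mem_filter.1 hk).2
    exact Finset.mem_biUnion.2 ⟨a, ha, mem_nbhd_symm hak⟩
  refine (Finset.card_le_card h).trans (Finset.card_biUnion_le.trans ?_)
  refine (Finset.sum_le_card_nsmul _ _ 3 fun a _ => card_nbhd_le a).trans ?_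
  have := card_nbhd_le (σ := σ) j
  simp only [smul_eq_mul]
  omega

namespace IsDegenerate

variable (hg : IsDegenerate g C)
include hg

theorem increment_sq_le (j : Fin n) (U : Fin n → ℝ) : increment σ g j U ^ 2 ≤ 4 * C ^ 2 := by
  have := sq_le_sq' (neg_le_of_abs_le (hg.abs_increment_le (σ := σ) j U))
    (le_of_abs_le (hg.abs_increment_le j U))
  linarith

theorem integrable_increment_sq (j : Fin n) :
    Integrable (fun U => increment σ g j U ^ 2) (unifPi (Fin n)) := by
  simpa only [pow_two] using hg.integrable_increment_mul (σ := σ) j j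

/-- Squared increments with disjoint neighbourhoods are uncorrelated, each neighbourhood meets at
most 9 others (itself included), and centered squares are bounded by `4 C²`; hence `144 = 16 · 9`.
-/
theorem integral_sq_sum_increment_sq_le :
    ∫ U, (∑ j, increment σ g j U ^ 2 - ∑ j, ∫ U, increment σ g j U ^ 2 ∂unifPi (Fin n)) ^ 2
      ∂unifPi (Fin n) ≤ 144 * C ^ 4 * n := by
  classical
  set Y : Fin n → (Fin n → ℝ) → ℝ := fun j U =>
    increment σ g j U ^ 2 - ∫ U, increment σ g j U ^ 2 ∂unifPi (Fin n) with hY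
  have hYm : ∀ j, Measurable (Y j) := fun j =>
    ((hg.measurable_increment j).pow_const 2).sub measurable_const
  have hYb : ∀ j U, |Y j U| ≤ 4 * C ^ 2 := fun j U => by
    have h1 := hg.increment_sq_le (σ := σ) j
    have h2 : ∫ U, increment σ g j U ^ 2 ∂unifPi (Fin n) ≤ 4 * C ^ 2 := by
      calc _ ≤ ∫ _, 4 * C ^ 2 ∂unifPi (Fin n) :=
            integral_mono (hg.integrable_increment_sq j) (integrable_const _) h1
        _ = 4 * C ^ 2 := by simp
    have h3 : 0 ≤ ∫ U, increment σ g j U ^ 2 ∂unifPi (Fin n) :=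
      integral_nonneg fun _ => sq_nonneg _
    have h4 := h1 U
    have h5 := sq_nonneg (increment σ g j U)
    exact abs_le.2 ⟨by simp only [hY]; linarith, by simp only [hY]; linarith⟩
  have hYi : ∀ j, ∫ U, Y j U ∂unifPi (Fin n) = 0 := fun j => by
    simp only [hY]
    rw [integral_sub (hg.integrable_increment_sq j) (integrable_const _)]
    simp
  have hYc : ∀ (j : Fin n) (T : Finset (Fin n)), Disjoint (nbhd σ j) T →
      ∀ U V, Y j (T.piecewise V U) = Y j U := fun j T hT U V => by
    simp only [hY]
    rw [increment_congr_nbhd (V := U)]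
    exact fun i hi => Finset.piecewise_eq_of_notMem _ _ _ (Finset.disjoint_left.1 hT hi)
  have h0 : ∀ j k, ¬¬Disjoint (nbhd σ j) (nbhd σ k) →
      ∫ U, Y j U * Y k U ∂unifPi (Fin n) = 0 := fun j k hjk => by
    refine integral_mul_eq_zero_of_piecewise (nbhd σ k) (hYc j _ (not_not.1 hjk)) ?_
      (ae_of_all _ fun U => ?_)
    · refine Integrable.of_bound ((hYm j).mul (hYm k)).aestronglyMeasurable
        ((4 * C ^ 2) * (4 * C ^ 2)) (ae_of_all _ fun U => ?_)
      rw [norm_mul]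
      exact mul_le_mul (hYb j U) (hYb k U) (norm_nonneg _) (by positivity)
    · rw [← hYi k]
      congr 1
      ext V
      simp only [hY]
      rw [increment_congr_nbhd (V := V)]
      exact fun i hi => Finset.piecewise_eq_of_mem _ _ _ hi
  have h := integral_sq_sum_le (μ := unifPi (Fin n)) Finset.univ Y (B := 4 * C ^ 2)
    (fun j _ => hYm j) (fun j _ => hYb j) (fun j k => ¬Disjoint (nbhd σ j) (nbhd σ k))
    (fun j _ k _ => h0 j k)
  simp only [hY, Finset.sum_sub_distrib] at h
  refine h.trans ?_
  have h2 : ∑ j : Fin n, ((Finset.univ.filter fun k =>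
      ¬Disjoint (nbhd σ j) (nbhd σ k)).card : ℝ) ≤ ∑ _j : Fin n, (9 : ℝ) :=
    Finset.sum_le_sum fun j _ => by exact_mod_cast card_nbhd_inter_le j
  simp only [Finset.sum_const, Finset.card_univ, Fintype.card_fin, nsmul_eq_mul] at h2
  calc _ ≤ (4 * C ^ 2) ^ 2 * (n * 9) := mul_le_mul_of_nonneg_left h2 (by positivity)
    _ = _ := by ring

/-- A quantitative central limit theorem for the edge sums of a degenerate function. -/
theorem norm_charFun_edge_sum_sub_le (hn : 0 < n) (hCn : 4 * C ≤ √n) {v K : ℝ} (hv : 0 ≤ v)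
    (hvK : v ≤ K) (hCK : 4 * C ^ 2 ≤ K) :
    ‖∫ U, Complex.exp (((1 / √n) * ∑ i, edge σ g i U : ℝ) * Complex.I) ∂unifPi (Fin n) -
        (Real.exp (-(v / 2)) : ℝ)‖ ≤
      Real.exp K * ((1 + 144 * C ^ 4 + 16 * C ^ 3) / √n +
        |(∑ j, ∫ U, increment σ g j U ^ 2 ∂unifPi (Fin n)) / n - v|) := by
  have hn' : (0 : ℝ) < n := by exact_mod_cast hn
  set s : ℝ := √n with hs
  have hs0 : 0 < s := Real.sqrt_pos.2 hn'
  have hs2 : s ^ 2 = n := Real.sq_sqrt hn'.le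
  have hC := hg.bound_nonneg
  set w : ℝ := ∑ j, ∫ U, increment σ g j U ^ 2 ∂unifPi (Fin n) with hw
  set x : Fin n → (Fin n → ℝ) → ℝ := fun j U => (1 / s) * increment σ g j U with hx
  have hxm : ∀ j, Measurable (x j) := fun j => (hg.measurable_increment j).const_mul _
  have hxb : ∀ j U, |x j U| ≤ 2 * C / s := fun j U => by
    simp only [hx]
    rw [abs_mul, abs_of_pos (by positivity), one_div, inv_mul_eq_div]
    exact div_le_div_of_nonneg_right (hg.abs_increment_le j U) hs0.le
  -- The assumption `4 C ≤ √n` serves to bring the rescaled increments into the range of the Taylor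
  -- estimate.
  have hxhalf : ∀ j U, |x j U| ≤ 1 / 2 := fun j U => (hxb j U).trans (by
    rw [div_le_div_iff₀ hs0 two_pos]; linarith)
  have hQ : ∀ U, ∑ j, x j U ^ 2 = (∑ j, increment σ g j U ^ 2) / n := fun U => by
    simp only [hx, mul_pow, ← Finset.mul_sum]
    rw [div_pow, hs2]
    ring
  have hQK : ∀ U, ∑ j, x j U ^ 2 ≤ K := fun U => by
    rw [hQ, div_le_iff₀ hn']
    calc ∑ j, increment σ g j U ^ 2 ≤ ∑ _j : Fin n, 4 * C ^ 2 :=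
          Finset.sum_le_sum fun j _ => hg.increment_sq_le j U
      _ = 4 * C ^ 2 * n := by simp; ring
      _ ≤ K * n := mul_le_mul_of_nonneg_right hCK hn'.le
  have hcube : ∀ U, ∑ j, 2 * |x j U| ^ 3 ≤ 16 * C ^ 3 / s := fun U => by
    calc ∑ j, 2 * |x j U| ^ 3 ≤ ∑ _j : Fin n, 2 * (2 * C / s) ^ 3 :=
          Finset.sum_le_sum fun j _ => mul_le_mul_of_nonneg_left
            (pow_le_pow_left₀ (abs_nonneg _) (hxb j U) 3) zero_le_two
      _ = n * (2 * (2 * C / s) ^ 3) := by simp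
      _ = 16 * C ^ 3 / s := by rw [← hs2]; field_simp; ring
  have hS : ∀ U, (1 / s) * ∑ i, edge σ g i U = ∑ j, x j U := fun U => by
    simp only [hx, ← Finset.mul_sum, sum_increment]
  set T : (Fin n → ℝ) → ℂ := fun U => ∏ j, (1 + (x j U : ℝ) * Complex.I) with hT
  have hTint : ∫ U, T U ∂unifPi (Fin n) = 1 := hg.integral_prod_one_add (1 / s)
  have hTI : Integrable T (unifPi (Fin n)) := by
    by_contra h
    rw [integral_undef h] at hTint
    exact zero_ne_one hTint
  have hSm : Measurable fun U => ∑ j, x j U := Finset.measurable_fun_sum _ fun j _ => hxm j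
  have hEI : Integrable (fun U => Complex.exp ((∑ j, x j U : ℝ) * Complex.I)) (unifPi (Fin n)) :=
    Integrable.of_bound ((Complex.measurable_ofReal.comp hSm).mul_const _).cexp.aestronglyMeasurable
      1 (ae_of_all _ fun U => by rw [Complex.norm_exp_ofReal_mul_I])
  have hvar : Integrable (fun U => (∑ j, increment σ g j U ^ 2 - w) ^ 2) (unifPi (Fin n)) := by
    refine Integrable.of_bound (Measurable.aestronglyMeasurable ?_) ((n * (4 * C ^ 2) + |w|) ^ 2)
      (ae_of_all _ fun U => ?_)
    · exact ((Finset.measurable_fun_sum _ fun j _ =>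
        (hg.measurable_increment j).pow_const 2).sub measurable_const).pow_const 2
    · rw [norm_pow]
      refine pow_le_pow_left₀ (norm_nonneg _) ((norm_sub_le _ _).trans ?_) 2
      refine add_le_add ?_ le_rfl
      rw [Real.norm_eq_abs, abs_of_nonneg (Finset.sum_nonneg fun _ _ => sq_nonneg _)]
      calc ∑ j, increment σ g j U ^ 2 ≤ ∑ _j : Fin n, 4 * C ^ 2 :=
            Finset.sum_le_sum fun j _ => hg.increment_sq_le j U
        _ = n * (4 * C ^ 2) := by simp
  have hpt : ∀ U, ‖Complex.exp ((∑ j, x j U : ℝ) * Complex.I) -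
      (Real.exp (-(v / 2)) : ℝ) * T U‖ ≤ Real.exp K * ((1 + 16 * C ^ 3) / s + |w / n - v| +
        s / n ^ 2 * (∑ j, increment σ g j U ^ 2 - w) ^ 2) := fun U => by
    refine (norm_exp_sum_sub_prod_le Finset.univ (fun j => x j U) hv hvK (fun j => hxhalf j U)
      (hQK U)).trans (mul_le_mul_of_nonneg_left ?_ (Real.exp_pos _).le)
    have h1 := hcube U
    have h2 : |∑ j, x j U ^ 2 - v| ≤ |∑ j, x j U ^ 2 - w / n| + |w / n - v| := abs_sub_le _ _ _
    -- A weighted arithmetic-geometric inequality; it lets the variance bound control the absolute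
    -- deviation pointwise.
    have h3 : |∑ j, x j U ^ 2 - w / n| ≤ 1 / s + s * (∑ j, x j U ^ 2 - w / n) ^ 2 := by
      set a := ∑ j, x j U ^ 2 - w / n
      have h4 : 0 ≤ (1 / s + s * a ^ 2) - |a| := by
        have : (1 / s + s * a ^ 2) - |a| = s * ((|a| - 1 / (2 * s)) ^ 2) + 3 / (4 * s) := by
          rw [← sq_abs a]
          field_simp
          ring
        rw [this]
        positivity
      linarith
    have h5 : s * (∑ j, x j U ^ 2 - w / n) ^ 2 =
        s / n ^ 2 * (∑ j, increment σ g j U ^ 2 - w) ^ 2 := by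
      rw [hQ]
      field_simp
    rw [h5] at h3
    have h6 : (1 + 16 * C ^ 3) / s = 1 / s + 16 * C ^ 3 / s := by ring
    rw [h6]
    linarith
  simp only [hS]
  have heq : ∫ U, Complex.exp ((∑ j, x j U : ℝ) * Complex.I) ∂unifPi (Fin n) -
      (Real.exp (-(v / 2)) : ℝ) = ∫ U, (Complex.exp ((∑ j, x j U : ℝ) * Complex.I) -
      (Real.exp (-(v / 2)) : ℝ) * T U) ∂unifPi (Fin n) := by
    rw [integral_sub hEI (hTI.const_mul _), integral_const_mul, hTint, mul_one]
  rw [heq]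
  refine (norm_integral_le_of_norm_le ((((integrable_const _).add
    (hvar.const_mul _))).const_mul _) (ae_of_all _ hpt)).trans ?_
  rw [integral_const_mul]
  refine mul_le_mul_of_nonneg_left ?_ (Real.exp_pos _).le
  rw [integral_add' (integrable_const _) (hvar.const_mul _), integral_const_mul]
  have h1 := hg.integral_sq_sum_increment_sq_le (σ := σ)
  have h2 : s / n ^ 2 * ∫ U, (∑ j, increment σ g j U ^ 2 - w) ^ 2 ∂unifPi (Fin n) ≤
      144 * C ^ 4 / s := by
    calc _ ≤ s / n ^ 2 * (144 * C ^ 4 * n) := mul_le_mul_of_nonneg_left h1 (by positivity)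
      _ = 144 * C ^ 4 / s := by rw [← hs2]; field_simp
  have h3 : (1 + 144 * C ^ 4 + 16 * C ^ 3) / s = (1 + 16 * C ^ 3) / s + 144 * C ^ 4 / s := by ring
  rw [h3]
  simp only [integral_const, probReal_univ, one_smul]
  linarith

end IsDegenerate

end CentralLimit

/-! ### Counting tuples under constraints. -/

section Counting

variable {n r : ℕ}

/-- Cross-multiplied so that no power `n^(r - |s|)` with truncated subtraction appears. -/
theorem card_forall_mem_mul_pow (s : Finset (Fin r)) (N : Finset (Fin n)) :
    (Finset.univ.filter fun f : Fin r → Fin n => ∀ c ∈ s, f c ∈ N).card * n ^ s.card =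
      N.card ^ s.card * n ^ r := by
  classical
  have h : (Finset.univ.filter fun f : Fin r → Fin n => ∀ c ∈ s, f c ∈ N) =
      Fintype.piFinset fun c => if c ∈ s then N else Finset.univ := by
    ext f
    simp only [Finset.mem_filter, Finset.mem_univ, true_and, Fintype.mem_piFinset]
    refine forall_congr' fun c => ?_
    by_cases hc : c ∈ s <;> simp [hc]
  rw [h, Fintype.card_piFinset]
  simp only [apply_ite Finset.card, Finset.card_univ, Fintype.card_fin]
  rw [Finset.prod_ite, Finset.prod_const, Finset.prod_const, mul_assoc, ← pow_add,
    Finset.filter_mem_eq_inter, Finset.univ_inter, Finset.filter_notMem_eq_sdiff,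
    ← Finset.compl_eq_univ_sdiff, add_comm, Finset.card_add_card_compl, Fintype.card_fin]

/-- The entry at `b` is determined by the one at `a`; overwriting it by any of `n` values is
injective. -/
theorem card_apply_eq_mul_le {a b : Fin r} (hab : a ≠ b) (φ : Fin n → Fin n) :
    (Finset.univ.filter fun f : Fin r → Fin n => f b = φ (f a)).card * n ≤ n ^ r := by
  classical
  have h : ((Finset.univ.filter fun f : Fin r → Fin n => f b = φ (f a)) ×ˢ
      (Finset.univ : Finset (Fin n))).card ≤ (Finset.univ : Finset (Fin r → Fin n)).card := by
    refine Finset.card_le_card_of_injOn (fun q => Function.update q.1 b q.2)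
      (fun _ _ => Finset.mem_coe.2 (Finset.mem_univ _)) ?_
    rintro ⟨f, v⟩ hf ⟨f', v'⟩ hf' h
    simp only [Finset.coe_product, Set.mem_prod, Finset.mem_coe, Finset.mem_filter,
      Finset.mem_univ, true_and, and_true] at hf hf'
    have h1 : ∀ c, c ≠ b → f c = f' c := fun c hc => by
      have := congrFun h c
      simpa [hc] using this
    have h2 : v = v' := by simpa using congrFun h b
    have h3 : f = f' := by
      ext c
      by_cases hc : c = b
      · rw [hc, hf, hf', h1 a hab]
      · rw [h1 c hc]
    rw [h2, h3]
  simpa using h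

theorem sum_apply_mul (G : Fin n → ℝ) (a : Fin r) :
    (∑ f : Fin r → Fin n, G (f a)) * n = (n : ℝ) ^ r * ∑ i, G i := by
  classical
  rw [← Finset.sum_fiberwise (s := Finset.univ) (g := fun f : Fin r → Fin n => f a),
    Finset.sum_mul, Finset.mul_sum]
  refine Finset.sum_congr rfl fun i _ => ?_
  rw [Finset.sum_congr rfl (g := fun _ => G i) fun f hf => by rw [(Finset.mem_filter.1 hf).2],
    Finset.sum_const, nsmul_eq_mul, mul_right_comm]
  congr 1
  have := card_forall_mem_mul_pow (n := n) {a} {i}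
  simp only [Finset.mem_singleton, forall_eq, Finset.card_singleton, pow_one,
    one_mul] at this
  exact_mod_cast this

end Counting

/-! ### Tuples of disjoint arcs, and pairs of tuples that are close. -/

section Spread

variable {n r : ℕ} (σ : Equiv.Perm (Fin n))

/-- The arcs starting from the entries of `f` are pairwise disjoint and none of them is a loop. -/
def IsSpread (f : Fin r → Fin n) : Prop := Function.Injective (Sum.elim f (σ ∘ f))

instance : DecidablePred (IsSpread (r := r) σ) := fun f => by
  unfold IsSpread
  infer_instance

/-- The vertices at distance at most one from an entry of `f`. -/
def tupleNbhd (f : Fin r → Fin n) : Finset (Fin n) := Finset.univ.biUnion fun a => nbhd σ (f a)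

variable {σ}

theorem IsSpread.injective {f : Fin r → Fin n} (hf : IsSpread σ f) : Function.Injective f :=
  fun a b h => Sum.inl_injective (hf (by simpa using h))

theorem IsSpread.apply_ne {f : Fin r → Fin n} (hf : IsSpread σ f) (a b : Fin r) :
    f a ≠ σ (f b) := fun h => by
  have : (Sum.inl a : Fin r ⊕ Fin r) = Sum.inr b := hf (by simpa using h)
  exact absurd this (by simp)

theorem card_tupleNbhd_le (f : Fin r → Fin n) : (tupleNbhd σ f).card ≤ 3 * r := by
  refine Finset.card_biUnion_le.trans ?_
  refine (Finset.sum_le_card_nsmul _ _ 3 fun a _ => card_nbhd_le _).trans ?_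
  simp [mul_comm]

/-- Two entries coincide (`A`), an entry is the image of another one (`B`), or an entry is a fixed
point (`D`). The first two cases lose a factor `n` for each of at most `r²` pairs; the third yields
the term in the number of fixed points. -/
theorem card_not_isSpread_mul_le :
    (Finset.univ.filter fun f : Fin r → Fin n => ¬IsSpread σ f).card * n ≤
      (2 * r ^ 2 + r * σ.partition.parts.count 1) * n ^ r := by
  classical
  set A : Fin r × Fin r → Finset (Fin r → Fin n) := fun q =>
    if q.1 = q.2 then ∅ else Finset.univ.filter fun f => f q.2 = f q.1 with hA
  set B : Fin r × Fin r → Finset (Fin r → Fin n) := fun q =>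
    if q.1 = q.2 then ∅ else Finset.univ.filter fun f => f q.2 = σ (f q.1) with hB
  set D : Fin r → Finset (Fin r → Fin n) := fun a =>
    Finset.univ.filter fun f => ∀ c ∈ ({a} : Finset (Fin r)),
      f c ∈ Finset.univ.filter fun i => σ i = i with hD
  have hsub : (Finset.univ.filter fun f : Fin r → Fin n => ¬IsSpread σ f) ⊆
      (Finset.univ.biUnion A ∪ Finset.univ.biUnion B) ∪ Finset.univ.biUnion D := by
    intro f hf
    by_contra hcon
    simp only [Finset.mem_union, Finset.mem_biUnion, Finset.mem_univ, true_and, not_or,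
      not_exists] at hcon
    obtain ⟨⟨h1, h2⟩, h3⟩ := hcon
    have h1' : ∀ a b, a ≠ b → f b ≠ f a := fun a b hab h => h1 (a, b) (by simp [hA, hab, h])
    have h2' : ∀ a b, f b ≠ σ (f a) := fun a b h => by
      by_cases hab : a = b
      · subst hab
        exact h3 a (by simp [hD, h.symm])
      · exact h2 (a, b) (by simp [hB, hab, h])
    refine (Finset.mem_filter.1 hf).2 ?_
    rintro (a | a) (b | b) h
    · by_contra hab
      exact h1' b a (fun h' => hab (by rw [h'])) h
    · exact absurd h (h2' b a)
    · exact absurd h.symm (h2' a b)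
    · by_contra hab
      exact h1' b a (fun h' => hab (by rw [h'])) (σ.injective h)
  have hAc : ∀ q, (A q).card * n ≤ n ^ r := fun q => by
    simp only [hA]
    split_ifs with h
    · simp
    · exact card_apply_eq_mul_le h id
  have hBc : ∀ q, (B q).card * n ≤ n ^ r := fun q => by
    simp only [hB]
    split_ifs with h
    · simp
    · exact card_apply_eq_mul_le h σ
  have hDc : ∀ a, (D a).card * n = σ.partition.parts.count 1 * n ^ r := fun a => by
    have := card_forall_mem_mul_pow (n := n) {a} (Finset.univ.filter fun i => σ i = i)
    rwa [Finset.card_singleton, pow_one, pow_one, ← count_one_partition] at this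
  have h1 := Finset.card_le_card hsub
  have h2 := Finset.card_union_le (Finset.univ.biUnion A ∪ Finset.univ.biUnion B)
    (Finset.univ.biUnion D)
  have h3 := Finset.card_union_le (Finset.univ.biUnion A) (Finset.univ.biUnion B)
  have h4 := Finset.card_biUnion_le (s := Finset.univ) (t := A)
  have h5 := Finset.card_biUnion_le (s := Finset.univ) (t := B)
  have h6 := Finset.card_biUnion_le (s := Finset.univ) (t := D)
  have h7 : (∑ q, (A q).card) * n ≤ r ^ 2 * n ^ r := by
    rw [Finset.sum_mul]
    refine (Finset.sum_le_card_nsmul _ _ _ fun q _ => hAc q).trans (le_of_eq ?_)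
    simp [pow_two]
  have h8 : (∑ q, (B q).card) * n ≤ r ^ 2 * n ^ r := by
    rw [Finset.sum_mul]
    refine (Finset.sum_le_card_nsmul _ _ _ fun q _ => hBc q).trans (le_of_eq ?_)
    simp [pow_two]
  have h9 : (∑ a, (D a).card) * n = r * (σ.partition.parts.count 1 * n ^ r) := by
    rw [Finset.sum_mul]
    simp [hDc]
  calc _ ≤ (∑ q, (A q).card + ∑ q, (B q).card + ∑ a, (D a).card) * n :=
        Nat.mul_le_mul_right n (by omega)
    _ = (∑ q, (A q).card) * n + (∑ q, (B q).card) * n + (∑ a, (D a).card) * n := by ring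
    _ ≤ r ^ 2 * n ^ r + r ^ 2 * n ^ r + r * (σ.partition.parts.count 1 * n ^ r) := by omega
    _ = _ := by ring

/-- At least two entries of `f'` are close to `f`. -/
def TwiceNear (σ : Equiv.Perm (Fin n)) (f f' : Fin r → Fin n) : Prop :=
  ∀ b, ∃ b', b' ≠ b ∧ f' b' ∈ tupleNbhd σ f

instance : DecidableRel (TwiceNear (r := r) σ) := fun f f' => by
  unfold TwiceNear
  infer_instance

/-- There are at most `r²` pairs of close entries, and `(3r)²` positions for such a pair. -/
theorem card_twiceNear_mul_le [NeZero r] (f : Fin r → Fin n) :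
    (Finset.univ.filter fun f' : Fin r → Fin n => TwiceNear σ f f').card * n ^ 2 ≤
      9 * r ^ 4 * n ^ r := by
  classical
  set A : Fin r × Fin r → Finset (Fin r → Fin n) := fun q =>
    if q.1 = q.2 then ∅ else Finset.univ.filter fun f' => ∀ c ∈ ({q.1, q.2} : Finset (Fin r)),
      f' c ∈ tupleNbhd σ f with hA
  have hsub : (Finset.univ.filter fun f' : Fin r → Fin n => TwiceNear σ f f') ⊆
      Finset.univ.biUnion A := by
    intro f' hf'
    have h := (Finset.mem_filter.1 hf').2
    -- Two applications produce distinct close entries: some `b`, and then some `c` different from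
    -- `b`.
    obtain ⟨b, -, hb⟩ := h 0
    obtain ⟨c, hcb, hc⟩ := h b
    refine Finset.mem_biUnion.2 ⟨(c, b), Finset.mem_univ _, ?_⟩
    simp [hA, hcb, hb, hc]
  have hAc : ∀ q, (A q).card * n ^ 2 ≤ 9 * r ^ 2 * n ^ r := fun q => by
    simp only [hA]
    split_ifs with h
    · simp
    · have h1 := card_forall_mem_mul_pow (n := n) {q.1, q.2} (tupleNbhd σ f)
      rw [Finset.card_pair h] at h1
      rw [h1]
      refine Nat.mul_le_mul_right _ ((Nat.pow_le_pow_left (card_tupleNbhd_le f) 2).trans ?_)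
      exact le_of_eq (by ring)
  calc _ ≤ (∑ q, (A q).card) * n ^ 2 :=
        Nat.mul_le_mul_right _ ((Finset.card_le_card hsub).trans Finset.card_biUnion_le)
    _ = ∑ q, (A q).card * n ^ 2 := Finset.sum_mul _ _ _
    _ ≤ (Finset.univ : Finset (Fin r × Fin r)).card • (9 * r ^ 2 * n ^ r) :=
        Finset.sum_le_card_nsmul _ _ _ fun q _ => hAc q
    _ = _ := by
        simp
        ring

end Spread

/-! ### The Hoeffding decomposition over tuples of arcs. -/

section Projection

variable {n r : ℕ}

/-- The centered conditional expectation of `H` (the pattern) given one of the points. -/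
noncomputable def proj (H : Equiv.Perm (Fin r) → ℝ) (z : ℝ × ℝ) : ℝ :=
  bernForm (centeredComb r H) z / (r - 1).factorial

/-- The mean of `H` under the uniform distribution. -/
noncomputable def patMean (H : Equiv.Perm (Fin r) → ℝ) : ℝ := (∑ π, H π) / r.factorial

theorem exists_isDegenerate_proj (H : Equiv.Perm (Fin r) → ℝ) : ∃ C, IsDegenerate (proj H) C := by
  refine ⟨(∑ i, ∑ j, |centeredComb r H i j|) / (r - 1).factorial,
    ((continuous_bernForm _).div_const _).measurable, fun z => ?_, fun x => ?_, fun y => ?_⟩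
  · rw [proj, abs_div, Nat.abs_cast]
    exact div_le_div_of_nonneg_right (abs_bernForm_le _ z) (by positivity)
  · simp only [proj]
    rw [integral_div, integral_bernForm_snd (centeredComb_row_sum H), zero_div]
  · simp only [proj]
    rw [integral_div, integral_bernForm_fst (centeredComb_col_sum H), zero_div]

theorem integral_proj (H : Equiv.Perm (Fin r) → ℝ) : ∫ z, proj H z ∂unifSq = 0 := by
  simp only [proj]
  rw [integral_div, integral_bernForm (centeredComb_row_sum H), zero_div]

theorem bernForm_centeredComb (H : Equiv.Perm (Fin r) → ℝ) (z : ℝ × ℝ) :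
    bernForm (centeredComb r H) z = ∑ π, H π * bernForm (centeredPerm π) z := by
  simp only [bernForm, centeredComb_apply, Matrix.sum_apply, Matrix.smul_apply, smul_eq_mul,
    Finset.sum_mul, Finset.mul_sum]
  rw [Finset.sum_comm' (t' := Finset.univ) (s' := fun _ => Finset.univ) (by simp)]
  conv_lhs => enter [2, x]; rw [Finset.sum_comm]
  rw [Finset.sum_comm]
  refine Finset.sum_congr rfl fun π _ => ?_
  rw [Finset.sum_comm]
  refine Finset.sum_congr rfl fun i _ => Finset.sum_congr rfl fun j _ => ?_
  ring

/-- The left side is the conditional expectation of `H` (the pattern) given that one of the points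
is `(x, y)`; see `integral_pattern_update`. -/
theorem sum_mul_bern_eq [NeZero r] (H : Equiv.Perm (Fin r) → ℝ) (x y : ℝ) :
    ∑ π, H π * ((∑ i, bern r i x * bern r (π i) y) / (r - 1).factorial) =
      patMean H + proj H (x, y) := by
  have h : ∀ π : Equiv.Perm (Fin r), (∑ i, bern r i x * bern r (π i) y) / (r - 1).factorial =
      1 / r.factorial + bernForm (centeredPerm π) (x, y) / (r - 1).factorial := fun π => by
    rw [← psi_sub_eq, psi_eq]
    ring
  simp only [h, mul_add, Finset.sum_add_distrib, patMean, proj, bernForm_centeredComb,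
    Finset.sum_div, mul_one_div, mul_div_assoc]

theorem measurable_geomPat (σ : Equiv.Perm (Fin n)) (f : Fin r → Fin n) :
    Measurable (geomPat σ f) := by
  have h1 : Measurable fun q : Equiv.Perm (Fin r) × Equiv.Perm (Fin r) => q.1 * q.2⁻¹ :=
    measurable_of_countable _
  exact h1.comp ((measurable_st.comp
    (by fun_prop : Measurable fun (U : Fin n → ℝ) a => U (σ (f a)))).prodMk
    (measurable_st.comp (by fun_prop : Measurable fun (U : Fin n → ℝ) a => U (f a))))

/-- The remainder of `H` (the pattern at `f`) after subtraction of its projection. -/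
noncomputable def remainder (σ : Equiv.Perm (Fin n)) (H : Equiv.Perm (Fin r) → ℝ)
    (f : Fin r → Fin n) (U : Fin n → ℝ) : ℝ :=
  H (geomPat σ f U) - patMean H - ∑ a, proj H (U (f a), U (σ (f a)))

/-- The `2r` vertices are distinct, so abscissas and ordinates are all independent, as in the
definition of `ψ`. -/
theorem measurePreserving_comp_spread {σ : Equiv.Perm (Fin n)} {f : Fin r → Fin n}
    (hf : IsSpread σ f) : MeasurePreserving
      (fun V : Fin n → ℝ => ((fun a => V (f a), fun a => V (σ (f a))) : (Fin r → ℝ) × (Fin r → ℝ)))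
      (unifPi (Fin n)) ((unifPi (Fin r)).prod (unifPi (Fin r))) :=
  (measurePreserving_sumPiEquivProdPi (fun _ : Fin r ⊕ Fin r => unif)).comp
    (measurePreserving_comp_injective hf)

variable {σ : Equiv.Perm (Fin n)} {H : Equiv.Perm (Fin r) → ℝ}

theorem measurable_remainder (f : Fin r → Fin n) : Measurable (remainder σ H f) := by
  obtain ⟨C, hC⟩ := exists_isDegenerate_proj H
  exact (((measurable_of_countable H).comp (measurable_geomPat σ f)).sub measurable_const).sub
    (Finset.measurable_fun_sum _ fun a _ => hC.measurable_comp_pair _ _)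

theorem abs_patMean_le {B : ℝ} (hB : ∀ π, |H π| ≤ B) : |patMean H| ≤ B := by
  rw [patMean, abs_div, Nat.abs_cast, div_le_iff₀ (by positivity)]
  refine (Finset.abs_sum_le_sum_abs _ _).trans ((Finset.sum_le_sum fun π _ => hB π).trans ?_)
  simp [Fintype.card_perm, mul_comm]

theorem abs_remainder_le {B C : ℝ} (hB : ∀ π, |H π| ≤ B) (hC : IsDegenerate (proj H) C)
    (f : Fin r → Fin n) (U : Fin n → ℝ) : |remainder σ H f U| ≤ 2 * B + r * C := by
  have h1 := hB (geomPat σ f U)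
  have h2 := abs_patMean_le hB
  have h3 : |∑ a, proj H (U (f a), U (σ (f a)))| ≤ r * C := by
    refine (Finset.abs_sum_le_sum_abs _ _).trans
      ((Finset.sum_le_sum fun a _ => hC.bound _).trans ?_)
    simp
  rw [remainder]
  refine (abs_sub _ _).trans ?_
  have := abs_sub (H (geomPat σ f U)) (patMean H)
  linarith

/-- The vertices of all arcs of `f` but the one at `b`. -/
def otherVertices (σ : Equiv.Perm (Fin n)) (f : Fin r → Fin n) (b : Fin r) : Finset (Fin n) :=
  (Finset.univ.erase b).image f ∪ (Finset.univ.erase b).image (σ ∘ f)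

/-- Given only the arc at `b`, the pattern term averages to the mean plus the projection at `b`,
both of which are subtracted, and the other projections average to zero. -/
theorem integral_remainder_piecewise {f : Fin r → Fin n} (hf : IsSpread σ f) (b : Fin r)
    (U : Fin n → ℝ) :
    ∫ V, remainder σ H f ((otherVertices σ f b).piecewise V U) ∂unifPi (Fin n) = 0 := by
  have : NeZero r := ⟨b.pos.ne'⟩
  obtain ⟨C, hC⟩ := exists_isDegenerate_proj H
  set T := otherVertices σ f b with hT
  set x := U (f b)
  set y := U (σ (f b))
  have hfb : f b ∉ T := by
    simp only [hT, otherVertices, Finset.mem_union, Finset.mem_image, Finset.mem_erase,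
      Finset.mem_univ, and_true, not_or, not_exists, not_and, Function.comp]
    exact ⟨fun a ha h => ha (hf.injective h), fun a _ h => hf.apply_ne b a h.symm⟩
  have hσb : σ (f b) ∉ T := by
    simp only [hT, otherVertices, Finset.mem_union, Finset.mem_image, Finset.mem_erase,
      Finset.mem_univ, and_true, not_or, not_exists, not_and, Function.comp]
    exact ⟨fun a _ h => hf.apply_ne a b h, fun a ha h => ha (hf.injective (σ.injective h))⟩
  have hfa : ∀ a, a ≠ b → f a ∈ T := fun a ha =>
    Finset.mem_union_left _ (Finset.mem_image_of_mem _ (by simpa using ha))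
  have hσa : ∀ a, a ≠ b → σ (f a) ∈ T := fun a ha =>
    Finset.mem_union_right _ (Finset.mem_image_of_mem (σ ∘ f) (by simpa using ha))
  have h1 : ∀ V : Fin n → ℝ, (fun a => T.piecewise V U (f a)) =
      Function.update (fun a => V (f a)) b x := fun V => by
    ext a
    by_cases ha : a = b
    · subst ha
      rw [Function.update_self, Finset.piecewise_eq_of_notMem _ _ _ hfb]
    · rw [Function.update_of_ne ha, Finset.piecewise_eq_of_mem _ _ _ (hfa a ha)]
  have h2 : ∀ V : Fin n → ℝ, (fun a => T.piecewise V U (σ (f a))) =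
      Function.update (fun a => V (σ (f a))) b y := fun V => by
    ext a
    by_cases ha : a = b
    · subst ha
      rw [Function.update_self, Finset.piecewise_eq_of_notMem _ _ _ hσb]
    · rw [Function.update_of_ne ha, Finset.piecewise_eq_of_mem _ _ _ (hσa a ha)]
  have h3 : ∀ V : Fin n → ℝ, ∑ a, proj H (T.piecewise V U (f a), T.piecewise V U (σ (f a))) =
      proj H (x, y) + ∑ a ∈ Finset.univ.erase b, proj H (V (f a), V (σ (f a))) := fun V => by
    rw [← Finset.add_sum_erase _ _ (Finset.mem_univ b),
      Finset.piecewise_eq_of_notMem _ _ _ hfb, Finset.piecewise_eq_of_notMem _ _ _ hσb]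
    congr 1
    refine Finset.sum_congr rfl fun a ha => ?_
    rw [Finset.piecewise_eq_of_mem _ _ _ (hfa a (Finset.ne_of_mem_erase ha)),
      Finset.piecewise_eq_of_mem _ _ _ (hσa a (Finset.ne_of_mem_erase ha))]
  set F : (Fin r → ℝ) × (Fin r → ℝ) → ℝ := fun p =>
    H (st (Function.update p.2 b y) * (st (Function.update p.1 b x))⁻¹) with hF
  have hFm : Measurable F := by
    have hq : Measurable fun q : Equiv.Perm (Fin r) × Equiv.Perm (Fin r) => H (q.1 * q.2⁻¹) :=
      measurable_of_countable _
    exact hq.comp ((measurable_st.comp ((measurable_update_left b y).comp measurable_snd)).prodMk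
      (measurable_st.comp ((measurable_update_left b x).comp measurable_fst)))
  have hmp := measurePreserving_comp_spread hf
  have h4 : ∫ V : Fin n → ℝ, F (fun a => V (f a), fun a => V (σ (f a))) ∂unifPi (Fin n) =
      patMean H + proj H (x, y) := by
    rw [← sum_mul_bern_eq, ← integral_pattern_update H b x y, ← hmp.map_eq]
    exact (integral_map hmp.measurable.aemeasurable hFm.aestronglyMeasurable).symm
  have hFI : Integrable (fun V : Fin n → ℝ => F (fun a => V (f a), fun a => V (σ (f a))))
      (unifPi (Fin n)) := by
    refine Integrable.of_bound (hFm.comp hmp.measurable).aestronglyMeasurable (∑ π, |H π|)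
      (ae_of_all _ fun V => ?_)
    exact Finset.single_le_sum (f := fun π => |H π|) (fun _ _ => abs_nonneg _) (Finset.mem_univ _)
  have hGI : ∀ a, Integrable (fun V : Fin n → ℝ => proj H (V (f a), V (σ (f a))))
      (unifPi (Fin n)) := fun a =>
    Integrable.of_bound (hC.measurable_comp_pair _ _).aestronglyMeasurable C
      (ae_of_all _ fun V => hC.bound _)
  have h5 : ∀ V, remainder σ H f (T.piecewise V U) =
      (F (fun a => V (f a), fun a => V (σ (f a))) - (patMean H + proj H (x, y))) -
        ∑ a ∈ Finset.univ.erase b, proj H (V (f a), V (σ (f a))) := fun V => by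
    rw [remainder, geomPat, h1, h2, h3]
    simp only [hF]
    ring
  simp only [h5]
  have hFI' : Integrable (fun V : Fin n → ℝ => F (fun a => V (f a), fun a => V (σ (f a))) -
      (patMean H + proj H (x, y))) (unifPi (Fin n)) := hFI.sub (integrable_const _)
  rw [integral_sub hFI' (integrable_finsetSum _ fun a _ => hGI a),
    integral_sub hFI (integrable_const _), h4, integral_finsetSum _ fun a _ => hGI a]
  have h6 : ∀ a, ∫ V : Fin n → ℝ, proj H (V (f a), V (σ (f a))) ∂unifPi (Fin n) = 0 := fun a => by
    rw [integral_pair_unifPi hC.measurable (hf.apply_ne a a), integral_proj]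
  simp [h6]

/-- If all entries of `f'` except possibly the one at `b` are far from `f`, the vertices of their
arcs can be resampled without affecting the remainder at `f`. -/
theorem integral_remainder_mul_remainder {f f' : Fin r → Fin n} (hf' : IsSpread σ f')
    (h : ¬TwiceNear σ f f') :
    ∫ U, remainder σ H f U * remainder σ H f' U ∂unifPi (Fin n) = 0 := by
  obtain ⟨C, hC⟩ := exists_isDegenerate_proj H
  have hB : ∀ π, |H π| ≤ ∑ π, |H π| := fun π =>
    Finset.single_le_sum (f := fun π => |H π|) (fun _ _ => abs_nonneg _) (Finset.mem_univ _)
  simp only [TwiceNear, not_forall, not_exists, not_and] at h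
  obtain ⟨b, hb⟩ := h
  have hnear : ∀ a c, c ≠ b → f' c ∉ nbhd σ (f a) := fun a c hc hmem =>
    hb c hc (Finset.mem_biUnion.2 ⟨a, Finset.mem_univ _, hmem⟩)
  have h1 : ∀ a, f a ∉ otherVertices σ f' b := fun a hmem => by
    simp only [otherVertices, Finset.mem_union, Finset.mem_image, Finset.mem_erase,
      Finset.mem_univ, and_true, Function.comp] at hmem
    rcases hmem with ⟨c, hc, h⟩ | ⟨c, hc, h⟩
    · exact hnear a c hc (by simp [nbhd, h])
    · exact hnear a c hc (by simp [nbhd, ← h])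
  have h2 : ∀ a, σ (f a) ∉ otherVertices σ f' b := fun a hmem => by
    simp only [otherVertices, Finset.mem_union, Finset.mem_image, Finset.mem_erase,
      Finset.mem_univ, and_true, Function.comp] at hmem
    rcases hmem with ⟨c, hc, h⟩ | ⟨c, hc, h⟩
    · exact hnear a c hc (by simp [nbhd, h])
    · exact hnear a c hc (by simp [nbhd, σ.injective h])
  refine integral_mul_eq_zero_of_piecewise (otherVertices σ f' b) (fun U V => ?_) ?_
    (ae_of_all _ fun U => integral_remainder_piecewise hf' b U)
  · simp only [remainder, geomPat, Finset.piecewise_eq_of_notMem _ _ _ (h1 _),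
      Finset.piecewise_eq_of_notMem _ _ _ (h2 _)]
  · refine Integrable.of_bound
      ((measurable_remainder f).mul (measurable_remainder f')).aestronglyMeasurable
      ((2 * (∑ π, |H π|) + r * C) * (2 * (∑ π, |H π|) + r * C)) (ae_of_all _ fun U => ?_)
    rw [norm_mul]
    exact mul_le_mul (abs_remainder_le hB hC f U) (abs_remainder_le hB hC f' U) (norm_nonneg _)
      ((abs_nonneg _).trans (abs_remainder_le (σ := σ) hB hC f U))

/-- Each of the at most `n^r` tuples is correlated with only `O(n^(r-2))` others. -/
theorem integral_sq_sum_remainder_mul_le [NeZero r] {B C : ℝ} (hB : ∀ π, |H π| ≤ B)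
    (hC : IsDegenerate (proj H) C) :
    (∫ U, (∑ f : Fin r → Fin n with IsSpread σ f, remainder σ H f U) ^ 2 ∂unifPi (Fin n)) *
      (n : ℝ) ^ 2 ≤ (2 * B + r * C) ^ 2 * (9 * r ^ 4) * ((n : ℝ) ^ r) ^ 2 := by
  have h := integral_sq_sum_le (μ := unifPi (Fin n))
    (Finset.univ.filter fun f : Fin r → Fin n => IsSpread σ f) (remainder σ H)
    (B := 2 * B + r * C) (fun f _ => measurable_remainder f)
    (fun f _ => abs_remainder_le hB hC f) (TwiceNear σ)
    (fun f _ f' hf' hff' => integral_remainder_mul_remainder (Finset.mem_filter.1 hf').2 hff')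
  have h2 : (∑ f : Fin r → Fin n with IsSpread σ f, ((Finset.filter (fun f' => TwiceNear σ f f')
      (Finset.univ.filter fun f : Fin r → Fin n => IsSpread σ f)).card : ℝ)) * (n : ℝ) ^ 2 ≤
      9 * r ^ 4 * ((n : ℝ) ^ r) ^ 2 := by
    rw [Finset.sum_mul]
    calc _ ≤ ∑ f : Fin r → Fin n with IsSpread σ f, (9 * r ^ 4 * n ^ r : ℝ) := by
          refine Finset.sum_le_sum fun f _ => ?_
          have h3 := card_twiceNear_mul_le (σ := σ) f
          have h4 : (Finset.filter (fun f' => TwiceNear σ f f')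
              (Finset.univ.filter fun f : Fin r → Fin n => IsSpread σ f)).card ≤
              (Finset.univ.filter fun f' : Fin r → Fin n => TwiceNear σ f f').card :=
            Finset.card_le_card (Finset.filter_subset_filter _ (Finset.filter_subset _ _))
          exact_mod_cast (Nat.mul_le_mul_right _ h4).trans h3
      _ ≤ ∑ _f : Fin r → Fin n, (9 * r ^ 4 * n ^ r : ℝ) :=
          Finset.sum_le_sum_of_subset_of_nonneg (Finset.filter_subset _ _)
            fun _ _ _ => by positivity
      _ = _ := by
          simp
          ring
  calc _ ≤ _ := mul_le_mul_of_nonneg_right h (by positivity)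
    _ ≤ _ := by
      rw [mul_assoc, mul_assoc]
      exact mul_le_mul_of_nonneg_left h2 (by positivity)

/-- The sum of `H` over all patterns is, up to a deterministic error, the sum of the remainders plus
a multiple of the sum of the projections. -/
theorem abs_sum_pattern_sub_le {B C : ℝ} (hB : ∀ π, |H π| ≤ B) (hC : IsDegenerate (proj H) C)
    (U : Fin n → ℝ) :
    |(∑ f : Fin r → Fin n with Function.Injective f, (H (geomPat σ f U) - patMean H)) * n -
        (∑ f : Fin r → Fin n with IsSpread σ f, remainder σ H f U) * n -
        r * (n : ℝ) ^ r * ∑ i, edge σ (proj H) i U| ≤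
      ((2 * r ^ 2 + r) * (2 * B + r * C) + r * C) *
        (n ^ r * (1 + σ.partition.parts.count 1)) := by
  classical
  set t : ℝ := ((σ.partition.parts.count 1 : ℕ) : ℝ) with ht
  set G : Fin n → ℝ := fun i => proj H (U i, U (σ i)) with hG
  -- The projections are summed over all tuples, spread or not; `E` corrects for this and collects
  -- the pattern terms of the injective tuples that are not spread.
  set E : ℝ := ∑ f : Fin r → Fin n with ¬IsSpread σ f,
    ((if Function.Injective f then H (geomPat σ f U) - patMean H else 0) - ∑ a, G (f a)) with hE
  have hC0 := hC.bound_nonneg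
  have hB0 : 0 ≤ B := (abs_nonneg _).trans (hB 1)
  have h1 : ∑ f : Fin r → Fin n with Function.Injective f, (H (geomPat σ f U) - patMean H) =
      ∑ f : Fin r → Fin n with IsSpread σ f, remainder σ H f U + ∑ f : Fin r → Fin n, ∑ a, G (f a) +
        E := by
    rw [Finset.sum_filter, ← Finset.sum_filter_add_sum_filter_not Finset.univ (IsSpread σ)
      (fun f : Fin r → Fin n => if Function.Injective f then H (geomPat σ f U) - patMean H else 0),
      ← Finset.sum_filter_add_sum_filter_not Finset.univ (IsSpread σ)
      (fun f : Fin r → Fin n => ∑ a, G (f a)), hE, Finset.sum_sub_distrib]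
    have h2 : ∑ f : Fin r → Fin n with IsSpread σ f,
        (if Function.Injective f then H (geomPat σ f U) - patMean H else 0) =
        ∑ f : Fin r → Fin n with IsSpread σ f, remainder σ H f U +
          ∑ f : Fin r → Fin n with IsSpread σ f, ∑ a, G (f a) := by
      rw [← Finset.sum_add_distrib]
      refine Finset.sum_congr rfl fun f hf => ?_
      rw [if_pos (Finset.mem_filter.1 hf).2.injective, remainder]
      ring
    rw [h2]
    ring
  have h3 : (∑ f : Fin r → Fin n, ∑ a, G (f a)) * n = r * (n : ℝ) ^ r * ∑ i, G i := by
    rw [Finset.sum_comm, Finset.sum_mul]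
    simp only [sum_apply_mul]
    simp
    ring
  -- The two sums differ exactly by the loops, which `edge` discards.
  have h4 : |∑ i, G i - ∑ i, edge σ (proj H) i U| ≤ C * t := by
    rw [← Finset.sum_sub_distrib]
    have h5 : ∀ i, G i - edge σ (proj H) i U = if σ i = i then G i else 0 := fun i => by
      rw [edge]
      split_ifs <;> simp [hG]
    simp only [h5]
    rw [← Finset.sum_filter]
    refine (Finset.abs_sum_le_sum_abs _ _).trans
      ((Finset.sum_le_sum fun i _ => hC.bound _).trans (le_of_eq ?_))
    rw [Finset.sum_const, nsmul_eq_mul, ht, count_one_partition, mul_comm]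
  have h6 : |E| * n ≤ (2 * r ^ 2 + r * t) * n ^ r * (2 * B + r * C) := by
    have h7 : |E| ≤ ((Finset.univ.filter fun f : Fin r → Fin n => ¬IsSpread σ f).card : ℝ) *
        (2 * B + r * C) := by
      rw [hE, ← nsmul_eq_mul, ← Finset.sum_const]
      refine (Finset.abs_sum_le_sum_abs _ _).trans (Finset.sum_le_sum fun f _ => ?_)
      refine (abs_sub _ _).trans (add_le_add ?_ ?_)
      · split_ifs
        · have := abs_sub (H (geomPat σ f U)) (patMean H)
          linarith [hB (geomPat σ f U), abs_patMean_le hB]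
        · simpa using hB0
      · refine (Finset.abs_sum_le_sum_abs _ _).trans
          ((Finset.sum_le_sum fun a _ => hC.bound _).trans ?_)
        simp
    have h8 : ((Finset.univ.filter fun f : Fin r → Fin n => ¬IsSpread σ f).card : ℝ) * n ≤
        (2 * r ^ 2 + r * t) * n ^ r := by
      rw [ht]
      exact_mod_cast card_not_isSpread_mul_le (σ := σ) (r := r)
    calc |E| * n ≤ _ := mul_le_mul_of_nonneg_right h7 (Nat.cast_nonneg n)
      _ = (((Finset.univ.filter fun f : Fin r → Fin n => ¬IsSpread σ f).card : ℝ) * n) *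
          (2 * B + r * C) := by ring
      _ ≤ _ := mul_le_mul_of_nonneg_right h8 (by positivity)
  have h9 : (∑ f : Fin r → Fin n with Function.Injective f,
      (H (geomPat σ f U) - patMean H)) * n -
      (∑ f : Fin r → Fin n with IsSpread σ f, remainder σ H f U) * n -
      r * (n : ℝ) ^ r * ∑ i, edge σ (proj H) i U =
      r * (n : ℝ) ^ r * (∑ i, G i - ∑ i, edge σ (proj H) i U) + E * n := by
    rw [h1, add_mul, add_mul, h3]
    ring
  have ht0 : 0 ≤ t := Nat.cast_nonneg _
  rw [h9]
  refine (abs_add_le _ _).trans ?_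
  rw [abs_mul, abs_mul E, Nat.abs_cast, abs_of_nonneg (by positivity : (0 : ℝ) ≤ r * (n : ℝ) ^ r)]
  have h10 := mul_le_mul_of_nonneg_left h4 (by positivity : (0 : ℝ) ≤ r * (n : ℝ) ^ r)
  have hBC : 0 ≤ 2 * B + r * C := by positivity
  have h11 : (2 * r ^ 2 + r * t) * n ^ r * (2 * B + r * C) ≤
      (2 * r ^ 2 + r) * (2 * B + r * C) * (n ^ r * (1 + t)) := by
    have : (2 * r ^ 2 + r * t : ℝ) ≤ (2 * r ^ 2 + r) * (1 + t) := by nlinarith [sq_nonneg (r : ℝ)]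
    calc _ ≤ ((2 * r ^ 2 + r) * (1 + t)) * n ^ r * (2 * B + r * C) := by gcongr
      _ = _ := by ring
  have h12 : r * (n : ℝ) ^ r * (C * t) ≤ r * C * (n ^ r * (1 + t)) := by
    calc _ = r * C * (n ^ r * t) := by ring
      _ ≤ _ := by gcongr; linarith
  linarith

end Projection

/-! ### Convergence of characteristic functions. -/

section Assembly

variable {n r : ℕ} {σ : Equiv.Perm (Fin n)} {H : Equiv.Perm (Fin r) → ℝ}

theorem edge_const_mul (c : ℝ) (g : ℝ × ℝ → ℝ) (i : Fin n) (U : Fin n → ℝ) :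
    edge σ (fun z => c * g z) i U = c * edge σ g i U := by
  unfold edge
  split_ifs <;> simp

theorem IsDegenerate.const_mul {g : ℝ × ℝ → ℝ} {C : ℝ} (hg : IsDegenerate g C) (c : ℝ) :
    IsDegenerate (fun z => c * g z) (|c| * C) where
  measurable := hg.measurable.const_mul c
  bound z := by
    rw [abs_mul]
    exact mul_le_mul_of_nonneg_left (hg.bound z) (abs_nonneg c)
  integral_snd x := by rw [integral_const_mul, hg.integral_snd, mul_zero]
  integral_fst y := by rw [integral_const_mul, hg.integral_fst, mul_zero]

/-- The linear combination with coefficients `H` of the rescaled pattern counts of the permutation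
constructed from the points `U`. -/
noncomputable def normalizedComb (σ : Equiv.Perm (Fin n)) (H : Equiv.Perm (Fin r) → ℝ)
    (U : Fin n → ℝ) : ℝ :=
  ∑ π, H π * (((patternCount π (st U * σ * (st U)⁻¹) : ℝ) - (n.choose r : ℝ) / (r.factorial : ℝ)) /
    (n : ℝ) ^ ((r : ℝ) - 1 / 2))

/-- The function whose edge sum governs the fluctuations of `normalizedComb`. -/
noncomputable def limitKernel (H : Equiv.Perm (Fin r) → ℝ) (z : ℝ × ℝ) : ℝ :=
  1 / (r - 1).factorial * proj H z

/-- This is `abs_sum_pattern_sub_le` divided by `r! n^r √n`; the quotient `r / r!` accounts for the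
factor in `limitKernel`. -/
theorem abs_normalizedComb_sub_le [NeZero r] (hn : 0 < n) {B C : ℝ} (hB : ∀ π, |H π| ≤ B)
    (hC : IsDegenerate (proj H) C) {U : Fin n → ℝ} (hU : Function.Injective U) :
    |normalizedComb σ H U - 1 / √n * ∑ i, edge σ (limitKernel H) i U -
        √n / (r.factorial * (n : ℝ) ^ r) *
          ∑ f : Fin r → Fin n with IsSpread σ f, remainder σ H f U| ≤
      ((2 * r ^ 2 + r) * (2 * B + r * C) + r * C) * (1 + σ.partition.parts.count 1) / √n := by
  have hn' : (0 : ℝ) < n := by exact_mod_cast hn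
  have h := abs_sum_pattern_sub_le (σ := σ) hB hC U
  rw [patMean, ← sum_mul_patternCount_conj hU σ H] at h
  set X := ∑ π, H π *
        ((patternCount π (st U * σ * (st U)⁻¹) : ℝ) - (n.choose r : ℝ) / (r.factorial : ℝ)) with hX
  set R := ∑ f : Fin r → Fin n with IsSpread σ f, remainder σ H f U
  set S := ∑ i, edge σ (proj H) i U with hS
  set K := (2 * r ^ 2 + r) * (2 * B + r * C) + r * C
  set t : ℝ := ((σ.partition.parts.count 1 : ℕ) : ℝ)
  set s := √(n : ℝ) with hs
  have hs0 : 0 < s := Real.sqrt_pos.2 hn'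
  have hs2 : s * s = n := Real.mul_self_sqrt hn'.le
  have hpow : (n : ℝ) ^ ((r : ℝ) - 1 / 2) = (n : ℝ) ^ r / s := by
    rw [Real.rpow_sub hn', Real.rpow_natCast, hs, Real.sqrt_eq_rpow]
  have hW : normalizedComb σ H U = X * s / (n : ℝ) ^ r := by
    simp only [normalizedComb, hpow, hX, Finset.sum_mul, Finset.sum_div]
    refine Finset.sum_congr rfl fun π _ => ?_
    field_simp
  have hSS : ∑ i, edge σ (limitKernel H) i U = 1 / (r - 1).factorial * S := by
    rw [hS, Finset.mul_sum]
    exact Finset.sum_congr rfl fun i _ => edge_const_mul _ _ _ _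
  have hfac : (r.factorial : ℝ) = r * (r - 1).factorial := by
    exact_mod_cast (Nat.mul_factorial_pred (NeZero.ne r)).symm
  have hr0 : (r : ℝ) ≠ 0 := NeZero.ne _
  have hf0 : (0 : ℝ) < r.factorial := by positivity
  have hkey : normalizedComb σ H U - 1 / s * ∑ i, edge σ (limitKernel H) i U -
      s / (r.factorial * (n : ℝ) ^ r) * R =
      (r.factorial * X * n - R * n - r * (n : ℝ) ^ r * S) / (s * r.factorial * (n : ℝ) ^ r) := by
    rw [hW, hSS, ← hs2, hfac]
    have : (s * s) ^ r ≠ 0 := by positivity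
    field_simp
    ring
  rw [hkey, abs_div, abs_of_pos (by positivity : 0 < s * r.factorial * (n : ℝ) ^ r),
    div_le_div_iff₀ (by positivity) hs0]
  have hnn : 0 ≤ K * ((n : ℝ) ^ r * (1 + t)) := (abs_nonneg _).trans h
  have h1 : (1 : ℝ) ≤ r.factorial := by exact_mod_cast Nat.one_le_iff_ne_zero.2 (Nat.factorial_ne_zero r)
  calc _ ≤ K * ((n : ℝ) ^ r * (1 + t)) * s := mul_le_mul_of_nonneg_right h hs0.le
    _ ≤ K * ((n : ℝ) ^ r * (1 + t)) * s * r.factorial :=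
        le_mul_of_one_le_right (mul_nonneg hnn hs0.le) h1
    _ = _ := by ring

theorem norm_exp_mul_I_sub_le (a b : ℝ) :
    ‖Complex.exp (a * Complex.I) - Complex.exp (b * Complex.I)‖ ≤ |a - b| := by
  have h : Complex.exp (a * Complex.I) - Complex.exp (b * Complex.I) =
      Complex.exp (b * Complex.I) * (Complex.exp (Complex.I * ((a - b : ℝ) : ℂ)) - 1) := by
    rw [mul_sub, ← Complex.exp_add, mul_one]
    congr 2
    push_cast
    ring
  rw [h, norm_mul, Complex.norm_exp_ofReal_mul_I, one_mul]
  exact Real.norm_exp_I_mul_ofReal_sub_one_le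

theorem measurable_conj_st (σ : Equiv.Perm (Fin n)) :
    Measurable fun U : Fin n → ℝ => st U * σ * (st U)⁻¹ :=
  (measurable_from_top (f := fun ρ : Equiv.Perm (Fin n) => ρ * σ * ρ⁻¹)).comp measurable_st

theorem measurable_normalizedComb : Measurable (normalizedComb σ H) :=
  (measurable_from_top (f := fun τ : Equiv.Perm (Fin n) => ∑ π, H π *
    (((patternCount π τ : ℝ) - (n.choose r : ℝ) / (r.factorial : ℝ)) /
    (n : ℝ) ^ ((r : ℝ) - 1 / 2)))).comp (measurable_conj_st σ)

/-- The map `a ↦ exp (ia)` is 1-Lipschitz. The deterministic error is bounded pathwise, and the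
remainder through its second moment, by the same weighted inequality as in the central limit
theorem. -/
theorem norm_charFun_normalizedComb_sub_le [NeZero r] (hn : 0 < n) {B C : ℝ}
    (hB : ∀ π, |H π| ≤ B) (hC : IsDegenerate (proj H) C) :
    ‖∫ U, Complex.exp (normalizedComb σ H U * Complex.I) ∂unifPi (Fin n) -
        ∫ U, Complex.exp (((1 / √n) * ∑ i, edge σ (limitKernel H) i U : ℝ) * Complex.I)
          ∂unifPi (Fin n)‖ ≤
      (((2 * r ^ 2 + r) * (2 * B + r * C) + r * C) * (1 + σ.partition.parts.count 1) + 1 +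
        (2 * B + r * C) ^ 2 * (9 * r ^ 4)) / √n := by
  have hn' : (0 : ℝ) < n := by exact_mod_cast hn
  set s := √(n : ℝ) with hs
  have hs0 : 0 < s := Real.sqrt_pos.2 hn'
  have hs2 : s ^ 2 = n := Real.sq_sqrt hn'.le
  set R : (Fin n → ℝ) → ℝ := fun U =>
    ∑ f : Fin r → Fin n with IsSpread σ f, remainder σ H f U with hR
  set K := ((2 * r ^ 2 + r) * (2 * B + r * C) + r * C) *
    (1 + ((σ.partition.parts.count 1 : ℕ) : ℝ))
  set c := (2 * B + r * C) ^ 2 * (9 * (r : ℝ) ^ 4)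
  set a := s / (r.factorial * (n : ℝ) ^ r) with ha
  have hRm : Measurable R := Finset.measurable_fun_sum _ fun f _ => measurable_remainder f
  have hR2 : Integrable (fun U => R U ^ 2) (unifPi (Fin n)) := by
    refine Integrable.of_bound (hRm.pow_const 2).aestronglyMeasurable
      ((∑ f : Fin r → Fin n with IsSpread σ f, (2 * B + r * C)) ^ 2) (ae_of_all _ fun U => ?_)
    rw [norm_pow]
    exact pow_le_pow_left₀ (norm_nonneg _) ((Finset.abs_sum_le_sum_abs _ _).trans
      (Finset.sum_le_sum fun f _ => abs_remainder_le hB hC f U)) 2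
  have hvar := integral_sq_sum_remainder_mul_le (σ := σ) hB hC
  have hgm := ((hC.const_mul (1 / (r - 1).factorial)) : IsDegenerate (limitKernel H) _)
  have hi1 : Integrable (fun U => Complex.exp (normalizedComb σ H U * Complex.I))
      (unifPi (Fin n)) :=
    Integrable.of_bound ((Complex.measurable_ofReal.comp
      measurable_normalizedComb).mul_const _).cexp.aestronglyMeasurable 1
      (ae_of_all _ fun U => by rw [Complex.norm_exp_ofReal_mul_I])
  have hi2 : Integrable (fun U => Complex.exp
      (((1 / s) * ∑ i, edge σ (limitKernel H) i U : ℝ) * Complex.I)) (unifPi (Fin n)) :=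
    Integrable.of_bound ((Complex.measurable_ofReal.comp
      ((Finset.measurable_fun_sum _ fun i _ =>
        hgm.measurable_edge i).const_mul _)).mul_const _).cexp.aestronglyMeasurable 1
      (ae_of_all _ fun U => by rw [Complex.norm_exp_ofReal_mul_I])
  rw [← integral_sub hi1 hi2]
  have hpt : ∀ᵐ U ∂unifPi (Fin n), ‖Complex.exp (normalizedComb σ H U * Complex.I) -
      Complex.exp (((1 / s) * ∑ i, edge σ (limitKernel H) i U : ℝ) * Complex.I)‖ ≤
      (K / s + 1 / s) + s * a ^ 2 * R U ^ 2 := by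
    filter_upwards [ae_injective_unifPi] with U hU
    refine (norm_exp_mul_I_sub_le _ _).trans ?_
    have h1 : |normalizedComb σ H U - 1 / s * ∑ i, edge σ (limitKernel H) i U - a * R U| ≤ K / s :=
      abs_normalizedComb_sub_le hn hB hC hU
    have h2 : |a * R U| ≤ 1 / s + s * a ^ 2 * R U ^ 2 := by
      have : 1 / s + s * a ^ 2 * R U ^ 2 - |a * R U| =
          s * (|a * R U| - 1 / (2 * s)) ^ 2 + 3 / (4 * s) := by
        have h3 : s * a ^ 2 * R U ^ 2 = s * |a * R U| ^ 2 := by rw [sq_abs]; ring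
        rw [h3]
        field_simp
        ring
      have h4 : 0 ≤ s * (|a * R U| - 1 / (2 * s)) ^ 2 + 3 / (4 * s) := by positivity
      linarith
    have h3 := abs_add_le (normalizedComb σ H U - 1 / s * ∑ i, edge σ (limitKernel H) i U - a * R U)
      (a * R U)
    rw [sub_add_cancel] at h3
    linarith
  refine (norm_integral_le_of_norm_le ((integrable_const _).add (hR2.const_mul _)) hpt).trans ?_
  rw [integral_add' (integrable_const _) (hR2.const_mul _), integral_const_mul]
  simp only [integral_const, probReal_univ, one_smul]
  have h5 : s * a ^ 2 * ∫ U, R U ^ 2 ∂unifPi (Fin n) ≤ c / s := by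
    have h1 : (1 : ℝ) ≤ (r.factorial : ℝ) ^ 2 := by
      exact_mod_cast Nat.one_le_pow _ _ (Nat.factorial_pos r)
    have h6 : s * a ^ 2 * ∫ U, R U ^ 2 ∂unifPi (Fin n) =
        ((∫ U, R U ^ 2 ∂unifPi (Fin n)) * (n : ℝ) ^ 2) /
          ((r.factorial : ℝ) ^ 2 * ((n : ℝ) ^ r) ^ 2 * s) := by
      rw [ha, ← hs2]
      have : (s ^ 2) ^ r ≠ 0 := by positivity
      field_simp
    rw [h6, div_le_div_iff₀ (by positivity) hs0]
    have hc : 0 ≤ c := by positivity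
    calc _ ≤ c * ((n : ℝ) ^ r) ^ 2 * s := mul_le_mul_of_nonneg_right hvar hs0.le
      _ ≤ c * ((n : ℝ) ^ r) ^ 2 * s * (r.factorial : ℝ) ^ 2 :=
          le_mul_of_one_le_right (by positivity) h1
      _ = _ := by ring
  have h7 : (K + 1 + c) / s = K / s + 1 / s + c / s := by ring
  rw [h7]
  linarith

theorem integral_limitKernel_sq : ∫ z, limitKernel H z * limitKernel H z ∂unifSq =
    gram r (centeredComb r H) (centeredComb r H) / ((r - 1).factorial : ℝ) ^ 4 := by
  rw [gram_apply, ← integral_div]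
  congr 1
  ext z
  simp only [limitKernel, proj]
  field_simp

theorem integral_limitKernel_swap : ∫ z, limitKernel H z * limitKernel H z.swap ∂unifSq =
    gram r (centeredComb r H) (centeredComb r H).transpose / ((r - 1).factorial : ℝ) ^ 4 := by
  rw [gram_apply, ← integral_div]
  congr 1
  ext z
  simp only [limitKernel, proj, bernForm_swap]
  field_simp

theorem tendsto_charFun_normalizedComb [NeZero r] {p : ℝ} (hp : p ∈ Set.Icc (0 : ℝ) 1)
    (H : Equiv.Perm (Fin r) → ℝ) (σ : (n : ℕ) → Equiv.Perm (Fin n))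
    (h1 : (fun n => ((σ n).partition.parts.count 1 : ℝ)) =o[atTop] fun n : ℕ => √(n : ℝ))
    (h2 : (fun n => 2 * ((σ n).partition.parts.count 2 : ℝ) - n * p) =o[atTop]
      fun n : ℕ => (n : ℝ)) :
    Tendsto (fun n => ∫ U, Complex.exp (normalizedComb (σ n) H U * Complex.I) ∂unifPi (Fin n)) atTop
      (𝓝 ((Real.exp (-(dotProduct H (Matrix.mulVec (sigma r p) H) / 2)) : ℝ) : ℂ)) := by
  obtain ⟨C, hC⟩ := exists_isDegenerate_proj H
  have hB : ∀ π, |H π| ≤ ∑ π, |H π| := fun π =>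
    Finset.single_le_sum (f := fun π => |H π|) (fun _ _ => abs_nonneg _) (Finset.mem_univ _)
  set B := ∑ π, |H π|
  obtain ⟨C', hC'⟩ : ∃ C', IsDegenerate (limitKernel H) C' := ⟨_, hC.const_mul _⟩
  set v := dotProduct H (Matrix.mulVec (sigma r p) H) with hv
  have hveq : v = ∫ z, limitKernel H z * limitKernel H z ∂unifSq +
      p * ∫ z, limitKernel H z * limitKernel H z.swap ∂unifSq := by
    rw [hv, dotProduct_sigma_mulVec, twistedVar, integral_limitKernel_sq, integral_limitKernel_swap]
    ring
  set A := ∫ z, limitKernel H z * limitKernel H z ∂unifSq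
  set D := ∫ z, limitKernel H z * limitKernel H z.swap ∂unifSq
  have hv0 : 0 ≤ v := by
    rw [hv, dotProduct_sigma_mulVec]
    exact div_nonneg (twistedVar_nonneg hp _) (by positivity)
  set K := max v (4 * C' ^ 2)
  set K₀ := (2 * (r : ℝ) ^ 2 + r) * (2 * B + r * C) + r * C
  set c := (2 * B + r * C) ^ 2 * (9 * (r : ℝ) ^ 4)
  set t₁ : ℕ → ℝ := fun n => ((σ n).partition.parts.count 1 : ℝ) with ht₁
  set t₂ : ℕ → ℝ := fun n => ((σ n).partition.parts.count 2 : ℝ) with ht₂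
  have hsqrt : Tendsto (fun n : ℕ => √(n : ℝ)) atTop atTop :=
    Real.tendsto_sqrt_atTop.comp tendsto_natCast_atTop_atTop
  have hinv : Tendsto (fun n : ℕ => 1 / √(n : ℝ)) atTop (𝓝 0) := by
    simp only [one_div]
    exact tendsto_inv_atTop_zero.comp hsqrt
  have hq1 : Tendsto (fun n => t₁ n / √(n : ℝ)) atTop (𝓝 0) := h1.tendsto_div_nhds_zero
  have hq2 : Tendsto (fun n => (2 * t₂ n - n * p) / (n : ℝ)) atTop (𝓝 0) :=
    h2.tendsto_div_nhds_zero
  have hq3 : Tendsto (fun n : ℕ => |(2 * t₂ n - n * p) / (n : ℝ) * D -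
      t₁ n / √(n : ℝ) * (1 / √(n : ℝ)) * A|) atTop (𝓝 0) := by
    simpa using ((hq2.mul_const D).sub ((hq1.mul hinv).mul_const A)).abs
  have hlim : Tendsto (fun n : ℕ => (K₀ * (1 / √(n : ℝ) + t₁ n / √(n : ℝ)) + (1 + c) * (1 / √(n : ℝ))) +
      Real.exp K * ((1 + 144 * C' ^ 4 + 16 * C' ^ 3) * (1 / √(n : ℝ)) +
        |(2 * t₂ n - n * p) / (n : ℝ) * D - t₁ n / √(n : ℝ) * (1 / √(n : ℝ)) * A|))
      atTop (𝓝 0) := by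
    have := (((hinv.add hq1).const_mul K₀).add (hinv.const_mul (1 + c))).add
      (((hinv.const_mul (1 + 144 * C' ^ 4 + 16 * C' ^ 3)).add hq3).const_mul (Real.exp K))
    simpa using this
  rw [tendsto_iff_norm_sub_tendsto_zero]
  refine squeeze_zero' (Eventually.of_forall fun _ => norm_nonneg _) ?_ hlim
  filter_upwards [eventually_gt_atTop 0, hsqrt.eventually_ge_atTop (4 * C')] with n hn hnC
  have hn' : (0 : ℝ) < n := by exact_mod_cast hn
  have hs0 : 0 < √(n : ℝ) := Real.sqrt_pos.2 hn'
  have hs2 : √(n : ℝ) * √(n : ℝ) = n := Real.mul_self_sqrt hn'.le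
  have e1 := norm_charFun_normalizedComb_sub_le (σ := σ n) hn hB hC
  have e2 := hC'.norm_charFun_edge_sum_sub_le (σ := σ n) hn hnC hv0 (le_max_left v (4 * C' ^ 2))
    (le_max_right _ _)
  rw [hC'.sum_integral_increment_sq] at e2
  -- The normalized variance differs from `v` only through `t₁ / n` and `2 t₂ / n - p`, which the
  -- hypotheses make vanish.
  have e3 : ((n - t₁ n) * A + 2 * t₂ n * D) / n - v =
      (2 * t₂ n - n * p) / (n : ℝ) * D - t₁ n / √(n : ℝ) * (1 / √(n : ℝ)) * A := by
    have : t₁ n / √(n : ℝ) * (1 / √(n : ℝ)) = t₁ n / n := by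
      rw [div_mul_div_comm, mul_one, hs2]
    rw [this, hveq]
    field_simp
    ring
  have e4 : |((n - t₁ n) * A + 2 * t₂ n * D) / n - v| = _ := congrArg abs e3
  rw [e4] at e2
  refine (norm_sub_le_norm_sub_add_norm_sub _ _ _).trans (add_le_add (e1.trans (le_of_eq ?_))
    (e2.trans (le_of_eq ?_)))
  · ring
  · ring

theorem inner_normalizedCounts (τ : Equiv.Perm (Fin n)) (s : EuclideanSpace ℝ (Equiv.Perm (Fin r))) :
    inner ℝ (normalizedCounts r τ) s = ∑ π, s π *
      (((patternCount π τ : ℝ) - (n.choose r : ℝ) / (r.factorial : ℝ)) /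
        (n : ℝ) ^ ((r : ℝ) - 1 / 2)) := by
  simp [normalizedCounts, PiLp.inner_apply]

/-- The Cramér–Wold reduction: the argument `s` of the characteristic function supplies the
coefficients `H`. -/
theorem charFun_map_normalizedCounts {t : n.Partition} (hσ : σ.partition.parts = t.parts)
    (s : EuclideanSpace ℝ (Equiv.Perm (Fin r))) :
    charFun ((uniformCyclic t).map (normalizedCounts r)) s =
      ∫ U, Complex.exp (normalizedComb σ (fun π => s π) U * Complex.I) ∂unifPi (Fin n) := by
  have hm : Measurable (normalizedCounts r : Equiv.Perm (Fin n) → _) := measurable_from_top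
  rw [charFun_apply, integral_map hm.aemeasurable (by fun_prop), uniformCyclic_eq_map hσ,
    integral_map (measurable_conj_st σ).aemeasurable
      (measurable_from_top (f := fun τ : Equiv.Perm (Fin n) =>
        Complex.exp ((inner ℝ (normalizedCounts r τ) s : ℝ) * Complex.I))).aestronglyMeasurable]
  simp only [inner_normalizedCounts]
  rfl

end Assembly

end PatternCLT

open Filter Asymptotics MeasureTheory ProbabilityTheory in
theorem mainTheorem9 (r : ℕ) (hr : 1 ≤ r) (p₂ : ℝ) (hp₂ : p₂ ∈ Set.Icc (0 : ℝ) 1) :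
    (∀ (t : (n : ℕ) → n.Partition)
        (_ : (fun n => ((t n).parts.count 1 : ℝ)) =o[atTop] fun n : ℕ => √(n : ℝ))
        (_ : (fun n => 2 * ((t n).parts.count 2 : ℝ) - n * p₂) =o[atTop] fun n : ℕ => (n : ℝ))
        (Ω : ℕ → Type*) [∀ n, MeasurableSpace (Ω n)] (P : (n : ℕ) → Measure (Ω n))
        [∀ n, IsProbabilityMeasure (P n)] (τ : (n : ℕ) → Ω n → Equiv.Perm (Fin n))
        (_ : ∀ n, HasLaw (τ n) (PatternCLT.uniformCyclic (t n)) (P n)),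
        TendstoInDistribution (fun n ω => PatternCLT.normalizedCounts r (τ n ω)) atTop id P
          (multivariateGaussian 0 (PatternCLT.sigma r p₂))) ∧
      (PatternCLT.sigma r p₂).PosSemidef ∧
      (p₂ < 1 → (PatternCLT.sigma r p₂).rank = (r - 1) ^ 2) ∧
      (p₂ = 1 → (PatternCLT.sigma r p₂).rank = r * (r - 1) / 2) ∧
      (2 ≤ r → ∀ π : Equiv.Perm (Fin r), 0 < PatternCLT.sigma r p₂ π π) := by
  have : NeZero r := ⟨by omega⟩
  refine ⟨?_, PatternCLT.posSemidef_sigma hp₂,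
    fun h => PatternCLT.rank_sigma_of_lt ⟨hp₂.1, h⟩,
    fun h => h ▸ PatternCLT.rank_sigma_one, fun h π => PatternCLT.sigma_diag_pos hp₂ h π⟩
  intro t h1 h2 Ω _ P _ τ hτ
  -- Only the law of `τ n` matters, and it is that of a random conjugate of any fixed representative
  -- `σ n`.
  choose σ hσ using fun n => PatternCLT.exists_perm_partition_eq (t n)
  have hm : ∀ n, Measurable (PatternCLT.normalizedCounts r : Equiv.Perm (Fin n) → _) :=
    fun n => measurable_from_top
  refine ⟨fun n => (hm n).comp_aemeasurable (hτ n).aemeasurable, aemeasurable_id, ?_⟩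
  refine ProbabilityMeasure.tendsto_iff_tendsto_charFun.2 fun s => ?_
  have hlaw : ∀ n, (P n).map (fun ω => PatternCLT.normalizedCounts r (τ n ω)) =
      (PatternCLT.uniformCyclic (t n)).map (PatternCLT.normalizedCounts r) := fun n => by
    rw [← (hτ n).map_eq, AEMeasurable.map_map_of_aemeasurable (hm n).aemeasurable
      (hτ n).aemeasurable]
    rfl
  simp only [ProbabilityMeasure.coe_mk, hlaw, Measure.map_id,
    charFun_multivariateGaussian (PatternCLT.posSemidef_sigma hp₂)]
  simp only [fun n => PatternCLT.charFun_map_normalizedCounts (hσ n) s]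
  simp only [← hσ] at h1 h2
  have := PatternCLT.tendsto_charFun_normalizedComb hp₂ (fun π => s π) σ h1 h2
  refine this.trans (le_of_eq ?_)
  congr 1
  rw [Complex.ofReal_exp]
  simp
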